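/- Setting. Let $d\ge 1$, and let $y=(y_j)_{j\ge1}$ be a sequence of independent random variables, each uniformly distributed on $[-1,1]$. For functions $\psi_j$ on an open set $\mathscr B\subset\mathbb R^d$ put $\kappa(x,y)=\lim_{N\to\infty}\sum_{j=1}^N\psi_j(x)\,y_j$, $a(x,y)=e^{\kappa(x,y)}$, $a_{\max}(y)=\|a(\cdot,y)\|_{L^\infty(\mathscr B)}$ and $a_{\min}(y)=1/\|a(\cdot,y)^{-1}\|_{L^\infty(\mathscr B)}$. (A) Let $\mathscr B\subset\mathbb R^d$ be a nonempty bounded open set with Lipschitz boundary, let $s\ge1$ be an integer, let $\psi_j\in C^s(\overline{\mathscr B})$ be real valued, and let $b_{s,j}=\max_{|i|\le s}\|D^i\psi_j\|_{L^\infty(\mathscr B)}$. If $\sum_j b_{s,j}^2<\infty$, then almost surely the series defining $\kappa(x,y)$ converges for every $x\in\mathscr B$, and $0<a_{\min}(y)\le a(x,y)\le a_{\max}(y)<\infty$ for every $x\in\mathscr B$; moreover $$\mathbb E\big[\|a\|^p_{W^{\upsilon,\infty}(\mathscr B)}\big]<\infty\qquad\text{for all real }1\le p<\infty\text{ and all real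 }0\le\upsilon<s,$$ and $\mathbb E[a_{\max}^p]<\infty$ and $\mathbb E[a_{\min}^{-p}]<\infty$ for all $1\le p<\infty$. Here, with $k=\lfloor\upsilon\rfloor$, the norm of $W^{\upsilon,\infty}(\mathscr B)$ is the maximum of the $L^\infty$ norms of the weak derivatives of order at most $k$ and, if $\upsilon\notin\mathbb N$, of the seminorms $\operatorname{ess\,sup}_{x,x'\in\mathscr B}|D^if(x)-D^if(x')|/|x-x'|^{\upsilon-k}$, $|i|=k$. (B) (Log-uniform example.) Let $\mathscr B=(0,1)^d$. There is a constant $C$, depending only on $d$, such that the following holds for every $\nu>0$. Let $$\kappa(x,y)=\sum_{k\in\mathbb N^d}A_k\sum_{\ell\in\{0,1\}^d}y_{k,\ell}\prod_{i=1}^d\cos(\pi k_ix_i)^{\ell_i}\sin(\pi k_ix_i)^{1-\ell_i},\qquad A_k=\sqrt3\,2^{|k|_0/2}(1+|k|^2)^{-\frac{\nu+d/2}{2}},$$ where $|k|=\sum_ik_i$, $|k|_0$ is the number of nonzero $k_i$, and the index set of the pairs $(k,\ell)$ is enumerated by any bijection with the positive integers, so that $\kappa$ has the form above. Then almost surely the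 series converges for every $x\in\mathscr B$ and $0<a_{\min}(y)\le a(x,y)\le a_{\max}(y)<\infty$ for every $x\in\mathscr B$; the random variables $a_{\max}$ and $1/a_{\min}$ have finite moments of all orders $p\ge1$; and for every $\varsigma\in H^{-1}(\mathscr B)=H^1_0(\mathscr B)'$ the problem $$-\operatorname{div}(a(\cdot,y)\nabla u(\cdot,y))=\varsigma\ \text{ in }\mathscr B,\qquad u(\cdot,y)=0\ \text{ on }\partial\mathscr B,$$ has, for almost every $y$, a weak solution $u(\cdot,y)\in H^1_0(\mathscr B)$, unique up to equality for almost every $y$; for all $1\le p<\infty$ one has $u\in L^p(\Gamma;H^1_0(\mathscr B))$, where $\Gamma=[-1,1]^{\mathbb N}$ carries the law of $y$, and $$\|u\|_{L^p(\Gamma;H^1_0(\mathscr B))}\le C\,\mathbb E\big[a_{\min}^{-p}\big]^{1/p}\,\|\varsigma\|_{H^{-1}(\mathscr B)}.$$ -/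

import Mathlib

open MeasureTheory Filter Topology
open scoped ENNReal NNReal ContDiff

noncomputable section

namespace RandomDiffusion

/-- The Euclidean space `ℝ^d`. -/
abbrev Space (d : ℕ) : Type := EuclideanSpace ℝ (Fin d)

/-! ### The parameter space -/

/-- The uniform probability measure `dλ / 2` on `[-1, 1]`. -/
def unif : Measure ℝ := (2⁻¹ : ℝ≥0∞) • volume.restrict (Set.Icc (-1 : ℝ) 1)

instance : IsProbabilityMeasure unif := by
  constructor
  simp only [unif, Measure.smul_apply, Measure.restrict_apply_univ, Real.volume_Icc, smul_eq_mul]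
  norm_num
  exact ENNReal.inv_mul_cancel (by norm_num) (by norm_num)

/-- The law of a sequence of independent random variables, all uniform on `[-1, 1]`: the
countable product of the measures `dλ / 2`. -/
def paramLaw : Measure (ℕ → ℝ) := Measure.infinitePi (fun _ : ℕ => unif)

/-- `X ≥ 0` is a random variable with `E[X ^ p] < ∞`. -/
def HasFiniteMoment (X : (ℕ → ℝ) → ℝ≥0∞) (p : ℝ) : Prop :=
  AEMeasurable X paramLaw ∧ ∫⁻ y, X y ^ p ∂paramLaw < ⊤

/-! ### Domains, derivatives and function spaces -/

variable {d : ℕ}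

/-- The set `B` has a Lipschitz boundary: near each of its boundary points it is, in suitable
orthonormal coordinates whose last axis is spanned by the unit vector `e`, the set of points
strictly above the graph of a Lipschitz function of the other coordinates.  That `γ` is a function
of the other coordinates only is expressed by its invariance under translations along `e`. -/
def HasLipschitzBoundary (B : Set (Space d)) : Prop :=
  ∀ x₀ ∈ frontier B, ∃ r : ℝ, 0 < r ∧ ∃ e : Space d, ‖e‖ = 1 ∧
    ∃ (L : ℝ≥0) (γ : Space d → ℝ), LipschitzWith L γ ∧
      (∀ (x : Space d) (t : ℝ), γ (x + t • e) = γ x) ∧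
      ∀ x ∈ Metric.ball x₀ r, (x ∈ B ↔ γ x < inner ℝ x e)

/-- The classical partial derivative `∂_{w 0} ⋯ ∂_{w (m-1)} f` of order `m`.  Partial derivatives
of order `m` are indexed by the words `w` of length `m` in the coordinate indices; the derivative
`D^i` of a multi-index `i` with `|i| = m` is the one for any word in which each `l` occurs `i l`
times. -/
def pderiv {m : ℕ} (w : Fin m → Fin d) (f : Space d → ℝ) (x : Space d) : ℝ :=
  iteratedFDeriv ℝ m f x (fun l => EuclideanSpace.single (w l) (1 : ℝ))

/-- `f ∈ C^s(closure B)`, for `B` open: `f` is of class `C^s` in `B`, and its derivatives of all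
orders up to `s` extend continuously to the closure of `B`. -/
def IsCsOnClosure (B : Set (Space d)) (s : ℕ) (f : Space d → ℝ) : Prop :=
  ContDiffOn ℝ s f B ∧ ∀ m : ℕ, m ≤ s → ∀ w : Fin m → Fin d,
    ∃ g : Space d → ℝ, ContinuousOn g (closure B) ∧ Set.EqOn (pderiv w f) g B

/-- The norm of `L^∞(B)`. -/
def supNorm (B : Set (Space d)) (f : Space d → ℝ) : ℝ≥0∞ :=
  eLpNorm f ⊤ (volume.restrict B)

/-- `max_{|i| ≤ s} ‖D^i f‖_{L^∞(B)}`. -/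
def derivBound (B : Set (Space d)) (s : ℕ) (f : Space d → ℝ) : ℝ≥0∞ :=
  ⨆ (m : ℕ) (_ : m ≤ s) (w : Fin m → Fin d), supNorm B (pderiv w f)

/-- `φ` is a test function on `B`, that is, `φ ∈ C_c^∞(B)`. -/
def IsTestFun (B : Set (Space d)) (φ : Space d → ℝ) : Prop :=
  ContDiff ℝ ∞ φ ∧ HasCompactSupport φ ∧ tsupport φ ⊆ B

/-- `g` is the weak derivative `∂_{w 0} ⋯ ∂_{w (m-1)} f` in `B`. -/
def IsWeakDeriv (B : Set (Space d)) {m : ℕ} (w : Fin m → Fin d) (f g : Space d → ℝ) : Prop :=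
  LocallyIntegrableOn f B ∧ LocallyIntegrableOn g B ∧
    ∀ φ : Space d → ℝ, IsTestFun B φ →
      ∫ x in B, f x * pderiv w φ x = (-1) ^ m * ∫ x in B, g x * φ x

/-- The Hölder seminorm `ess sup |g x - g x'| / |x - x'| ^ θ` over `(x, x') ∈ B × B`. -/
def holderSeminorm (B : Set (Space d)) (θ : ℝ) (g : Space d → ℝ) : ℝ≥0∞ :=
  essSup (fun z : Space d × Space d => ‖g z.1 - g z.2‖ₑ / ‖z.1 - z.2‖ₑ ^ θ)
    ((volume.restrict B).prod (volume.restrict B))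

open Classical in
/-- The norm of the Sobolev (Sobolev–Slobodeckij) space `W^{υ,∞}(B)` for real `υ ≥ 0`, with the
value `∞` off that space.  With `k = ⌊υ⌋`, it is the maximum of the `L^∞` norms of the weak
derivatives of order at most `k` and, if `υ` is not an integer, of the Hölder seminorms with
exponent `υ - k` of the weak derivatives of order `k`.  The infimum is over all families of weak
derivatives: it is `∞` if there is none, and otherwise its argument does not depend on the family,
because weak derivatives are unique almost everywhere. -/
def sobolevInftyNorm (B : Set (Space d)) (υ : ℝ) (f : Space d → ℝ) : ℝ≥0∞ :=
  ⨅ (g : (m : ℕ) → (Fin m → Fin d) → Space d → ℝ)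
    (_ : ∀ m : ℕ, m ≤ ⌊υ⌋₊ → ∀ w : Fin m → Fin d, IsWeakDeriv B w f (g m w)),
    max (⨆ (m : ℕ) (_ : m ≤ ⌊υ⌋₊) (w : Fin m → Fin d), supNorm B (g m w))
      (if υ = ⌊υ⌋₊ then 0
        else ⨆ w : Fin ⌊υ⌋₊ → Fin d, holderSeminorm B (υ - ⌊υ⌋₊) (g ⌊υ⌋₊ w))

/-! ### The random coefficient -/

/-- The partial sums of the random series `∑_j ψ_j(x) y_j`. -/
def kappaPartial (ψ : ℕ → Space d → ℝ) (N : ℕ) (x : Space d) (y : ℕ → ℝ) : ℝ :=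
  ∑ j ∈ Finset.range N, ψ j x * y j

/-- `κ(x, y) = ∑_j ψ_j(x) y_j`, the limit of the partial sums (the series need not converge
absolutely). -/
def kappa (ψ : ℕ → Space d → ℝ) (x : Space d) (y : ℕ → ℝ) : ℝ :=
  limUnder atTop (fun N => kappaPartial ψ N x y)

/-- The diffusion coefficient `a = exp κ`. -/
def coeff (ψ : ℕ → Space d → ℝ) (y : ℕ → ℝ) (x : Space d) : ℝ := Real.exp (kappa ψ x y)

/-- `a_max(y) = ‖a(·, y)‖_{L^∞(B)}`. -/
def aMax (B : Set (Space d)) (ψ : ℕ → Space d → ℝ) (y : ℕ → ℝ) : ℝ≥0∞ :=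
  supNorm B (coeff ψ y)

/-- `a_min(y) = 1 / ‖a(·, y)⁻¹‖_{L^∞(B)}`. -/
def aMin (B : Set (Space d)) (ψ : ℕ → Space d → ℝ) (y : ℕ → ℝ) : ℝ≥0∞ :=
  (supNorm B (fun x => (coeff ψ y x)⁻¹))⁻¹

/-- Almost surely, the series that defines `κ(x, ·)` converges for all `x ∈ B`. -/
def SeriesConverges (B : Set (Space d)) (ψ : ℕ → Space d → ℝ) : Prop :=
  ∀ᵐ y ∂paramLaw, ∀ x ∈ B, Tendsto (fun N => kappaPartial ψ N x y) atTop (𝓝 (kappa ψ x y))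

/-- Almost surely, `0 < a_min(y) ≤ a(x, y) ≤ a_max(y) < ∞` for all `x ∈ B`. -/
def IsUniformlyElliptic (B : Set (Space d)) (ψ : ℕ → Space d → ℝ) : Prop :=
  ∀ᵐ y ∂paramLaw, 0 < aMin B ψ y ∧ aMax B ψ y < ⊤ ∧
    ∀ x ∈ B, aMin B ψ y ≤ ENNReal.ofReal (coeff ψ y x) ∧
      ENNReal.ofReal (coeff ψ y x) ≤ aMax B ψ y

/-! ### The boundary value problem -/

/-- The Hilbert space `L²(B) × L²(B)^d`, in which `H¹(B)` embeds isometrically by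
`u ↦ (u, ∇u)`. -/
abbrev L2Pair (B : Set (Space d)) : Type :=
  WithLp 2 (Lp ℝ 2 (volume.restrict B) × Lp (Space d) 2 (volume.restrict B))

/-- `H¹₀(B)`, the closure of the test functions in `H¹(B)`, with the norm
`(‖u‖² + ‖∇u‖²)^{1/2}`; a function `u` is represented by the pair `(u, ∇u)`. -/
def H10 (B : Set (Space d)) : Submodule ℝ (L2Pair B) :=
  (Submodule.span ℝ {z : L2Pair B | ∃ φ : Space d → ℝ, IsTestFun B φ ∧
    z.fst =ᵐ[volume.restrict B] φ ∧
    z.snd =ᵐ[volume.restrict B] fun x => gradient φ x}).topologicalClosure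

/-- The weak gradient of `u ∈ H¹₀(B)`. -/
def grad {B : Set (Space d)} (u : H10 B) : Space d → Space d := (u : L2Pair B).snd

/-- `H⁻¹(B)`, the dual space of `H¹₀(B)`, with the operator norm. -/
abbrev Hneg1 (B : Set (Space d)) : Type := StrongDual ℝ (H10 B)

/-- `u ∈ H¹₀(B)` is the weak solution of `-div (a ∇u) = ς` in `B`, `u = 0` on `∂B`. -/
def IsWeakSolution {B : Set (Space d)} (a : Space d → ℝ) (ς : Hneg1 B) (u : H10 B) : Prop :=
  ∀ v : H10 B, IntegrableOn (fun x => a x * inner ℝ (grad u x) (grad v x)) B ∧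
    ∫ x in B, a x * inner ℝ (grad u x) (grad v x) = ς v

/-! ### The log-uniform example -/

/-- The open unit cube `(0, 1)^d`. -/
def unitCube (d : ℕ) : Set (Space d) := {x | ∀ i, x i ∈ Set.Ioo (0 : ℝ) 1}

/-- `A_k = √3 · 2^{|k|₀ / 2} · (1 + |k|²)^{-(ν + d/2)/2}`, where `|k|₀` is the number of non-zero
entries of `k` and `|k|` is their sum. -/
def amplitude (ν : ℝ) (k : Fin d → ℕ) : ℝ :=
  √3 * (2 : ℝ) ^ (((Finset.univ.filter (fun i => k i ≠ 0)).card : ℝ) / 2) *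
    (1 + ((∑ i, k i : ℕ) : ℝ) ^ 2) ^ (-((ν + (d : ℝ) / 2) / 2))

/-- `∏_i cos(π k_i x_i)^{ℓ_i} sin(π k_i x_i)^{1 - ℓ_i}`, with `ℓ ∈ {0, 1}^d`. -/
def trigProd (k : Fin d → ℕ) (l : Fin d → Fin 2) (x : Space d) : ℝ :=
  ∏ i, Real.cos (Real.pi * k i * x i) ^ (l i : ℕ) *
    Real.sin (Real.pi * k i * x i) ^ (1 - (l i : ℕ))

/-- The functions `ψ_j` of the log-uniform example, for an enumeration `e` of the index set
`{(k, ℓ) : k ∈ ℕ^d, ℓ ∈ {0, 1}^d}`. -/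
def logUniform (ν : ℝ) (e : ℕ ≃ (Fin d → ℕ) × (Fin d → Fin 2)) (j : ℕ) (x : Space d) : ℝ :=
  amplitude ν (e j).1 * trigProd (e j).1 (e j).2 x

end RandomDiffusion

end

/-! Everything rests on a quantitative form of the almost sure uniform convergence of `∑ ψ_j y_j`
when only the squares of the bounds `β_j` of the `ψ_j` are summable. By Hoeffding's lemma a finite
sum `∑ c_j y_j` is sub-Gaussian with parameter `∑ c_j²`. All partial sums are treated as one process
indexed by the pairs `(N, x)`, with distance `max (√|t_N - t_M|) ‖x - x'‖`, where `t_N` are the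
partial sums of a convergent series dominating `∑ β_j²`. At distance `ρ ≤ 3`, increments are
sub-Gaussian with parameter of order `ρ^(2η)`. Kolmogorov chaining along dyadic nets
(`exists_holder_bound`) then bounds the process and its Hölder quotients by a single random variable
`K` with all exponential moments. Varying `N` gives a Cauchy sequence, uniformly in `x`; varying `x`
gives Hölder continuity of `κ` with any exponent below `η` (`exists_kappa_bound`).

On a bounded Lipschitz domain, bounds on the derivatives up to order `s` make those up to order `s -
1` Lipschitz (`exists_lipschitz_const`). Chaining applied to each differentiated series puts `κ` in
`C^(s-1,θ)` for every `θ < 1`, with norm bounded by a variable with exponential moments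
(`exists_kappa_ckHolder`). Taking the exponential turns a bound `M ≥ 1` into `exp (c M)`
(`CkHolder.exp`), which therefore has moments of all orders; `-κ` in place of `κ` handles `1 /
a_min`. The Sobolev norm is computed by classical derivatives (`sobolevInftyNorm_eq`), and countable
suprema give its measurability.

For the log-uniform example, interpolation between boundedness and the Lipschitz bound of the
trigonometric products gives square summable Hölder bounds with a small exponent
(`exists_logUniform_bounds`), so chaining applies directly on the cube. Lax-Milgram and the Poincaré
inequality give the solution and its bound by `1 / a_min`. The solution depends continuously on the
logarithm of the coefficient, hence is an almost sure limit of continuous functions of `y`, and so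
is strongly measurable. -/

noncomputable section

namespace RandomDiffusion

/-! ### Exponential moments -/

section ExpMoments

variable {Ω : Type*} [MeasurableSpace Ω] {μ : Measure Ω}

/-- `K ≥ 0` is a random variable all of whose exponential moments are finite. -/
structure HasExpMoments (K : Ω → ℝ) (μ : Measure Ω) : Prop where
  measurable : Measurable K
  nonneg : ∀ y, 0 ≤ K y
  lintegral_lt : ∀ t : ℝ, ∫⁻ y, ENNReal.ofReal (Real.exp (t * K y)) ∂μ < ⊤

/-- No independence is needed: the exponential of a sum is at most the sum of the exponentials at
twice the parameter. -/
theorem HasExpMoments.add {K L : Ω → ℝ} (hK : HasExpMoments K μ) (hL : HasExpMoments L μ) :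
    HasExpMoments (fun y => K y + L y) μ := by
  refine ⟨hK.measurable.add hL.measurable, fun y => add_nonneg (hK.nonneg y) (hL.nonneg y),
    fun t => ?_⟩
  have h : ∀ y, ENNReal.ofReal (Real.exp (t * (K y + L y))) ≤
      ENNReal.ofReal (Real.exp ((2 * t) * K y)) + ENNReal.ofReal (Real.exp ((2 * t) * L y)) := by
    intro y
    rw [← ENNReal.ofReal_add (Real.exp_pos _).le (Real.exp_pos _).le]
    apply ENNReal.ofReal_le_ofReal
    rcases le_total (t * K y) (t * L y) with h | h
    · have : Real.exp (t * (K y + L y)) ≤ Real.exp ((2 * t) * L y) :=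
        Real.exp_le_exp.2 (by linarith)
      linarith [Real.exp_pos ((2 * t) * K y)]
    · have : Real.exp (t * (K y + L y)) ≤ Real.exp ((2 * t) * K y) :=
        Real.exp_le_exp.2 (by linarith)
      linarith [Real.exp_pos ((2 * t) * L y)]
  refine (lintegral_mono h).trans_lt ?_
  rw [lintegral_add_left (by have := hK.measurable; fun_prop)]
  exact ENNReal.add_lt_top.2 ⟨hK.lintegral_lt _, hL.lintegral_lt _⟩

theorem HasExpMoments.const_mul {K : Ω → ℝ} (hK : HasExpMoments K μ) {c : ℝ} (hc : 0 ≤ c) :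
    HasExpMoments (fun y => c * K y) μ :=
  ⟨hK.measurable.const_mul c, fun y => mul_nonneg hc (hK.nonneg y), fun t => by
    simpa [mul_assoc] using hK.lintegral_lt (t * c)⟩

theorem HasExpMoments.const [IsFiniteMeasure μ] {c : ℝ} (hc : 0 ≤ c) :
    HasExpMoments (fun _ : Ω => c) μ :=
  ⟨measurable_const, fun _ => hc, fun t => by
    rw [lintegral_const]; exact ENNReal.mul_lt_top ENNReal.ofReal_lt_top (measure_lt_top _ _)⟩

theorem HasExpMoments.sum [IsFiniteMeasure μ] {α : Type*} (s : Finset α) {K : α → Ω → ℝ}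
    (hK : ∀ a ∈ s, HasExpMoments (K a) μ) : HasExpMoments (fun y => ∑ a ∈ s, K a y) μ := by
  classical
  induction s using Finset.induction_on with
  | empty => simpa using HasExpMoments.const (μ := μ) le_rfl
  | insert a s ha ih =>
    simp only [Finset.sum_insert ha]
    exact (hK a (by simp)).add (ih fun b hb => hK b (by simp [hb]))

/-- The random variable `X` has sub-Gaussian moment generating function with parameter `v`. -/
structure SubGaussian (X : Ω → ℝ) (v : ℝ) (μ : Measure Ω) : Prop where
  measurable : Measurable X
  lintegral_le : ∀ t : ℝ,
    ∫⁻ y, ENNReal.ofReal (Real.exp (t * X y)) ∂μ ≤ ENNReal.ofReal (Real.exp (v * t ^ 2))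

theorem SubGaussian.const_mul {X : Ω → ℝ} {v : ℝ} (hX : SubGaussian X v μ) (c : ℝ) :
    SubGaussian (fun y => c * X y) (v * c ^ 2) μ :=
  ⟨hX.measurable.const_mul c, fun t => by
    have := hX.lintegral_le (t * c)
    simp only [mul_assoc] at this ⊢
    refine this.trans (le_of_eq ?_)
    ring_nf⟩

theorem SubGaussian.mono {X : Ω → ℝ} {v w : ℝ} (hX : SubGaussian X v μ) (h : v ≤ w) :
    SubGaussian X w μ :=
  ⟨hX.measurable, fun t => (hX.lintegral_le t).trans <| ENNReal.ofReal_le_ofReal <|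
    Real.exp_le_exp.2 <| mul_le_mul_of_nonneg_right h (sq_nonneg t)⟩

theorem SubGaussian.lintegral_abs_le {X : Ω → ℝ} {v : ℝ} (hX : SubGaussian X v μ) (t : ℝ) :
    ∫⁻ y, ENNReal.ofReal (Real.exp (t * |X y|)) ∂μ ≤
      ENNReal.ofReal (2 * Real.exp (v * t ^ 2)) := by
  have h : ∀ y, ENNReal.ofReal (Real.exp (t * |X y|)) ≤
      ENNReal.ofReal (Real.exp (t * X y)) + ENNReal.ofReal (Real.exp ((-t) * X y)) := by
    intro y
    rcases abs_cases (X y) with ⟨h, _⟩ | ⟨h, _⟩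
    · rw [h]; exact le_self_add
    · rw [h, mul_neg, neg_mul]; exact le_add_self
  refine (lintegral_mono h).trans ?_
  rw [lintegral_add_left (by have := hX.measurable; fun_prop), two_mul,
    ENNReal.ofReal_add (Real.exp_pos _).le (Real.exp_pos _).le]
  refine add_le_add (hX.lintegral_le t) ?_
  simpa using hX.lintegral_le (-t)

/-- A countable family of sub-Gaussian variables, with at most `A * b ^ n` members of parameter
`c * r ^ n` for each `n`, where `r < 1`, is bounded by a variable with exponential moments. -/
theorem exists_hasExpMoments_bound [IsProbabilityMeasure μ] {α : Type*} (Q : ℕ → Finset α)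
    (X : ℕ → α → Ω → ℝ) {A b c r : ℝ} (hA : 0 ≤ A) (hb : 1 ≤ b) (hc : 0 ≤ c) (hr : 0 ≤ r)
    (hr1 : r < 1) (hcard : ∀ n, ((Q n).card : ℝ) ≤ A * b ^ n)
    (hX : ∀ n, ∀ a ∈ Q n, SubGaussian (X n a) (c * r ^ n) μ) :
    ∃ K : Ω → ℝ, HasExpMoments K μ ∧ ∀ᵐ y ∂μ, ∀ n, ∀ a ∈ Q n, |X n a y| ≤ K y := by
  -- With this `L`, the weight `e^(-L n) = (2b)^(-n)` outweighs the at most `A * b ^ n` members of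
  -- level `n` and leaves a factor `2^(-n)`.
  set L : ℝ := Real.log (2 * b) with hL
  have hL0 : 0 ≤ L := Real.log_nonneg (by linarith)
  have hexpL : Real.exp L = 2 * b := Real.exp_log (by linarith)
  -- `W t` dominates `exp (t |X n a|)` for all members at once: if `|X n a| ≤ 1` the first term
  -- suffices, and otherwise `(t + L n) |X n a| - L n ≥ t |X n a|`. The shift by `-L n` is what
  -- makes the expectation of the series finite.
  let W : ℝ → Ω → ℝ≥0∞ := fun t y => ENNReal.ofReal (Real.exp t) +
    ∑' n : ℕ, ∑ a ∈ Q n, ENNReal.ofReal (Real.exp ((t + L * n) * |X n a y| - L * n))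
  have hWint : ∀ t : ℝ, ∫⁻ y, W t y ∂μ < ⊤ := by
    intro t
    have hmeas : ∀ n : ℕ, ∀ a ∈ Q n, Measurable fun y =>
        ENNReal.ofReal (Real.exp ((t + L * n) * |X n a y| - L * n)) := fun n a ha => by
      have := (hX n a ha).measurable
      have h2 : Measurable fun y => |X n a y| := by simpa using this.norm
      fun_prop
    -- The geometric decay of the parameters absorbs the quadratic growth in `n` of the squared
    -- exponent.
    obtain ⟨G, hG⟩ : ∃ G : ℝ, ∀ n : ℕ, (c * r ^ n) * (t + L * n) ^ 2 ≤ G := by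
      have h2 := tendsto_pow_const_mul_const_pow_of_abs_lt_one 2 (r := r)
        (by rwa [abs_of_nonneg hr])
      have h0 := tendsto_pow_const_mul_const_pow_of_abs_lt_one 0 (r := r)
        (by rwa [abs_of_nonneg hr])
      have h := ((h0.const_mul (2 * c * t ^ 2)).add
        (h2.const_mul (2 * c * L ^ 2))).bddAbove_range
      obtain ⟨G, hG⟩ := h
      refine ⟨G, fun n => le_trans ?_ (hG ⟨n, rfl⟩)⟩
      have hrn : 0 ≤ r ^ n := pow_nonneg hr n
      have : (t + L * n) ^ 2 ≤ 2 * t ^ 2 + 2 * L ^ 2 * n ^ 2 := by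
        nlinarith [sq_nonneg (t - L * n)]
      calc (c * r ^ n) * (t + L * n) ^ 2 ≤ (c * r ^ n) * (2 * t ^ 2 + 2 * L ^ 2 * n ^ 2) :=
            mul_le_mul_of_nonneg_left this (mul_nonneg hc hrn)
        _ = _ := by simp; ring
    have hterm : ∀ n : ℕ, ∑ a ∈ Q n,
        ∫⁻ y, ENNReal.ofReal (Real.exp ((t + L * n) * |X n a y| - L * n)) ∂μ ≤
        ENNReal.ofReal (2 * A * Real.exp G) * (2⁻¹ : ℝ≥0∞) ^ n := by
      intro n
      have h1 : ∀ a ∈ Q n,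
          ∫⁻ y, ENNReal.ofReal (Real.exp ((t + L * n) * |X n a y| - L * n)) ∂μ ≤
          ENNReal.ofReal (Real.exp (-(L * n)) * (2 * Real.exp G)) := by
        intro a ha
        have : ∀ y, ENNReal.ofReal (Real.exp ((t + L * n) * |X n a y| - L * n)) =
            ENNReal.ofReal (Real.exp (-(L * n))) *
              ENNReal.ofReal (Real.exp ((t + L * n) * |X n a y|)) := fun y => by
          rw [← ENNReal.ofReal_mul (Real.exp_pos _).le, ← Real.exp_add]
          ring_nf
        simp only [this]
        rw [lintegral_const_mul' _ _ ENNReal.ofReal_ne_top,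
          ENNReal.ofReal_mul (Real.exp_pos _).le]
        gcongr
        refine ((hX n a ha).lintegral_abs_le _).trans (ENNReal.ofReal_le_ofReal ?_)
        gcongr
        exact hG n
      refine (Finset.sum_le_sum h1).trans ?_
      rw [Finset.sum_const, nsmul_eq_mul, ← ENNReal.ofReal_natCast,
        ← ENNReal.ofReal_mul (Nat.cast_nonneg _)]
      have h2 : (2⁻¹ : ℝ≥0∞) ^ n = ENNReal.ofReal ((2⁻¹ : ℝ) ^ n) := by
        rw [ENNReal.ofReal_pow (by norm_num), ENNReal.ofReal_inv_of_pos (by norm_num)]; norm_num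
      rw [h2, ← ENNReal.ofReal_mul (by positivity)]
      apply ENNReal.ofReal_le_ofReal
      have h3 : Real.exp (-(L * n)) = (2 * b)⁻¹ ^ n := by
        rw [mul_comm, Real.exp_neg, Real.exp_nat_mul, hexpL, inv_pow]
      rw [h3]
      calc ((Q n).card : ℝ) * ((2 * b)⁻¹ ^ n * (2 * Real.exp G))
          ≤ (A * b ^ n) * ((2 * b)⁻¹ ^ n * (2 * Real.exp G)) :=
            mul_le_mul_of_nonneg_right (hcard n) (by positivity)
        _ = 2 * A * Real.exp G * (b * (2 * b)⁻¹) ^ n := by rw [mul_pow]; ring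
        _ = _ := by congr 2; field_simp
    simp only [W]
    rw [lintegral_add_left measurable_const, lintegral_tsum (fun n =>
      (Finset.measurable_sum _ (hmeas n)).aemeasurable)]
    refine ENNReal.add_lt_top.2 ⟨?_, ?_⟩
    · simp
    · have : ∀ n : ℕ, ∫⁻ y, ∑ a ∈ Q n,
          ENNReal.ofReal (Real.exp ((t + L * n) * |X n a y| - L * n)) ∂μ = ∑ a ∈ Q n,
          ∫⁻ y, ENNReal.ofReal (Real.exp ((t + L * n) * |X n a y| - L * n)) ∂μ :=
        fun n => lintegral_finsetSum' _ fun a ha => (hmeas n a ha).aemeasurable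
      simp only [this]
      refine (ENNReal.tsum_le_tsum hterm).trans_lt ?_
      rw [ENNReal.tsum_mul_left]
      refine ENNReal.mul_lt_top ENNReal.ofReal_lt_top ?_
      rw [ENNReal.tsum_geometric, ENNReal.inv_lt_top]
      simp
  have hXW : ∀ t : ℝ, 0 ≤ t → ∀ y n, ∀ a ∈ Q n,
      ENNReal.ofReal (Real.exp (t * |X n a y|)) ≤ W t y := by
    intro t ht y n a ha
    rcases le_total |X n a y| 1 with h | h
    · refine le_trans (ENNReal.ofReal_le_ofReal (Real.exp_le_exp.2 ?_)) le_self_add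
      nlinarith
    · refine le_trans ?_ le_add_self
      refine le_trans ?_ (ENNReal.le_tsum n)
      refine le_trans ?_ (Finset.single_le_sum (f := fun a =>
        ENNReal.ofReal (Real.exp ((t + L * n) * |X n a y| - L * n))) (fun _ _ => zero_le) ha)
      apply ENNReal.ofReal_le_ofReal
      apply Real.exp_le_exp.2
      have : 0 ≤ L * n := by positivity
      nlinarith
  let S : Ω → ℝ≥0∞ := fun y => ⨆ n, ⨆ a ∈ Q n, ENNReal.ofReal |X n a y|
  have hSmeas : Measurable S := by
    refine Measurable.iSup fun n => Measurable.biSup _ (Q n).countable_toSet fun a ha => ?_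
    have : Measurable fun y => |X n a y| := by simpa using (hX n a ha).measurable.norm
    exact this.ennreal_ofReal
  have hexp : ∀ t : ℝ, 0 < t → ∀ y, ENNReal.ofReal (Real.exp (t * (S y).toReal)) ≤ W t y := by
    intro t ht y
    by_cases hW : W t y = ⊤
    · rw [hW]; exact le_top
    have h1 : ENNReal.ofReal (Real.exp t) ≤ W t y := le_self_add
    have hw : Real.exp t ≤ (W t y).toReal := (ENNReal.ofReal_le_iff_le_toReal hW).1 h1
    have hwpos : 0 < (W t y).toReal := (Real.exp_pos t).trans_le hw
    have hlog : 0 ≤ Real.log (W t y).toReal / t := by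
      have : t ≤ Real.log (W t y).toReal := (Real.le_log_iff_exp_le hwpos).2 hw
      have := div_le_div_of_nonneg_right this ht.le
      rw [div_self ht.ne'] at this
      linarith
    have hS : S y ≤ ENNReal.ofReal (Real.log (W t y).toReal / t) := by
      refine iSup_le fun n => iSup₂_le fun a ha => ENNReal.ofReal_le_ofReal ?_
      rw [le_div_iff₀ ht, mul_comm, Real.le_log_iff_exp_le hwpos]
      exact (ENNReal.ofReal_le_iff_le_toReal hW).1 (hXW t ht.le y n a ha)
    have hS' : (S y).toReal ≤ Real.log (W t y).toReal / t := ENNReal.toReal_le_of_le_ofReal hlog hS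
    rw [ENNReal.ofReal_le_iff_le_toReal hW, ← Real.le_log_iff_exp_le hwpos, mul_comm,
      ← le_div_iff₀ ht]
    exact hS'
  have hWmeas : Measurable (W 1) := by
    have h : ∀ n : ℕ, Measurable fun y => ∑ a ∈ Q n,
        ENNReal.ofReal (Real.exp ((1 + L * n) * |X n a y| - L * n)) :=
      fun n => Finset.measurable_sum _ fun a ha => by
        have h2 : Measurable fun y => |X n a y| := by simpa using (hX n a ha).measurable.norm
        fun_prop
    exact measurable_const.add (Measurable.tsum h)
  -- Where the supremum `S` is infinite, `toReal` gives `0` and the bound on the family is lost, but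
  -- there `W 1` is infinite, so this is a null set.
  refine ⟨fun y => (S y).toReal, ⟨hSmeas.ennreal_toReal, fun y => ENNReal.toReal_nonneg,
    fun t => ?_⟩, ?_⟩
  · have ht : t ≤ max t 1 := le_max_left _ _
    refine lt_of_le_of_lt (lintegral_mono fun y => ?_) (hWint (max t 1))
    refine le_trans (ENNReal.ofReal_le_ofReal (Real.exp_le_exp.2 ?_))
      (hexp (max t 1) (lt_of_lt_of_le one_pos (le_max_right _ _)) y)
    exact mul_le_mul_of_nonneg_right ht ENNReal.toReal_nonneg
  · filter_upwards [ae_lt_top hWmeas (hWint 1).ne] with y hy n a ha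
    have hS : S y < ⊤ := by
      refine lt_of_le_of_lt (iSup_le fun n => iSup₂_le fun a ha => ?_) hy
      refine le_trans (ENNReal.ofReal_le_ofReal ?_) (hXW 1 zero_le_one y n a ha)
      rw [one_mul]
      linarith [Real.add_one_le_exp |X n a y|]
    have : ENNReal.ofReal |X n a y| ≤ S y :=
      le_trans (le_iSup₂ (f := fun a (_ : a ∈ Q n) => ENNReal.ofReal |X n a y|) a ha)
        (le_iSup (fun n => ⨆ a ∈ Q n, ENNReal.ofReal |X n a y|) n)
    exact (ENNReal.ofReal_le_iff_le_toReal hS.ne).1 this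

end ExpMoments

/-! ### Chaining -/

/-- Kolmogorov's continuity theorem by chaining along nets of polynomial size, with exponential
moments of the Hölder constant. -/
theorem exists_holder_bound {Ω : Type*} [MeasurableSpace Ω] {μ : Measure Ω}
    [IsProbabilityMeasure μ] {ι : Type*} (Y : ι → Ω → ℝ) (ρ : ι → ι → ℝ)
    (hρ0 : ∀ z w, 0 ≤ ρ z w) (hρc : ∀ z w, ρ z w = ρ w z)
    (hρt : ∀ z w v, ρ z v ≤ ρ z w + ρ w v)
    (net : ℕ → Finset ι) (π : ℕ → ι → ι) (hπ : ∀ n z, π n z ∈ net n)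
    (hπρ : ∀ n z, ρ z (π n z) ≤ (1 / 2) ^ n) {A b c η θ : ℝ} (hA : 0 ≤ A) (hb : 1 ≤ b)
    (hcard : ∀ n, ((net n).card : ℝ) ≤ A * b ^ n) (hc : 0 ≤ c) (hθ : 0 < θ) (hθη : θ < η)
    (hval : ∀ z, SubGaussian (Y z) c μ)
    (hinc : ∀ z w, ρ z w ≤ 3 → SubGaussian (fun y => Y z y - Y w y) (c * ρ z w ^ (2 * η)) μ)
    (hcont : ∀ y z (u : ℕ → ι), Tendsto (fun n => ρ z (u n)) atTop (𝓝 0) →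
      Tendsto (fun n => Y (u n) y) atTop (𝓝 (Y z y))) :
    ∃ K : Ω → ℝ, HasExpMoments K μ ∧ ∀ᵐ y ∂μ, ∀ z, |Y z y| ≤ K y ∧
      ∀ w, |Y z y - Y w y| ≤ K y * ρ z w ^ θ := by
  classical
  have hcard0 : ∀ n, (0:ℝ) ≤ A * b ^ n := fun n => by positivity
  -- Increments between nearby points of two consecutive nets, magnified by `2^(θ n)`. Since `θ <
  -- η`, their parameters still decay like `2^(2 (θ - η) n)`, while the number of pairs grows only
  -- geometrically. The radius `3 * 2^(-n)` covers the net points of any two points at distance at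
  -- most `2^(-n)`.
  obtain ⟨K₁, hK₁, hY₁⟩ := exists_hasExpMoments_bound (μ := μ)
    (fun n => ((net n ∪ net (n + 1)) ×ˢ (net n ∪ net (n + 1))).filter
      fun q => ρ q.1 q.2 ≤ 3 * (1 / 2) ^ n)
    (fun n q y => ((2 : ℝ) ^ θ) ^ n * (Y q.1 y - Y q.2 y))
    (A := (A + A * b) ^ 2) (b := b ^ 2) (c := c * 3 ^ (2 * η)) (r := (2 : ℝ) ^ (2 * (θ - η)))
    (by positivity) (one_le_pow₀ hb) (by positivity) (by positivity)
    (Real.rpow_lt_one_of_one_lt_of_neg (by norm_num) (by linarith))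
    (fun n => by
      have h1 : ((net n ∪ net (n + 1)).card : ℝ) ≤ (A + A * b) * b ^ n := by
        have : ((net n ∪ net (n + 1)).card : ℝ) ≤ (net n).card + (net (n + 1)).card := by
          exact_mod_cast Finset.card_union_le _ _
        have h2 := hcard n
        have h3 := hcard (n + 1)
        rw [pow_succ] at h3
        nlinarith
      calc ((Finset.filter _ _).card : ℝ)
          ≤ (((net n ∪ net (n + 1)) ×ˢ (net n ∪ net (n + 1))).card : ℝ) := by
            exact_mod_cast Finset.card_filter_le _ _
        _ = ((net n ∪ net (n + 1)).card : ℝ) ^ 2 := by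
            rw [Finset.card_product]; push_cast; ring
        _ ≤ ((A + A * b) * b ^ n) ^ 2 := by gcongr
        _ = _ := by ring)
    (fun n q hq => by
      have hq2 := (Finset.mem_filter.1 hq).2
      have h3 : ρ q.1 q.2 ≤ 3 := hq2.trans (by
        have : ((1:ℝ) / 2) ^ n ≤ 1 := pow_le_one₀ (by norm_num) (by norm_num)
        linarith)
      refine ((hinc q.1 q.2 h3).const_mul (((2 : ℝ) ^ θ) ^ n)).mono ?_
      have hη : 0 ≤ 2 * η := by linarith
      have h4 : ρ q.1 q.2 ^ (2 * η) ≤ (3 * (1 / 2) ^ n) ^ (2 * η) :=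
        Real.rpow_le_rpow (hρ0 _ _) hq2 hη
      calc c * ρ q.1 q.2 ^ (2 * η) * (((2:ℝ) ^ θ) ^ n) ^ 2
          ≤ c * (3 * (1 / 2) ^ n) ^ (2 * η) * (((2:ℝ) ^ θ) ^ n) ^ 2 := by gcongr
        _ = c * 3 ^ (2 * η) * ((2:ℝ) ^ (2 * (θ - η))) ^ n := by
          rw [Real.mul_rpow (by norm_num) (by positivity), mul_sub, Real.rpow_sub (by norm_num),
            ← Real.rpow_natCast, ← Real.rpow_natCast, ← Real.rpow_natCast, ← Real.rpow_natCast,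
            ← Real.rpow_mul (by positivity), ← Real.rpow_mul (by positivity),
            ← Real.rpow_mul (by positivity), Real.div_rpow (by positivity) (by positivity),
            Real.div_rpow (by positivity) (by positivity),
            ← Real.rpow_mul (by positivity), ← Real.rpow_mul (by positivity), Real.one_rpow]
          push_cast
          rw [show 2 * η * (n:ℝ) = n * (2 * η) by ring, show 2 * θ * (n:ℝ) = θ * n * 2 by ring]
          field_simp)
  -- The values on the coarsest net. All other levels are empty, so `r = 0` is admissible, with `0 ^
  -- 0 = 1` at level `0`.
  obtain ⟨K₂, hK₂, hY₂⟩ := exists_hasExpMoments_bound (μ := μ)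
    (fun n => if n = 0 then net 0 else ∅) (fun _ z y => Y z y)
    (A := A) (b := 1) (c := c) (r := 0) hA le_rfl hc le_rfl one_pos
    (fun n => by
      by_cases hn : n = 0
      · subst hn; simpa using hcard 0
      · simp [hn, hA])
    (fun n a ha => by
      by_cases hn : n = 0
      · subst hn; simpa using hval a
      · simp [hn] at ha)
  set q : ℝ := (2 : ℝ) ^ (-θ) with hq
  have hq0 : 0 < q := by positivity
  have hq1 : q < 1 := Real.rpow_lt_one_of_one_lt_of_neg (by norm_num) (by linarith)
  have hqn : ∀ n : ℕ, ((2 : ℝ) ^ θ) ^ n * q ^ n = 1 := fun n => by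
    rw [← mul_pow, hq, ← Real.rpow_add (by norm_num)]; simp
  set M : ℝ := 1 + 2 / (1 - q) with hM
  have h1q : 0 < 1 - q := by linarith
  have hM1 : 1 ≤ M := by rw [hM]; have : 0 < 2 / (1 - q) := by positivity
                         linarith
  have h2θ : 1 ≤ (2:ℝ) ^ θ := Real.one_le_rpow (by norm_num) hθ.le
  refine ⟨fun y => (2 * (2 ^ θ * M)) * (K₁ y + K₂ y), (hK₁.add hK₂).const_mul (by positivity), ?_⟩
  filter_upwards [hY₁, hY₂] with y h₁ h₂
  have hk1 := hK₁.nonneg y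
  have hk2 := hK₂.nonneg y
  have hstep : ∀ n, ∀ u ∈ net n ∪ net (n + 1), ∀ v ∈ net n ∪ net (n + 1),
      ρ u v ≤ 3 * (1 / 2) ^ n → |Y u y - Y v y| ≤ K₁ y * q ^ n := by
    intro n u hu v hv huv
    have := h₁ n (u, v) (by simp only [Finset.mem_filter, Finset.mem_product]
                            exact ⟨⟨hu, hv⟩, huv⟩)
    rw [abs_mul, abs_of_nonneg (by positivity)] at this
    calc |Y u y - Y v y| = (((2 : ℝ) ^ θ) ^ n * q ^ n) * |Y u y - Y v y| := by
          rw [hqn, one_mul]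
      _ = (((2 : ℝ) ^ θ) ^ n * |Y u y - Y v y|) * q ^ n := by ring
      _ ≤ K₁ y * q ^ n := by gcongr
  -- Telescoping along `π n z`, which tends to `z`. Only increments between net points enter, so the
  -- exceptional null set does not depend on `z`.
  have hlim : ∀ z n, |Y (π n z) y - Y z y| ≤ K₁ y * q ^ n / (1 - q) := by
    intro z n
    refine dist_le_of_le_geometric_of_tendsto q (K₁ y) hq1 (f := fun n => Y (π n z) y) ?_ ?_ n
    · intro n
      refine hstep n _ (Finset.mem_union_left _ (hπ n z)) _
        (Finset.mem_union_right _ (hπ (n + 1) z)) ?_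
      have h3 := hρt (π n z) z (π (n + 1) z)
      rw [hρc (π n z) z] at h3
      have h4 := hπρ n z
      have h5 := hπρ (n + 1) z
      have : (0:ℝ) < (1 / 2) ^ n := by positivity
      rw [pow_succ] at h5
      linarith
    · refine hcont y z _ (squeeze_zero (fun n => hρ0 _ _) (fun n => hπρ n z) ?_)
      exact tendsto_pow_atTop_nhds_zero_of_lt_one (by norm_num) (by norm_num)
  have hnear : ∀ z w n, ρ z w ≤ (1 / 2) ^ n → |Y z y - Y w y| ≤ M * K₁ y * q ^ n := by
    intro z w n hzw
    have h3 := hlim z n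
    have h4 := hlim w n
    have h5 : |Y (π n z) y - Y (π n w) y| ≤ K₁ y * q ^ n := by
      refine hstep n _ (Finset.mem_union_left _ (hπ n z)) _
        (Finset.mem_union_left _ (hπ n w)) ?_
      have h6 := hρt (π n z) z (π n w)
      have h7 := hρt z w (π n w)
      rw [hρc (π n z) z] at h6
      have := hπρ n z
      have := hπρ n w
      linarith
    have e : M * K₁ y * q ^ n = K₁ y * q ^ n + 2 * (K₁ y * q ^ n / (1 - q)) := by
      rw [hM]; ring
    rw [e]
    rw [abs_le] at *
    constructor <;> linarith [h3.1, h3.2, h4.1, h4.2, h5.1, h5.2]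
  have hbdd : ∀ z, |Y z y| ≤ (2 ^ θ * M) * (K₁ y + K₂ y) := by
    intro z
    have h3 := hlim z 0
    have h4 : |Y (π 0 z) y| ≤ K₂ y := h₂ 0 _ (by simpa using hπ 0 z)
    have h5 : K₁ y * q ^ 0 / (1 - q) ≤ M * K₁ y := by
      rw [hM, pow_zero, mul_one, add_mul, div_mul_eq_mul_div]
      have : K₁ y / (1 - q) ≤ 2 * K₁ y / (1 - q) := by gcongr; linarith
      linarith
    have h6 : |Y z y| ≤ K₂ y + M * K₁ y := by
      rw [abs_le] at *
      constructor <;> linarith [h3.1, h3.2, h4.1, h4.2]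
    have h7 : K₂ y + M * K₁ y ≤ M * (K₁ y + K₂ y) := by nlinarith
    have h8 : 0 ≤ M * (K₁ y + K₂ y) := by positivity
    nlinarith
  have hB : 0 ≤ (2 ^ θ * M) * (K₁ y + K₂ y) := by positivity
  intro z
  refine ⟨(hbdd z).trans (by nlinarith), fun w => ?_⟩
  -- Three ranges of the distance: at distance zero `hnear` holds for every `n`, at distance at most
  -- one it is used at the dyadic scale of `ρ z w`, and beyond one the uniform bound suffices.
  rcases (hρ0 z w).eq_or_lt with h0 | h0
  · have h3 : Tendsto (fun n : ℕ => M * K₁ y * q ^ n) atTop (𝓝 (M * K₁ y * 0)) :=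
      (tendsto_pow_atTop_nhds_zero_of_lt_one hq0.le hq1).const_mul _
    have h4 : |Y z y - Y w y| ≤ M * K₁ y * 0 :=
      ge_of_tendsto' h3 fun n => hnear z w n (by rw [← h0]; positivity)
    rw [mul_zero] at h4
    exact h4.trans (mul_nonneg (by positivity) (by rw [← h0]; exact Real.rpow_nonneg le_rfl _))
  rcases le_or_gt (ρ z w) 1 with hle | hgt
  · obtain ⟨n, hn1, hn2⟩ := exists_nat_pow_near_of_lt_one h0 hle (by norm_num : (0:ℝ) < 1 / 2)
      (by norm_num)
    have h3 : q ^ n ≤ 2 ^ θ * ρ z w ^ θ := by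
      rw [← Real.mul_rpow (by norm_num) h0.le]
      have : q ^ n = ((1 / 2) ^ n) ^ θ := by
        rw [hq, Real.rpow_neg (by norm_num), ← Real.inv_rpow (by norm_num), ← Real.rpow_natCast,
          ← Real.rpow_natCast, ← Real.rpow_mul (by norm_num), ← Real.rpow_mul (by norm_num),
          mul_comm]
        norm_num
      rw [this]
      refine Real.rpow_le_rpow (by positivity) ?_ hθ.le
      rw [pow_succ] at hn1
      linarith
    have hp : 0 ≤ ρ z w ^ θ := Real.rpow_nonneg h0.le _
    calc |Y z y - Y w y| ≤ M * K₁ y * q ^ n := hnear z w n hn2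
      _ ≤ M * K₁ y * (2 ^ θ * ρ z w ^ θ) := by gcongr
      _ = (2 ^ θ * M) * K₁ y * ρ z w ^ θ := by ring
      _ ≤ 2 * (2 ^ θ * M) * (K₁ y + K₂ y) * ρ z w ^ θ := by
          have : 0 ≤ 2 ^ θ * M * K₁ y := by positivity
          refine mul_le_mul_of_nonneg_right ?_ hp
          nlinarith [mul_nonneg (by positivity : 0 ≤ 2 ^ θ * M) hk2]
  · have hp : 1 ≤ ρ z w ^ θ := Real.one_le_rpow hgt.le hθ.le
    have h3 : |Y z y - Y w y| ≤ 2 * (2 ^ θ * M) * (K₁ y + K₂ y) := by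
      have := hbdd z
      have := hbdd w
      have := abs_sub (Y z y) (Y w y)
      linarith
    refine h3.trans (le_mul_of_one_le_right (by positivity) hp)

section Nets

/-! ### Nets -/

/-- The coordinates are rounded down to multiples of `2^(-n)`, and one point of `ι` represents each
occupied cell. Choosing points of `ι` itself keeps the net inside the index set. -/
theorem exists_net {ι κ : Type*} [Fintype κ] [Nonempty ι] (f : ι → κ → ℝ) (R : ℕ)
    (hf : ∀ z i, |f z i| ≤ R) (n : ℕ) :
    ∃ (N : Finset ι) (π : ι → ι), (∀ z, π z ∈ N) ∧
      (∀ z i, |f z i - f (π z) i| ≤ (1 / 2) ^ n) ∧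
      (N.card : ℝ) ≤ ((2 * R + 1) * 2 ^ n) ^ Fintype.card κ := by
  classical
  let c : ι → κ → ℤ := fun z i => ⌊(2 : ℝ) ^ n * f z i⌋
  let rep : (κ → ℤ) → ι := fun k => if h : ∃ z, c z = k then h.choose else Classical.arbitrary ι
  have hrep : ∀ z, c (rep (c z)) = c z := fun z => by
    have h : ∃ w, c w = c z := ⟨z, rfl⟩
    simp only [rep, h, dif_pos]
    exact h.choose_spec
  let box : Finset (κ → ℤ) := Fintype.piFinset fun _ => Finset.Icc (-(2 ^ n * R : ℤ)) (2 ^ n * R)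
  refine ⟨box.image rep, fun z => rep (c z), fun z => ?_, fun z i => ?_, ?_⟩
  · refine Finset.mem_image_of_mem _ (Fintype.mem_piFinset.2 fun i => ?_)
    have h := abs_le.1 (hf z i)
    have h2 : (0:ℝ) < 2 ^ n := by positivity
    rw [Finset.mem_Icc]
    constructor
    · rw [Int.le_floor]; push_cast; nlinarith
    · change ⌊(2 : ℝ) ^ n * f z i⌋ ≤ _
      have : (⌊(2 : ℝ) ^ n * f z i⌋ : ℝ) ≤ ((2 ^ n * R : ℤ) : ℝ) :=
        (Int.floor_le _).trans (by push_cast; nlinarith)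
      exact Int.cast_le.1 this
  · have h : ⌊(2 : ℝ) ^ n * f (rep (c z)) i⌋ = ⌊(2 : ℝ) ^ n * f z i⌋ := congrFun (hrep z) i
    have h2 := Int.abs_sub_lt_one_of_floor_eq_floor h
    rw [← mul_sub, abs_mul, abs_of_pos (by positivity), abs_sub_comm] at h2
    rw [one_div, inv_pow, ← one_div, le_div_iff₀ (by positivity), mul_comm]
    exact h2.le
  · calc ((box.image rep).card : ℝ) ≤ (box.card : ℝ) := by exact_mod_cast Finset.card_image_le
      _ = ((2 * (2 ^ n * R) + 1 : ℕ) : ℝ) ^ Fintype.card κ := by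
        rw [Fintype.card_piFinset]
        simp only [Int.card_Icc, Finset.prod_const, Finset.card_univ]
        push_cast
        congr 1
        have : ((2 : ℤ) ^ n * R + 1 - -(2 ^ n * R)).toNat = 2 * (2 ^ n * R) + 1 := by
          have : ((2 : ℤ) ^ n * R + 1 - -(2 ^ n * R)) = ((2 * (2 ^ n * R) + 1 : ℕ) : ℤ) := by
            push_cast; ring
          rw [this, Int.toNat_natCast]
        rw [this]; push_cast; ring
      _ ≤ _ := by
        refine pow_le_pow_left₀ (by positivity) ?_ _
        have : (1:ℝ) ≤ 2 ^ n := one_le_pow₀ (by norm_num)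
        push_cast
        nlinarith

/-! ### Random series -/

instance : IsProbabilityMeasure paramLaw := by unfold paramLaw; infer_instance

theorem ae_mem_Icc_unif : ∀ᵐ x ∂unif, x ∈ Set.Icc (-1 : ℝ) 1 := by
  unfold unif
  exact Measure.ae_smul_measure (ae_restrict_mem measurableSet_Icc) _

theorem integral_id_unif : ∫ x, x ∂unif = 0 := by
  unfold unif
  rw [integral_smul_measure, integral_Icc_eq_integral_Ioc,
    ← intervalIntegral.integral_of_le (by norm_num), integral_id]
  norm_num

/-- Hoeffding's lemma: a centred variable with values in an interval of length `2` has variance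
proxy `(2 / 2)² = 1`. -/
theorem hasSubgaussianMGF_coord (j : ℕ) :
    ProbabilityTheory.HasSubgaussianMGF (fun y : ℕ → ℝ => y j) 1 paramLaw := by
  have hmp := measurePreserving_eval_infinitePi (fun _ : ℕ => unif) j
  have h0 : ∫ y : ℕ → ℝ, y j ∂paramLaw = 0 := by
    rw [← integral_id_unif, ← hmp.map_eq, integral_map hmp.measurable.aemeasurable
      (by fun_prop)]
    rfl
  have h1 : ∀ᵐ y ∂paramLaw, y j ∈ Set.Icc (-1 : ℝ) 1 :=
    hmp.quasiMeasurePreserving.ae ae_mem_Icc_unif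
  have := ProbabilityTheory.hasSubgaussianMGF_of_mem_Icc (μ := paramLaw)
    (X := fun y : ℕ → ℝ => y j) (measurable_pi_apply j).aemeasurable h1
  simp only [h0, sub_zero] at this
  convert this
  ext
  simp
  norm_num

theorem subGaussian_sum (s : Finset ℕ) (c : ℕ → ℝ) {v : ℝ} (hv : ∑ j ∈ s, c j ^ 2 ≤ v) :
    SubGaussian (fun y : ℕ → ℝ => ∑ j ∈ s, c j * y j) v paramLaw := by
  have hind : ProbabilityTheory.iIndepFun (fun (j : ℕ) (y : ℕ → ℝ) => c j * y j) paramLaw :=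
    ProbabilityTheory.iIndepFun_infinitePi (P := fun _ : ℕ => unif)
      (X := fun j x => c j * x) fun j => by fun_prop
  have h := ProbabilityTheory.HasSubgaussianMGF.sum_of_iIndepFun hind (s := s)
    (c := fun j => (Real.toNNReal (c j ^ 2)) * 1)
    (fun j _ => by
      have := (hasSubgaussianMGF_coord j).const_mul (c j)
      rwa [show (⟨c j ^ 2, sq_nonneg _⟩ : ℝ≥0) = Real.toNNReal (c j ^ 2) from
        (Real.toNNReal_of_nonneg (sq_nonneg _)).symm] at this)
  refine ⟨by fun_prop, fun t => ?_⟩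
  rw [← ofReal_integral_eq_lintegral_ofReal (h.integrable_exp_mul t)
    (ae_of_all _ fun _ => (Real.exp_pos _).le)]
  refine ENNReal.ofReal_le_ofReal ((h.mgf_le t).trans (Real.exp_le_exp.2 ?_))
  push_cast
  have h0 : 0 ≤ ∑ j ∈ s, c j ^ 2 := Finset.sum_nonneg fun _ _ => sq_nonneg _
  simp only [mul_one, Real.coe_toNNReal _ (sq_nonneg _)]
  -- Hoeffding's bound has the exponent `v t² / 2`; `SubGaussian` asks only for `v t²`.
  nlinarith [sq_nonneg t, mul_le_mul_of_nonneg_right hv (sq_nonneg t),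
    mul_nonneg h0 (sq_nonneg t)]

variable {d : ℕ}

/-- The terms common to both partial sums contribute differences of `g j`, hence the factor `D`; the
remaining terms contribute values of `g j`, hence the increment of the sums of `w`. -/
theorem subGaussian_kappaPartial_sub {g : ℕ → Space d → ℝ} {w : ℕ → ℝ} {x x' : Space d} {D : ℝ}
    (hx : ∀ j, |g j x| ^ 2 ≤ w j) (hxx : ∀ j, |g j x - g j x'| ^ 2 ≤ w j * D)
    {M N : ℕ} (hMN : M ≤ N) :
    SubGaussian (fun y => kappaPartial g N x y - kappaPartial g M x' y)
      ((∑ j ∈ Finset.range M, w j) * D + (∑ j ∈ Finset.range N, w j - ∑ j ∈ Finset.range M, w j))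
      paramLaw := by
  have h := subGaussian_sum (Finset.range N) (fun j => if j < M then g j x - g j x' else g j x)
    (v := (∑ j ∈ Finset.range M, w j) * D +
      (∑ j ∈ Finset.range N, w j - ∑ j ∈ Finset.range M, w j)) (by
    rw [← Finset.sum_range_add_sum_Ico _ hMN, Finset.sum_mul, ← Finset.sum_Ico_eq_sub _ hMN]
    refine add_le_add (Finset.sum_le_sum fun j hj => ?_) (Finset.sum_le_sum fun j hj => ?_)
    · rw [if_pos (Finset.mem_range.1 hj), ← sq_abs]; exact hxx j
    · rw [if_neg (not_lt.2 (Finset.mem_Ico.1 hj).1), ← sq_abs]; exact hx j)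
  convert h using 2 with y
  unfold kappaPartial
  rw [← Finset.sum_range_add_sum_Ico _ hMN, ← Finset.sum_range_add_sum_Ico _ hMN,
    add_sub_right_comm, ← Finset.sum_sub_distrib]
  congr 1
  · refine Finset.sum_congr rfl fun j hj => ?_
    rw [if_pos (Finset.mem_range.1 hj), sub_mul]
  · refine Finset.sum_congr rfl fun j hj => ?_
    rw [if_neg (not_lt.2 (Finset.mem_Ico.1 hj).1)]

theorem sqrt_abs_sub_le (a b c : ℝ) : √|a - c| ≤ √|a - b| + √|b - c| := by
  rw [Real.sqrt_le_left (by positivity), add_sq, Real.sq_sqrt (abs_nonneg _),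
    Real.sq_sqrt (abs_nonneg _)]
  have := abs_sub_le a b c
  have : 0 ≤ 2 * √|a - b| * √|b - c| := by positivity
  linarith

/-- A series `∑ g_j y_j` with square summable uniform and Hölder bounds on the `g_j` converges
uniformly almost surely, with exponential moments of the Hölder norm of its sum. -/
theorem exists_kappa_bound {X : Set (Space d)} (hne : X.Nonempty) (hX : Bornology.IsBounded X)
    (g : ℕ → Space d → ℝ) (β : ℕ → ℝ) (hβ : Summable fun j => β j ^ 2)
    {η θ : ℝ} (hη : η ≤ 1) (hθ : 0 < θ) (hθη : θ < η)
    (hg : ∀ j, ∀ x ∈ X, |g j x| ≤ β j)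
    (hgg : ∀ j, ∀ x ∈ X, ∀ x' ∈ X, |g j x - g j x'| ≤ β j * ‖x - x'‖ ^ η) :
    ∃ K : (ℕ → ℝ) → ℝ, HasExpMoments K paramLaw ∧ ∀ᵐ y ∂paramLaw,
      TendstoUniformlyOn (fun N x => kappaPartial g N x y) (fun x => kappa g x y) atTop X ∧
      ∀ x ∈ X, |kappa g x y| ≤ K y ∧
        ∀ x' ∈ X, |kappa g x y - kappa g x' y| ≤ K y * ‖x - x'‖ ^ θ := by
  have hη0 : 0 < η := hθ.trans hθη
  have hβ0 : ∀ j, 0 ≤ β j := fun j => (abs_nonneg _).trans (hg j _ hne.some_mem)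
  -- The added geometric term makes every weight positive, so that `t` is strictly increasing and
  -- `√|t N - t M|` separates the indices.
  set w : ℕ → ℝ := fun j => β j ^ 2 + (1 / 2) ^ j with hw
  have hwpos : ∀ j, 0 < w j := fun j => by positivity
  have hwsum : Summable w := hβ.add (summable_geometric_of_lt_one (by norm_num) (by norm_num))
  have hβw : ∀ j, β j ^ 2 ≤ w j := fun j => le_add_of_nonneg_right (by positivity)
  set t : ℕ → ℝ := fun N => ∑ j ∈ Finset.range N, w j with ht
  set T : ℝ := ∑' j, w j with hT
  have htT : ∀ N, t N ≤ T := fun N => hwsum.sum_le_tsum _ fun j _ => (hwpos j).le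
  have ht0 : ∀ N, 0 ≤ t N := fun N => Finset.sum_nonneg fun j _ => (hwpos j).le
  have htmono : Monotone t := monotone_nat_of_le_succ fun N => by
    simp only [ht, Finset.sum_range_succ]; linarith [hwpos N]
  have hT0 : 0 ≤ T := (ht0 0).trans (htT 0)
  have htlim : Tendsto t atTop (𝓝 T) := hwsum.hasSum.tendsto_sum_nat
  have : Nonempty X := hne.to_subtype
  -- The truncation index is part of the parameter, so a single chaining argument gives both uniform
  -- convergence in `N` and Hölder continuity in `x`.
  let ι := ℕ × X
  let Y : ι → (ℕ → ℝ) → ℝ := fun z y => kappaPartial g z.1 z.2 y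
  let ρ : ι → ι → ℝ := fun z w => max (√|t z.1 - t w.1|) ‖(z.2 : Space d) - w.2‖
  have hρ0 : ∀ z w, 0 ≤ ρ z w := fun z w => le_max_of_le_left (Real.sqrt_nonneg _)
  have hρc : ∀ z w, ρ z w = ρ w z := fun z w => by
    simp only [ρ]; rw [abs_sub_comm, norm_sub_rev]
  have hρt : ∀ z w v, ρ z v ≤ ρ z w + ρ w v := fun z w v =>
    max_le ((sqrt_abs_sub_le _ (t w.1) _).trans (add_le_add (le_max_left _ _) (le_max_left _ _)))
      ((norm_sub_le_norm_sub_add_norm_sub _ (w.2 : Space d) _).trans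
        (add_le_add (le_max_right _ _) (le_max_right _ _)))
  obtain ⟨R₀, hR₀⟩ := hX.exists_norm_le
  obtain ⟨R, hR⟩ := exists_nat_ge (max R₀ T)
  -- Level `2 * n + d`: the square root in `ρ` requires `t` to within `(2^(-n))²`, and `d * 2^(-d) ≤
  -- 1` absorbs the passage from coordinates to the Euclidean norm.
  have hnet := fun n : ℕ => exists_net (ι := ι) (κ := Option (Fin d))
    (fun z i => i.elim (t z.1) fun i => (z.2 : Space d) i) R (by
      rintro z (_ | i)
      · simp only [Option.elim]
        rw [abs_of_nonneg (ht0 _)]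
        exact (htT _).trans ((le_max_right _ _).trans hR)
      · simp only [Option.elim]
        exact (PiLp.norm_apply_le (z.2 : Space d) i).trans ((hR₀ _ z.2.2).trans
          ((le_max_left _ _).trans hR))) (2 * n + d)
  choose net π hπ hπf hcard using hnet
  have hd2 : ((d : ℝ)) * (1 / 2) ^ d ≤ 1 := by
    rw [one_div, inv_pow, ← div_eq_mul_inv, div_le_one (by positivity)]
    exact_mod_cast (Nat.lt_two_pow_self).le
  have hπρ : ∀ n z, ρ z (π n z) ≤ (1 / 2) ^ n := by
    intro n z
    have hp : (1 / 2 : ℝ) ^ (2 * n + d) ≤ ((1 / 2) ^ n) ^ 2 := by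
      rw [← pow_mul, mul_comm n 2]
      exact pow_le_pow_of_le_one (by norm_num) (by norm_num) (by omega)
    refine max_le ?_ ?_
    · rw [Real.sqrt_le_left (by positivity)]
      exact (hπf n z none).trans hp
    · have h1 : ∀ i, |((z.2 : Space d) - ((π n z).2 : Space d)) i| ≤ (1 / 2) ^ (2 * n + d) :=
        fun i => hπf n z (some i)
      have h2 : ‖(z.2 : Space d) - ((π n z).2 : Space d)‖ ≤ ∑ _i : Fin d,
          (1 / 2 : ℝ) ^ (2 * n + d) := by
        rw [EuclideanSpace.norm_eq, Real.sqrt_le_left (by positivity)]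
        refine (Finset.sum_le_sum fun i _ => pow_le_pow_left₀ (norm_nonneg _) (h1 i) 2).trans ?_
        exact Finset.sum_sq_le_sq_sum_of_nonneg fun _ _ => by positivity
      rw [Finset.sum_const, Finset.card_univ, Fintype.card_fin, nsmul_eq_mul] at h2
      refine h2.trans ?_
      rw [pow_add, ← mul_assoc, mul_comm (d : ℝ), mul_assoc]
      have h3 : (1 / 2 : ℝ) ^ (2 * n) ≤ (1 / 2) ^ n :=
        pow_le_pow_of_le_one (by norm_num) (by norm_num) (by omega)
      exact (mul_le_of_le_one_right (by positivity) hd2).trans h3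
  obtain ⟨K, hK, hKY⟩ := exists_holder_bound (μ := paramLaw) Y ρ hρ0 hρc hρt net π hπ hπρ
    (A := ((2 * R + 1) * 2 ^ d) ^ (d + 1)) (b := 4 ^ (d + 1)) (c := T + 9) (η := η) (θ := θ)
    (by positivity) (one_le_pow₀ (by norm_num))
    (fun n => by
      refine (hcard n).trans (le_of_eq ?_)
      rw [Fintype.card_option, Fintype.card_fin, ← pow_mul (4 : ℝ), mul_comm (d + 1) n,
        pow_mul (4 : ℝ), ← mul_pow, pow_add (2 : ℝ), pow_mul (2 : ℝ) 2 n]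
      norm_num
      ring)
    (by positivity) hθ hθη
    (fun z => (subGaussian_sum (Finset.range z.1) (fun j => g j z.2) (v := T + 9) (by
      refine le_trans (Finset.sum_le_sum fun j _ => ?_) ((htT z.1).trans (by linarith))
      rw [← sq_abs]
      exact (pow_le_pow_left₀ (abs_nonneg _) (hg j _ z.2.2) 2).trans (hβw j))))
    (fun z v hzv => by
      have key : ∀ z v : ι, ρ z v ≤ 3 → v.1 ≤ z.1 →
          SubGaussian (fun y => Y z y - Y v y) ((T + 9) * ρ z v ^ (2 * η)) paramLaw := by
        intro z v hzv hle
        refine (subGaussian_kappaPartial_sub (g := g) (w := w)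
          (D := ‖(z.2 : Space d) - v.2‖ ^ (2 * η))
          (fun j => (pow_le_pow_left₀ (abs_nonneg _) (hg j _ z.2.2) 2).trans (hβw j))
          (fun j => ?_) hle).mono ?_
        · refine (pow_le_pow_left₀ (abs_nonneg _) (hgg j _ z.2.2 _ v.2.2) 2).trans ?_
          rw [mul_pow, mul_comm 2 η, Real.rpow_mul (norm_nonneg _), Real.rpow_two]
          exact mul_le_mul_of_nonneg_right (hβw j) (by positivity)
        · have h1 : ‖(z.2 : Space d) - v.2‖ ^ (2 * η) ≤ ρ z v ^ (2 * η) :=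
            Real.rpow_le_rpow (norm_nonneg _) (le_max_right _ _) (by linarith)
          have h2 : t z.1 - t v.1 ≤ ρ z v ^ 2 := by
            have h3 : √|t z.1 - t v.1| ^ 2 ≤ ρ z v ^ 2 :=
              pow_le_pow_left₀ (Real.sqrt_nonneg _) (le_max_left _ _) 2
            rw [Real.sq_sqrt (abs_nonneg _)] at h3
            exact (le_abs_self _).trans h3
          -- Here `ρ ≤ 3` and `η ≤ 1` are used: `(ρ / 3)^2 ≤ (ρ / 3)^(2 η)`. This is the source of
          -- the `9` in the constant `T + 9`.
          have h4 : ρ z v ^ 2 ≤ 9 * ρ z v ^ (2 * η) := by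
            have h5 : (ρ z v / 3) ^ (2:ℝ) ≤ (ρ z v / 3) ^ (2 * η) :=
              Real.rpow_le_rpow_of_exponent_ge_of_imp (by have := hρ0 z v; positivity)
                (by linarith) (by linarith) (by intro _ h; linarith)
            rw [Real.rpow_two] at h5
            have h6 : (ρ z v / 3) ^ (2 * η) ≤ ρ z v ^ (2 * η) :=
              Real.rpow_le_rpow (by have := hρ0 z v; positivity) (by linarith [hρ0 z v])
                (by linarith)
            nlinarith
          have h7 : t v.1 * ‖(z.2 : Space d) - v.2‖ ^ (2 * η) ≤ T * ρ z v ^ (2 * η) :=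
            mul_le_mul (htT _) h1 (by positivity) hT0
          change t v.1 * ‖(z.2 : Space d) - v.2‖ ^ (2 * η) + (t z.1 - t v.1) ≤ _
          linarith
      rcases le_total v.1 z.1 with h | h
      · exact key z v hzv h
      · have := (key v z (by rwa [hρc]) h).const_mul (-1)
        rw [hρc v z] at this
        have e : (T + 9) * ρ z v ^ (2 * η) * (-1) ^ 2 = (T + 9) * ρ z v ^ (2 * η) := by ring
        rw [e] at this
        simpa using this)
    (by
      intro y z u hu
      have hs : Tendsto (fun n => |t z.1 - t (u n).1|) atTop (𝓝 0) := by
        have h1 : Tendsto (fun n => √|t z.1 - t (u n).1|) atTop (𝓝 0) :=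
          squeeze_zero (fun n => Real.sqrt_nonneg _) (fun n => le_max_left _ _) hu
        have h2 := h1.pow 2
        simpa [Real.sq_sqrt (abs_nonneg _)] using h2
      have hx : Tendsto (fun n => ‖(z.2 : Space d) - (u n).2‖ ^ η) atTop (𝓝 0) := by
        have h1 : Tendsto (fun n => ‖(z.2 : Space d) - (u n).2‖) atTop (𝓝 0) :=
          squeeze_zero (fun n => norm_nonneg _) (fun n => le_max_right _ _) hu
        simpa [Real.zero_rpow hη0.ne'] using h1.rpow_const (p := η) (Or.inr hη0.le)
      -- Truncation indices are isolated: another index changes `t` by at least one of the two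
      -- adjacent weights. At index `0` the truncated `z.1 - 1` is harmless, as there is no smaller
      -- index.
      have hev : ∀ᶠ n in atTop, (u n).1 = z.1 := by
        have hm : 0 < min (w z.1) (w (z.1 - 1)) := lt_min (hwpos _) (hwpos _)
        filter_upwards [hs.eventually (gt_mem_nhds hm)] with n hn
        by_contra hne
        rcases lt_or_gt_of_ne hne with h | h
        · have h1 : t (u n).1 ≤ t (z.1 - 1) := htmono (by omega)
          have h2 : t z.1 = t (z.1 - 1) + w (z.1 - 1) := by
            have h3 : z.1 = z.1 - 1 + 1 := by omega
            conv_lhs => rw [h3]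
            exact Finset.sum_range_succ _ _
          have := le_abs_self (t z.1 - t (u n).1)
          have := hn.trans_le (min_le_right _ _)
          linarith
        · have h1 : t (z.1 + 1) ≤ t (u n).1 := htmono h
          have h2 : t (z.1 + 1) = t z.1 + w z.1 := Finset.sum_range_succ _ _
          have := neg_le_abs (t z.1 - t (u n).1)
          have := hn.trans_le (min_le_left _ _)
          linarith
      have hS : Tendsto (fun n => kappaPartial g z.1 (u n).2 y) atTop
          (𝓝 (kappaPartial g z.1 z.2 y)) := by
        refine tendsto_finsetSum _ fun j _ => Tendsto.mul_const _ ?_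
        rw [tendsto_iff_dist_tendsto_zero]
        refine squeeze_zero (fun n => dist_nonneg) (fun n => ?_)
          (by simpa using hx.const_mul (β j))
        rw [dist_comm]
        exact hgg j _ z.2.2 _ (u n).2.2
      refine hS.congr' ?_
      filter_upwards [hev] with n hn
      simp only [Y, hn])
  refine ⟨K, hK, ?_⟩
  filter_upwards [hKY] with y hy
  -- The Hölder bound between two truncations at the same point involves only the tail of `∑ w`, so
  -- the Cauchy modulus is uniform in `x`.
  set e : ℕ → ℝ := fun N => K y * (√(T - t N)) ^ θ with he
  have he0 : Tendsto e atTop (𝓝 0) := by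
    have h1 : Tendsto (fun N => T - t N) atTop (𝓝 0) := by simpa using htlim.const_sub T
    have h2 := (h1.sqrt.rpow_const (p := θ) (Or.inr hθ.le)).const_mul (K y)
    simpa [Real.zero_rpow hθ.ne'] using h2
  have hcau : ∀ x ∈ X, ∀ n m N : ℕ, N ≤ n → N ≤ m →
      dist (kappaPartial g n x y) (kappaPartial g m x y) ≤ e N := by
    intro x hx n m N hn hm
    refine ((hy (n, ⟨x, hx⟩)).2 (m, ⟨x, hx⟩)).trans ?_
    refine mul_le_mul_of_nonneg_left ?_ (hK.nonneg y)
    refine Real.rpow_le_rpow (hρ0 _ _) (max_le ?_ ?_) hθ.le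
    · refine Real.sqrt_le_sqrt ?_
      have := htmono hn
      have := htmono hm
      have := htT n
      have := htT m
      rw [abs_le]
      constructor <;> simp only <;> linarith
    · simp
  have hlim : ∀ x ∈ X, Tendsto (fun N => kappaPartial g N x y) atTop (𝓝 (kappa g x y)) :=
    fun x hx => CauchySeq.tendsto_limUnder (cauchySeq_of_le_tendsto_0 e (hcau x hx) he0)
  refine ⟨?_, fun x hx => ⟨?_, fun x' hx' => ?_⟩⟩
  · rw [Metric.tendstoUniformlyOn_iff]
    intro ε hε
    filter_upwards [he0.eventually (gt_mem_nhds hε)] with N hN x hx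
    refine lt_of_le_of_lt ?_ hN
    rw [dist_comm]
    exact le_of_tendsto (tendsto_const_nhds.dist (hlim x hx)) <|
      (eventually_ge_atTop N).mono fun m hm => hcau x hx N m N le_rfl hm
  · exact le_of_tendsto' (hlim x hx).abs fun N => (hy (N, ⟨x, hx⟩)).1
  · refine le_of_tendsto' ((hlim x hx).sub (hlim x' hx')).abs fun N => ?_
    refine ((hy (N, ⟨x, hx⟩)).2 (N, ⟨x', hx'⟩)).trans (le_of_eq ?_)
    simp [ρ]

end Nets

section DifferentiableFunctions

variable {d : ℕ}

/-! ### Partial derivatives -/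

/-- The partial derivative `∂_l f`. -/
def partialD (l : Fin d) (f : Space d → ℝ) (x : Space d) : ℝ :=
  fderiv ℝ f x (EuclideanSpace.single l 1)

/-- The linear form with the given coefficients. -/
def linForm (c : Fin d → ℝ) : Space d →L[ℝ] ℝ := ∑ l, c l • EuclideanSpace.proj (𝕜 := ℝ) l

theorem linForm_apply (c : Fin d → ℝ) (v : Space d) : linForm c v = ∑ l, c l * v l := by
  simp [linForm]

theorem linForm_single (c : Fin d → ℝ) (l : Fin d) :
    linForm c (EuclideanSpace.single l 1) = c l := by
  simp [linForm_apply]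

theorem eq_linForm (L : Space d →L[ℝ] ℝ) :
    L = linForm fun l => L (EuclideanSpace.single l 1) := by
  apply ContinuousLinearMap.coe_injective
  refine (EuclideanSpace.basisFun (Fin d) ℝ).toBasis.ext fun l => ?_
  simp only [OrthonormalBasis.coe_toBasis, EuclideanSpace.basisFun_apply,
    ContinuousLinearMap.coe_coe]
  rw [linForm_single]

theorem fderiv_eq_linForm (f : Space d → ℝ) (x : Space d) :
    fderiv ℝ f x = linForm fun l => partialD l f x := eq_linForm _

theorem norm_linForm_le (c : Fin d → ℝ) : ‖linForm c‖ ≤ ∑ l, |c l| := by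
  refine ContinuousLinearMap.opNorm_le_bound _ (Finset.sum_nonneg fun _ _ => abs_nonneg _)
    fun v => ?_
  rw [linForm_apply, Finset.sum_mul]
  refine (norm_sum_le _ _).trans (Finset.sum_le_sum fun l _ => ?_)
  rw [norm_mul, Real.norm_eq_abs]
  exact mul_le_mul_of_nonneg_left (PiLp.norm_apply_le v l) (abs_nonneg _)

theorem linForm_sub (c c' : Fin d → ℝ) : linForm c - linForm c' = linForm fun l => c l - c' l := by
  ext v; simp [linForm_apply, sub_mul]

theorem partialD_congr {B : Set (Space d)} (hB : IsOpen B) {f g : Space d → ℝ}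
    (h : Set.EqOn f g B) (l : Fin d) : Set.EqOn (partialD l f) (partialD l g) B := fun x hx => by
  unfold partialD
  rw [(h.eventuallyEq_of_mem (hB.mem_nhds hx)).fderiv_eq]

theorem pderiv_continuousOn {B : Set (Space d)} (hB : IsOpen B) {f : Space d → ℝ} {m : ℕ}
    (hf : ContDiffOn ℝ m f B) (w : Fin m → Fin d) : ContinuousOn (pderiv w f) B := by
  have h : ContinuousOn (iteratedFDeriv ℝ m f) B :=
    (hf.continuousOn_iteratedFDerivWithin le_rfl hB.uniqueDiffOn).congr
      (iteratedFDerivWithin_of_isOpen m hB).symm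
  intro x hx
  exact ((ContinuousMultilinearMap.apply ℝ (fun _ : Fin m => Space d) ℝ
    (fun l => EuclideanSpace.single (w l) (1 : ℝ))).continuous.continuousAt.comp_continuousWithinAt
      (h x hx))

/-- Links the words that index `derivBound` to the recursion of `CkHolder`. The derivative taken
first occupies the last slot of the iterated derivative, hence `Fin.snoc`. -/
theorem pderiv_partialD {B : Set (Space d)} (hB : IsOpen B) {f : Space d → ℝ} {m : ℕ}
    (hf : ContDiffOn ℝ (m + 1 : ℕ) f B) (w : Fin m → Fin d) (l : Fin d) {x : Space d}
    (hx : x ∈ B) :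
    pderiv w (partialD l f) x = pderiv (Fin.snoc w l : Fin (m + 1) → Fin d) f x := by
  have h : ContDiffAt ℝ m (fderiv ℝ f) x :=
    (hf.fderiv_of_isOpen hB (by push_cast; exact le_rfl)).contDiffAt (hB.mem_nhds hx)
  have e := (ContinuousLinearMap.apply ℝ ℝ
    (EuclideanSpace.single l (1 : ℝ) : Space d)).iteratedFDeriv_comp_left h le_rfl
  have e1 : pderiv w (partialD l f) x = (iteratedFDeriv ℝ m ((ContinuousLinearMap.apply ℝ ℝ
    (EuclideanSpace.single l (1 : ℝ) : Space d)) ∘ fderiv ℝ f) x)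
      fun i => EuclideanSpace.single (w i) (1 : ℝ) := rfl
  rw [e1, e]
  unfold pderiv
  rw [iteratedFDeriv_succ_apply_right]
  simp only [ContinuousLinearMap.compContinuousMultilinearMap_coe, Function.comp_apply,
    ContinuousLinearMap.apply_apply, Fin.snoc_last]
  congr 2
  ext i
  simp [Fin.init]

theorem partialD_contDiffOn {B : Set (Space d)} (hB : IsOpen B) {f : Space d → ℝ} {m : ℕ}
    (hf : ContDiffOn ℝ (m + 1 : ℕ) f B) (l : Fin d) : ContDiffOn ℝ m (partialD l f) B :=
  (hf.fderiv_of_isOpen hB (by push_cast; exact le_rfl)).clm_apply contDiffOn_const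

/-! ### Hölder spaces -/

/-- `|f| ≤ M` on `B`, and `f` is Hölder continuous on `B` with exponent `θ` and constant `M`. -/
def HolderBdd (B : Set (Space d)) (θ M : ℝ) (f : Space d → ℝ) : Prop :=
  ∀ x ∈ B, |f x| ≤ M ∧ ∀ x' ∈ B, |f x - f x'| ≤ M * ‖x - x'‖ ^ θ

/-- The partial derivatives of `f` up to order `k` exist on `B`, are bounded by `M`, and are Hölder
continuous on `B` with exponent `θ` and constant `M`. -/
def CkHolder (B : Set (Space d)) (θ : ℝ) : ℕ → ℝ → (Space d → ℝ) → Prop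
  | 0, M, f => HolderBdd B θ M f
  | k + 1, M, f => HolderBdd B θ M f ∧ (∀ x ∈ B, DifferentiableAt ℝ f x) ∧
      ∀ l, CkHolder B θ k M (partialD l f)

variable {B : Set (Space d)} {θ : ℝ}

theorem HolderBdd.mono {M N : ℝ} {f : Space d → ℝ} (h : HolderBdd B θ M f) (hMN : M ≤ N) :
    HolderBdd B θ N f := fun x hx => ⟨(h x hx).1.trans hMN, fun x' hx' =>
  ((h x hx).2 x' hx').trans (mul_le_mul_of_nonneg_right hMN (by positivity))⟩

theorem HolderBdd.congr {M : ℝ} {f g : Space d → ℝ} (h : HolderBdd B θ M f)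
    (hfg : Set.EqOn f g B) : HolderBdd B θ M g := fun x hx => by
  refine ⟨hfg hx ▸ (h x hx).1, fun x' hx' => ?_⟩
  rw [← hfg hx, ← hfg hx']
  exact (h x hx).2 x' hx'

theorem HolderBdd.add {M N : ℝ} {f g : Space d → ℝ} (hf : HolderBdd B θ M f)
    (hg : HolderBdd B θ N g) : HolderBdd B θ (M + N) (fun x => f x + g x) := fun x hx => by
  refine ⟨(abs_add_le _ _).trans (add_le_add (hf x hx).1 (hg x hx).1), fun x' hx' => ?_⟩
  rw [add_sub_add_comm, add_mul]
  exact (abs_add_le _ _).trans (add_le_add ((hf x hx).2 x' hx') ((hg x hx).2 x' hx'))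

theorem HolderBdd.mul {M N : ℝ} {f g : Space d → ℝ} (hM : 0 ≤ M) (hN : 0 ≤ N)
    (hf : HolderBdd B θ M f)
    (hg : HolderBdd B θ N g) : HolderBdd B θ (2 * (M * N)) (fun x => f x * g x) := fun x hx => by
  have h1 := mul_le_mul (hf x hx).1 (hg x hx).1 (abs_nonneg _) hM
  refine ⟨by rw [abs_mul]; nlinarith, fun x' hx' => ?_⟩
  have e : f x * g x - f x' * g x' = f x * (g x - g x') + (f x - f x') * g x' := by ring
  rw [e]
  have h2 := mul_le_mul (hf x hx).1 ((hg x hx).2 x' hx') (abs_nonneg _) hM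
  have h3 := mul_le_mul ((hf x hx).2 x' hx') (hg x' hx').1 (abs_nonneg _) (by positivity)
  rw [← abs_mul] at h2 h3
  refine (abs_add_le _ _).trans ((add_le_add h2 h3).trans (le_of_eq ?_))
  ring

theorem HolderBdd.continuousOn {M : ℝ} {f : Space d → ℝ} (hθ : 0 < θ) (h : HolderBdd B θ M f) :
    ContinuousOn f B := by
  intro x hx
  rw [ContinuousWithinAt, tendsto_iff_dist_tendsto_zero]
  have h1 : Tendsto (fun x' => M * ‖x - x'‖ ^ θ) (𝓝[B] x) (𝓝 0) := by
    have h2 : Tendsto (fun x' => ‖x - x'‖) (𝓝[B] x) (𝓝 0) := by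
      have : ContinuousWithinAt (fun x' => ‖x - x'‖) B x := by fun_prop
      simpa [ContinuousWithinAt] using this
    simpa [Real.zero_rpow hθ.ne'] using (h2.rpow_const (p := θ) (Or.inr hθ.le)).const_mul M
  refine squeeze_zero' (Eventually.of_forall fun _ => dist_nonneg) ?_ h1
  filter_upwards [self_mem_nhdsWithin] with x' hx'
  rw [dist_comm]
  exact (h x hx).2 x' hx'

theorem CkHolder.holderBdd {k : ℕ} {M : ℝ} {f : Space d → ℝ} (h : CkHolder B θ k M f) :
    HolderBdd B θ M f := by
  cases k with
  | zero => exact h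
  | succ k => exact h.1

theorem CkHolder.of_succ {k : ℕ} {M : ℝ} {f : Space d → ℝ} (h : CkHolder B θ (k + 1) M f) :
    CkHolder B θ k M f := by
  induction k generalizing f with
  | zero => exact h.1
  | succ k ih => exact ⟨h.1, h.2.1, fun l => ih (h.2.2 l)⟩

theorem CkHolder.of_le {k m : ℕ} (hmk : m ≤ k) {M : ℝ} {f : Space d → ℝ}
    (h : CkHolder B θ k M f) : CkHolder B θ m M f := by
  induction k, hmk using Nat.le_induction with
  | base => exact h
  | succ k _ ih => exact ih h.of_succ

theorem CkHolder.mono {k : ℕ} {M N : ℝ} {f : Space d → ℝ} (h : CkHolder B θ k M f)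
    (hMN : M ≤ N) : CkHolder B θ k N f := by
  induction k generalizing f with
  | zero => exact HolderBdd.mono h hMN
  | succ k ih => exact ⟨h.1.mono hMN, h.2.1, fun l => ih (h.2.2 l)⟩

theorem CkHolder.congr (hB : IsOpen B) {k : ℕ} {M : ℝ} {f g : Space d → ℝ}
    (h : CkHolder B θ k M f) (hfg : Set.EqOn f g B) : CkHolder B θ k M g := by
  induction k generalizing f g with
  | zero => exact HolderBdd.congr h hfg
  | succ k ih => exact ⟨h.1.congr hfg, fun x hx => (h.2.1 x hx).congr_of_eventuallyEq
      (hfg.symm.eventuallyEq_of_mem (hB.mem_nhds hx)),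
      fun l => ih (h.2.2 l) (partialD_congr hB hfg l)⟩

theorem CkHolder.add (hB : IsOpen B) {k : ℕ} {M N : ℝ} {f g : Space d → ℝ}
    (hf : CkHolder B θ k M f) (hg : CkHolder B θ k N g) :
    CkHolder B θ k (M + N) (fun x => f x + g x) := by
  induction k generalizing f g with
  | zero => exact HolderBdd.add hf hg
  | succ k ih =>
    refine ⟨hf.1.add hg.1, fun x hx => (hf.2.1 x hx).add (hg.2.1 x hx), fun l => ?_⟩
    refine (ih (hf.2.2 l) (hg.2.2 l)).congr hB fun x hx => ?_
    simp only [partialD]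
    rw [fderiv_fun_add (hf.2.1 x hx) (hg.2.1 x hx)]
    rfl

/-- The product rule has two summands, each of one order less; each order thus doubles the constant.
-/
theorem CkHolder.mul (hB : IsOpen B) {k : ℕ} {M N : ℝ} {f g : Space d → ℝ} (hM : 0 ≤ M)
    (hN : 0 ≤ N) (hf : CkHolder B θ k M f) (hg : CkHolder B θ k N g) :
    CkHolder B θ k (2 ^ (k + 1) * (M * N)) (fun x => f x * g x) := by
  induction k generalizing f g with
  | zero =>
    rw [zero_add, pow_one]
    exact HolderBdd.mul hM hN hf hg
  | succ k ih =>
    refine ⟨(hf.1.mul hM hN hg.1).mono ?_, fun x hx => (hf.2.1 x hx).mul (hg.2.1 x hx),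
      fun l => ?_⟩
    · refine mul_le_mul_of_nonneg_right ?_ (by positivity)
      exact le_self_pow₀ (by norm_num) (by omega)
    · have h := (ih hf.of_succ (hg.2.2 l)).add hB (ih (hf.2.2 l) hg.of_succ)
      rw [show 2 ^ (k + 1) * (M * N) + 2 ^ (k + 1) * (M * N) = 2 ^ (k + 1 + 1) * (M * N) by ring]
        at h
      refine h.congr hB fun x hx => ?_
      simp only [partialD]
      rw [fderiv_fun_mul (hf.2.1 x hx) (hg.2.1 x hx)]
      simp
      ring

theorem abs_exp_sub_exp_le {a b M : ℝ} (ha : a ≤ M) (hb : b ≤ M) :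
    |Real.exp a - Real.exp b| ≤ Real.exp M * |a - b| := by
  have key : ∀ a b : ℝ, a ≤ M → Real.exp a - Real.exp b ≤ Real.exp M * |a - b| := by
    intro a b ha
    have h1 : Real.exp a * (b - a + 1) ≤ Real.exp b := by
      have := mul_le_mul_of_nonneg_left (Real.add_one_le_exp (b - a)) (Real.exp_pos a).le
      rwa [← Real.exp_add, add_sub_cancel] at this
    have h2 : Real.exp a * (a - b) ≤ Real.exp a * |a - b| :=
      mul_le_mul_of_nonneg_left (le_abs_self _) (Real.exp_pos a).le
    have h3 : Real.exp a * |a - b| ≤ Real.exp M * |a - b| :=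
      mul_le_mul_of_nonneg_right (Real.exp_le_exp.2 ha) (abs_nonneg _)
    linarith
  rw [abs_le]
  have h1 := key a b ha
  have h2 := key b a hb
  rw [abs_sub_comm] at h2
  constructor <;> linarith

theorem HolderBdd.exp {M : ℝ} {f : Space d → ℝ} (hf : HolderBdd B θ M f) :
    HolderBdd B θ (Real.exp (2 * M)) (fun x => Real.exp (f x)) := by
  intro x hx
  have hM : 0 ≤ M := (abs_nonneg _).trans (hf x hx).1
  have h1 := (abs_le.1 (hf x hx).1).2
  refine ⟨?_, fun x' hx' => ?_⟩
  · rw [abs_of_pos (Real.exp_pos _)]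
    exact Real.exp_le_exp.2 (by linarith)
  · refine (abs_exp_sub_exp_le h1 (abs_le.1 (hf x' hx').1).2).trans ?_
    have h2 : M ≤ Real.exp M := by linarith [Real.add_one_le_exp M]
    have h3 := (hf x hx).2 x' hx'
    have hp : 0 ≤ ‖x - x'‖ ^ θ := by positivity
    calc Real.exp M * |f x - f x'| ≤ Real.exp M * (Real.exp M * ‖x - x'‖ ^ θ) := by
          gcongr; exact h3.trans (mul_le_mul_of_nonneg_right h2 hp)
      _ = _ := by rw [two_mul, Real.exp_add, mul_assoc]

/-- Induction through `∂(exp f) = exp f * ∂f`. The exponent stays linear in `M`, because `2` and `M`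
are at most `exp M` when `M ≥ 1`; exponential moments of `M` thus become moments of all orders. -/
theorem CkHolder.exp (hB : IsOpen B) (k : ℕ) : ∃ c : ℝ, 2 ≤ c ∧ ∀ M : ℝ, 1 ≤ M →
    ∀ f : Space d → ℝ, CkHolder B θ k M f →
      CkHolder B θ k (Real.exp (c * M)) (fun x => Real.exp (f x)) := by
  induction k with
  | zero => exact ⟨2, le_rfl, fun M _ f hf => HolderBdd.exp hf⟩
  | succ k ih =>
    obtain ⟨c, hc, ih⟩ := ih
    refine ⟨c + (k + 1) + 1, by have : (0:ℝ) ≤ k := k.cast_nonneg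
                                linarith, fun M hM f hf => ?_⟩
    have hk : (0:ℝ) ≤ k := k.cast_nonneg
    refine ⟨hf.1.exp.mono (Real.exp_le_exp.2 ?_), fun x hx => (hf.2.1 x hx).exp, fun l => ?_⟩
    · exact mul_le_mul_of_nonneg_right (by linarith) (by linarith)
    · have h := (ih M hM f hf.of_succ).mul hB (Real.exp_pos _).le (by linarith : 0 ≤ M) (hf.2.2 l)
      refine (h.mono ?_).congr hB fun x hx => ?_
      · have h1 : M ≤ Real.exp M := by linarith [Real.add_one_le_exp M]
        have h2 : (2:ℝ) ≤ Real.exp M := by linarith [Real.add_one_le_exp M]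
        calc 2 ^ (k + 1) * (Real.exp (c * M) * M)
            ≤ Real.exp M ^ (k + 1) * (Real.exp (c * M) * Real.exp M) := by gcongr
          _ = _ := by
            rw [← Real.exp_nat_mul, ← Real.exp_add, ← Real.exp_add]
            push_cast
            ring_nf
      · simp only [partialD]
        rw [fderiv_exp (hf.2.1 x hx)]
        rfl

/-! ### Lipschitz domains -/

theorem abs_sub_le_of_segment {f : Space d → ℝ} {b : ℝ}
    (hf : ∀ x ∈ B, DifferentiableAt ℝ f x) (hb : ∀ x ∈ B, ‖fderiv ℝ f x‖ ≤ b) {x x' : Space d}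
    (h : segment ℝ x x' ⊆ B) : |f x - f x'| ≤ b * ‖x - x'‖ :=
  (convex_segment x x').norm_image_sub_le_of_norm_fderiv_le (fun z hz => hf z (h hz))
    (fun z hz => hb z (h hz)) (right_mem_segment ℝ x x') (left_mem_segment ℝ x x')

/-- Near a boundary point, two points at distance `h` are joined by a path of three segments inside
`B`: up along `e` by `(L + 1) h`, across, and down again. On the crossing the graph rises by at most
`L h` and the height drops by at most `h`, so the lift keeps the path above the graph. At an
interior point a ball in `B` suffices. -/
theorem exists_ball_lipschitz (hB : IsOpen B) (hL : HasLipschitzBoundary B) {x₀ : Space d}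
    (hx₀ : x₀ ∈ closure B) : ∃ r C : ℝ, 0 < r ∧ 0 ≤ C ∧ ∀ (f : Space d → ℝ) (b : ℝ),
      (∀ x ∈ B, DifferentiableAt ℝ f x) → (∀ x ∈ B, ‖fderiv ℝ f x‖ ≤ b) →
      ∀ x ∈ B ∩ Metric.ball x₀ r, ∀ x' ∈ B ∩ Metric.ball x₀ r,
        |f x - f x'| ≤ C * b * ‖x - x'‖ := by
  by_cases hx : x₀ ∈ B
  · obtain ⟨r, hr, hrB⟩ := Metric.isOpen_iff.1 hB x₀ hx
    refine ⟨r, 1, hr, zero_le_one, fun f b hf hb x hx x' hx' => ?_⟩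
    rw [one_mul]
    exact abs_sub_le_of_segment hf hb
      (((convex_ball x₀ r).segment_subset hx.2 hx'.2).trans hrB)
  obtain ⟨r₀, hr₀, e, he, L, γ, hγ, hγe, hγB⟩ :=
    hL x₀ ⟨hx₀, fun h => hx (interior_subset h)⟩
  have hL0 : (0:ℝ) ≤ L := L.2
  set m : ℝ := L + 1 with hm
  -- For points of the small ball `h < 2 r`, so the lifted points stay within `(2 m + 1) r < r₀` of
  -- `x₀`. The constant `2 m + 1` is the length of the path divided by `h`.
  refine ⟨r₀ / (2 * m + 2), 2 * m + 1, by positivity, by positivity,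
    fun f b hf hb x hx x' hx' => ?_⟩
  set r := r₀ / (2 * m + 2) with hr
  have hrr : (2 * m + 2) * r = r₀ := by rw [hr]; exact mul_div_cancel₀ _ (by positivity)
  have hrpos : 0 < r := by positivity
  have hrle : r ≤ r₀ := by nlinarith
  set h : ℝ := ‖x - x'‖ with hh
  have hx1 := mem_ball_iff_norm.1 hx.2
  have hx2 := mem_ball_iff_norm.1 hx'.2
  have hh0 : 0 ≤ h := norm_nonneg _
  have hh2 : h < 2 * r := by
    have : ‖x - x'‖ ≤ ‖x - x₀‖ + ‖x' - x₀‖ := by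
      rw [← sub_sub_sub_cancel_right x x' x₀]; exact norm_sub_le _ _
    linarith
  have hball : ∀ z ∈ Metric.ball x₀ r, ∀ τ : ℝ, 0 ≤ τ → τ ≤ m * h →
      z + τ • e ∈ Metric.ball x₀ r₀ := by
    intro z hz τ h0 h1
    rw [mem_ball_iff_norm] at hz ⊢
    have : ‖z + τ • e - x₀‖ ≤ ‖z - x₀‖ + τ := by
      rw [add_sub_right_comm]
      refine (norm_add_le _ _).trans ?_
      rw [norm_smul, he, mul_one, Real.norm_of_nonneg h0]
    have : m * h ≤ m * (2 * r) := by gcongr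
    nlinarith
  have hee : inner ℝ e e = (1:ℝ) := by rw [real_inner_self_eq_norm_sq, he, one_pow]
  have hin : ∀ z ∈ B ∩ Metric.ball x₀ r, ∀ τ : ℝ, 0 ≤ τ → τ ≤ m * h → z + τ • e ∈ B := by
    intro z hz τ h0 h1
    rw [hγB _ (hball z hz.2 τ h0 h1), hγe, inner_add_left, real_inner_smul_left, hee]
    have := (hγB z (Metric.ball_subset_ball hrle hz.2)).1 hz.1
    linarith
  have hvert : ∀ z ∈ B ∩ Metric.ball x₀ r, |f z - f (z + (m * h) • e)| ≤ b * (m * h) := by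
    intro z hz
    have := abs_sub_le_of_segment hf hb (x := z) (x' := z + (m * h) • e) (by
      rw [segment_eq_image']
      rintro _ ⟨τ, ⟨h0, h1⟩, rfl⟩
      have : z + τ • (z + (m * h) • e - z) = z + (τ * (m * h)) • e := by
        rw [add_sub_cancel_left, smul_smul]
      simp only
      rw [this]
      exact hin z hz _ (by positivity) (mul_le_of_le_one_left (by positivity) h1))
    refine this.trans (le_of_eq ?_)
    rw [sub_add_cancel_left, norm_neg, norm_smul, he, mul_one, Real.norm_of_nonneg (by positivity)]
  have hhor : |f (x + (m * h) • e) - f (x' + (m * h) • e)| ≤ b * h := by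
    have := abs_sub_le_of_segment hf hb (x := x + (m * h) • e) (x' := x' + (m * h) • e) (by
      rw [segment_eq_image']
      rintro _ ⟨τ, ⟨h0, h1⟩, rfl⟩
      have e1 : x + (m * h) • e + τ • (x' + (m * h) • e - (x + (m * h) • e)) =
          (x + τ • (x' - x)) + (m * h) • e := by
        rw [add_sub_add_right_eq_sub]; abel
      simp only
      rw [e1]
      have hz : x + τ • (x' - x) ∈ Metric.ball x₀ r :=
        (convex_ball x₀ r).segment_subset hx.2 hx'.2
          (by rw [segment_eq_image']; exact ⟨τ, ⟨h0, h1⟩, rfl⟩)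
      rw [hγB _ (hball _ hz _ (by positivity) le_rfl), hγe, inner_add_left, inner_add_left,
        real_inner_smul_left, real_inner_smul_left, hee]
      have h2 := (hγB x (Metric.ball_subset_ball hrle hx.2)).1 hx.1
      have hxx : ‖x' - x‖ = h := norm_sub_rev _ _
      have h3 : γ (x + τ • (x' - x)) ≤ γ x + L * h := by
        have := hγ.dist_le_mul (x + τ • (x' - x)) x
        rw [Real.dist_eq, dist_eq_norm, add_sub_cancel_left, norm_smul, hxx,
          Real.norm_of_nonneg h0] at this
        have h4 := le_abs_self (γ (x + τ • (x' - x)) - γ x)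
        have h5 : (L : ℝ) * (τ * h) ≤ L * h := by
          gcongr; exact mul_le_of_le_one_left hh0 h1
        linarith
      have h6 : -h ≤ τ * inner ℝ (x' - x) e := by
        have h7 := abs_real_inner_le_norm (x' - x) e
        rw [hxx, he, mul_one] at h7
        have h8 := (abs_le.1 h7).1
        nlinarith
      rw [hm, add_mul, one_mul]
      linarith)
    refine this.trans (le_of_eq ?_)
    rw [add_sub_add_right_eq_sub]
  have h1 := hvert x hx
  have h2 := hvert x' hx'
  rw [abs_le] at *
  constructor <;> nlinarith [h1.1, h1.2, h2.1, h2.2, hhor.1, hhor.2]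

/-- On a bounded Lipschitz domain, bounded functions with bounded gradient are Lipschitz. -/
theorem exists_lipschitz_const (hB : IsOpen B) (hbd : Bornology.IsBounded B)
    (hL : HasLipschitzBoundary B) : ∃ C : ℝ, 1 ≤ C ∧ ∀ (f : Space d → ℝ) (b : ℝ),
      (∀ x ∈ B, DifferentiableAt ℝ f x) → (∀ x ∈ B, |f x| ≤ b) →
      (∀ l, ∀ x ∈ B, |partialD l f x| ≤ b) →
      ∀ x ∈ B, ∀ x' ∈ B, |f x - f x'| ≤ C * b * ‖x - x'‖ := by
  have hloc := fun x₀ : closure B => exists_ball_lipschitz hB hL x₀.2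
  choose r C hr hC hf using hloc
  have hcpt := hbd.isCompact_closure
  obtain ⟨t, ht⟩ := hcpt.elim_finite_subcover
    (fun x₀ : closure B => Metric.ball (x₀ : Space d) (r x₀))
    (fun _ => Metric.isOpen_ball) fun x hx =>
      Set.mem_iUnion.2 ⟨⟨x, hx⟩, Metric.mem_ball_self (hr _)⟩
  -- Points closer than a Lebesgue number share one of the finitely many balls; for the others `|f|
  -- ≤ b` alone gives the constant `2 / δ`.
  obtain ⟨δ, hδ, hδt⟩ := lebesgue_number_lemma_of_metric (ι := t) hcpt
    (c := fun i => Metric.ball ((i : closure B) : Space d) (r i)) (fun _ => Metric.isOpen_ball)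
    (by simpa only [Set.iUnion_coe_set, Finset.mem_coe, Set.iUnion_subtype] using ht)
  set S : ℝ := ∑ i ∈ t, C i with hS
  have hS0 : 0 ≤ S := Finset.sum_nonneg fun i _ => hC i
  refine ⟨1 + S * d + 2 / δ, by
    have : 0 < 2 / δ := by positivity
    have : 0 ≤ S * d := by positivity
    linarith, fun f b hfd hfb hpd x hx x' hx' => ?_⟩
  have hb0 : 0 ≤ b := (abs_nonneg _).trans (hfb x hx)
  have hgrad : ∀ x ∈ B, ‖fderiv ℝ f x‖ ≤ d * b := by
    intro x hx
    rw [fderiv_eq_linForm]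
    refine (norm_linForm_le _).trans ((Finset.sum_le_sum fun l _ => hpd l x hx).trans ?_)
    simp
  have hn := norm_nonneg (x - x')
  rcases lt_or_ge ‖x - x'‖ δ with hlt | hge
  · obtain ⟨i, hi⟩ := hδt x (subset_closure hx)
    have h1 := hf i f _ hfd hgrad x ⟨hx, hi (Metric.mem_ball_self hδ)⟩ x'
      ⟨hx', hi (by rw [mem_ball_iff_norm, norm_sub_rev]; exact hlt)⟩
    have h2 : C i ≤ S := Finset.single_le_sum (fun i _ => hC i) i.2
    calc _ ≤ C i * (d * b) * ‖x - x'‖ := h1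
      _ ≤ S * (d * b) * ‖x - x'‖ := by gcongr
      _ = (S * d) * b * ‖x - x'‖ := by ring
      _ ≤ _ := by
        gcongr
        have : 0 < 2 / δ := by positivity
        linarith
  · have h1 : |f x - f x'| ≤ 2 * b := by
      have := abs_sub (f x) (f x')
      have := hfb x hx
      have := hfb x' hx'
      linarith
    calc _ ≤ 2 * b := h1
      _ = 2 / δ * b * δ := by field_simp
      _ ≤ 2 / δ * b * ‖x - x'‖ := by gcongr
      _ ≤ _ := by
        gcongr
        have : 0 ≤ S * d := by positivity
        linarith

/-- One order of differentiability is spent on the Lipschitz bound of the derivatives below it. -/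
theorem ckHolder_of_pderiv_le (hB : IsOpen B) {C : ℝ} (hC : 1 ≤ C)
    (hLip : ∀ (f : Space d → ℝ) (b : ℝ),
      (∀ x ∈ B, DifferentiableAt ℝ f x) → (∀ x ∈ B, |f x| ≤ b) →
      (∀ l, ∀ x ∈ B, |partialD l f x| ≤ b) →
      ∀ x ∈ B, ∀ x' ∈ B, |f x - f x'| ≤ C * b * ‖x - x'‖) {b : ℝ} (hb : 0 ≤ b) (k : ℕ)
    (f : Space d → ℝ) (hf : ContDiffOn ℝ (k + 1 : ℕ) f B)
    (hfb : ∀ m ≤ k + 1, ∀ (w : Fin m → Fin d), ∀ x ∈ B, |pderiv w f x| ≤ b) :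
    CkHolder B 1 k (C * b) f := by
  induction k generalizing f with
  | zero =>
    have hd : ∀ x ∈ B, DifferentiableAt ℝ f x := fun x hx =>
      (hf.contDiffAt (hB.mem_nhds hx)).differentiableAt (by simp)
    have h0 : ∀ x ∈ B, |f x| ≤ b := fun x hx => by
      simpa [pderiv] using hfb 0 (by omega) Fin.elim0 x hx
    intro x hx
    refine ⟨(h0 x hx).trans (le_mul_of_one_le_left hb hC), fun x' hx' => ?_⟩
    rw [Real.rpow_one]
    refine hLip f b hd h0 (fun l x hx => ?_) x hx x' hx'
    have h2 := pderiv_partialD hB hf Fin.elim0 l hx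
    have h3 := hfb 1 (by omega) (Fin.snoc Fin.elim0 l) x hx
    rw [← h2] at h3
    simpa [pderiv] using h3
  | succ k ih =>
    have hd : ∀ x ∈ B, DifferentiableAt ℝ f x := fun x hx =>
      (hf.contDiffAt (hB.mem_nhds hx)).differentiableAt (by simp)
    have h0 : ∀ x ∈ B, |f x| ≤ b := fun x hx => by
      simpa [pderiv] using hfb 0 (by omega) Fin.elim0 x hx
    refine ⟨fun x hx => ⟨(h0 x hx).trans (le_mul_of_one_le_left hb hC), fun x' hx' => ?_⟩, hd,
      fun l => ih _ (partialD_contDiffOn hB hf l) fun m hm w x hx => ?_⟩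
    · rw [Real.rpow_one]
      refine hLip f b hd h0 (fun l x hx => ?_) x hx x' hx'
      have h2 := pderiv_partialD hB (hf.of_le (m := (0 + 1 : ℕ)) (by norm_cast; omega))
        Fin.elim0 l hx
      have h3 := hfb 1 (by omega) (Fin.snoc Fin.elim0 l) x hx
      rw [← h2] at h3
      simpa [pderiv] using h3
    · rw [pderiv_partialD hB (hf.of_le (by norm_cast; omega)) w l hx]
      exact hfb (m + 1) (by omega) _ x hx

/-! ### Regularity of the random series -/

/-- Pointwise convergence of the series and uniform convergence of the differentiated series allow
termwise differentiation. -/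
theorem partialD_kappa {ψ : ℕ → Space d → ℝ} {y : ℕ → ℝ} (hB : IsOpen B)
    (hd : ∀ j, ∀ x ∈ B, DifferentiableAt ℝ (ψ j) x)
    (h : ∀ x ∈ B, Tendsto (fun N => kappaPartial ψ N x y) atTop (𝓝 (kappa ψ x y)))
    (h' : ∀ l, TendstoUniformlyOn (fun N x => kappaPartial (fun j => partialD l (ψ j)) N x y)
      (fun x => kappa (fun j => partialD l (ψ j)) x y) atTop B) :
    ∀ x ∈ B, HasFDerivAt (fun x => kappa ψ x y)
      (linForm fun l => kappa (fun j => partialD l (ψ j)) x y) x := by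
  intro x hx
  refine hasFDerivAt_of_tendstoUniformlyOn (l := atTop) hB
    (f := fun N x => kappaPartial ψ N x y)
    (f' := fun N x => linForm fun l => kappaPartial (fun j => partialD l (ψ j)) N x y)
    (g' := fun x => linForm fun l => kappa (fun j => partialD l (ψ j)) x y) ?_ ?_ h hx
  · rw [Metric.tendstoUniformlyOn_iff]
    intro ε hε
    have hε' : 0 < ε / (d + 1) := by positivity
    have hev := eventually_all.2 fun l => Metric.tendstoUniformlyOn_iff.1 (h' l) _ hε'
    filter_upwards [hev] with N hN x hx
    rw [dist_eq_norm, linForm_sub]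
    refine (norm_linForm_le _).trans_lt
      ((Finset.sum_le_sum fun l _ => (hN l x hx).le).trans_lt ?_)
    simp only [Finset.sum_const, Finset.card_univ, Fintype.card_fin, nsmul_eq_mul]
    rw [← mul_div_assoc, div_lt_iff₀ (by positivity)]
    nlinarith
  · intro N x hx
    have : HasFDerivAt (fun x => ∑ j ∈ Finset.range N, ψ j x * y j)
        (∑ j ∈ Finset.range N, y j • fderiv ℝ (ψ j) x) x :=
      HasFDerivAt.fun_sum fun j _ => (hd j x hx).hasFDerivAt.mul_const (y j)
    have e : (linForm fun l => kappaPartial (fun j => partialD l (ψ j)) N x y) =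
        ∑ j ∈ Finset.range N, y j • fderiv ℝ (ψ j) x := by
      ext v
      simp only [linForm_apply, kappaPartial, sum_apply, smul_apply, fderiv_eq_linForm,
        smul_eq_mul, Finset.sum_mul, Finset.mul_sum]
      rw [Finset.sum_comm]
      exact Finset.sum_congr rfl fun _ _ => Finset.sum_congr rfl fun _ _ => by ring
    rw [e]
    exact this

/-- Each series of partial derivatives satisfies the same hypotheses with one order less, so
induction on `k` applies chaining to all of them; the finitely many bounds are added. -/
theorem exists_kappa_ckHolder (hB : IsOpen B) (hne : B.Nonempty) (hbd : Bornology.IsBounded B)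
    (hθ : 0 < θ) (hθ1 : θ < 1) (k : ℕ) (ψ : ℕ → Space d → ℝ) (β : ℕ → ℝ)
    (hβ : Summable fun j => β j ^ 2) (hψ : ∀ j, CkHolder B 1 k (β j) (ψ j)) :
    ∃ K : (ℕ → ℝ) → ℝ, HasExpMoments K paramLaw ∧ ∀ᵐ y ∂paramLaw,
      TendstoUniformlyOn (fun N x => kappaPartial ψ N x y) (fun x => kappa ψ x y) atTop B ∧
      CkHolder B θ k (K y) (fun x => kappa ψ x y) := by
  have base : ∀ (ψ : ℕ → Space d → ℝ), (∀ j, HolderBdd B 1 (β j) (ψ j)) →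
      ∃ K : (ℕ → ℝ) → ℝ, HasExpMoments K paramLaw ∧ ∀ᵐ y ∂paramLaw,
      TendstoUniformlyOn (fun N x => kappaPartial ψ N x y) (fun x => kappa ψ x y) atTop B ∧
      HolderBdd B θ (K y) (fun x => kappa ψ x y) := fun ψ hψ =>
    exists_kappa_bound hne hbd ψ β hβ le_rfl hθ hθ1 (fun j x hx => (hψ j x hx).1)
      fun j x hx x' hx' => (hψ j x hx).2 x' hx'
  induction k generalizing ψ with
  | zero => exact base ψ hψ
  | succ k ih =>
    obtain ⟨K₀, hK₀, h₀⟩ := base ψ fun j => (hψ j).1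
    choose K hK hy using fun l => ih (fun j => partialD l (ψ j)) fun j => (hψ j).2.2 l
    refine ⟨fun y => K₀ y + ∑ l, K l y, hK₀.add (HasExpMoments.sum _ fun l _ => hK l), ?_⟩
    filter_upwards [h₀, ae_all_iff.2 hy] with y h0 h1
    have hder := partialD_kappa hB (fun j => (hψ j).2.1) (fun x hx => h0.1.tendsto_at hx)
      fun l => (h1 l).1
    have hsum : 0 ≤ ∑ l, K l y := Finset.sum_nonneg fun l _ => (hK l).nonneg y
    refine ⟨h0.1, h0.2.mono (by linarith), fun x hx => (hder x hx).differentiableAt, fun l => ?_⟩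
    refine ((h1 l).2.mono ?_).congr hB fun x hx => ?_
    · have h2 : K l y ≤ ∑ l, K l y :=
        Finset.single_le_sum (fun l _ => (hK l).nonneg y) (Finset.mem_univ l)
      have := hK₀.nonneg y
      linarith
    · simp only [partialD]
      rw [(hder x hx).fderiv, linForm_single]

end DifferentiableFunctions

section WeakDerivatives

variable {d : ℕ}

/-! ### Essential suprema of continuous functions -/

/-- A nonempty superlevel set of a continuous function on an open set is open, hence of positive
measure. The larger set `V` leaves room for the diagonal in the Hölder seminorm, where the quotient
vanishes. -/
theorem essSup_restrict_eq_iSup {Z : Type*} [TopologicalSpace Z] [MeasurableSpace Z]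
    [OpensMeasurableSpace Z] {μ : Measure Z} [μ.IsOpenPosMeasure] {U V : Set Z} (hU : IsOpen U)
    (hV : MeasurableSet V) (hUV : U ⊆ V) {h : Z → ℝ≥0∞} (hc : ContinuousOn h U)
    (h0 : ∀ z ∈ V, z ∉ U → h z = 0) : essSup h (μ.restrict V) = ⨆ z ∈ U, h z := by
  refine le_antisymm (essSup_le_of_ae_le _ ?_) (iSup₂_le fun z hz => ?_)
  · filter_upwards [ae_restrict_mem hV] with z hz
    by_cases hzU : z ∈ U
    · exact le_iSup₂ (f := fun z (_ : z ∈ U) => h z) z hzU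
    · rw [h0 z hz hzU]; exact zero_le
  · by_contra! hlt
    have hopen : IsOpen (U ∩ h ⁻¹' Set.Ioi (essSup h (μ.restrict V))) :=
      hc.isOpen_inter_preimage hU isOpen_Ioi
    have hpos := hopen.measure_pos μ ⟨z, hz, hlt⟩
    have hae : ∀ᵐ z ∂μ.restrict V, h z ≤ essSup h (μ.restrict V) := ae_le_essSup
    rw [ae_iff, Measure.restrict_apply' hV] at hae
    refine hpos.ne' (measure_mono_null ?_ hae)
    rintro z ⟨h1, h2⟩
    exact ⟨not_le.2 h2, hUV h1⟩

/-- The countable set does not depend on `h`, so suprema of random continuous functions become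
countable suprema and are measurable. -/
theorem exists_countable_iSup_eq {Z : Type*} [TopologicalSpace Z] [SecondCountableTopology Z]
    (U : Set Z) : ∃ S : Set Z, S.Countable ∧ S ⊆ U ∧ ∀ h : Z → ℝ≥0∞, ContinuousOn h U →
      ⨆ z ∈ U, h z = ⨆ z ∈ S, h z := by
  obtain ⟨S, hS, hd⟩ := TopologicalSpace.exists_countable_dense U
  refine ⟨(↑) '' S, hS.image _, by rintro _ ⟨z, _, rfl⟩; exact z.2, fun h hc => ?_⟩
  refine le_antisymm (iSup₂_le fun z hz => ?_)
    (biSup_mono (by rintro _ ⟨z, _, rfl⟩; exact z.2))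
  have hcl : IsClosed {u : U | h u ≤ ⨆ z ∈ ((↑) '' S : Set Z), h z} :=
    isClosed_le (continuousOn_iff_continuous_domRestrict.1 hc) continuous_const
  have hsub : S ⊆ {u : U | h u ≤ ⨆ z ∈ ((↑) '' S : Set Z), h z} := fun u hu =>
    le_iSup₂ (f := fun z (_ : z ∈ ((↑) '' S : Set Z)) => h z) (u : Z) ⟨u, hu, rfl⟩
  have := hcl.closure_subset_iff.2 hsub
  rw [hd.closure_eq] at this
  exact this (Set.mem_univ ⟨z, hz⟩)

variable {B : Set (Space d)} {θ : ℝ}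

theorem supNorm_eq_iSup (hB : IsOpen B) {f : Space d → ℝ} (hf : ContinuousOn f B) :
    supNorm B f = ⨆ x ∈ B, ‖f x‖ₑ := by
  unfold supNorm
  rw [eLpNorm_exponent_top, eLpNormEssSup]
  exact essSup_restrict_eq_iSup hB hB.measurableSet subset_rfl hf.enorm fun z h h' => absurd h h'

theorem holderSeminorm_eq_iSup (hB : IsOpen B) {g : Space d → ℝ} (hg : ContinuousOn g B) :
    ContinuousOn (fun z : Space d × Space d => ‖g z.1 - g z.2‖ₑ / ‖z.1 - z.2‖ₑ ^ θ)
      ((B ×ˢ B) ∩ {z | z.1 ≠ z.2}) ∧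
    holderSeminorm B θ g = ⨆ z ∈ (B ×ˢ B) ∩ {z : Space d × Space d | z.1 ≠ z.2},
      ‖g z.1 - g z.2‖ₑ / ‖z.1 - z.2‖ₑ ^ θ := by
  have hc : ContinuousOn (fun z : Space d × Space d => ‖g z.1 - g z.2‖ₑ / ‖z.1 - z.2‖ₑ ^ θ)
      ((B ×ˢ B) ∩ {z | z.1 ≠ z.2}) := by
    have h1 : ContinuousOn (fun z : Space d × Space d =>
        ENNReal.ofReal (‖g z.1 - g z.2‖ / ‖z.1 - z.2‖ ^ θ)) ((B ×ˢ B) ∩ {z | z.1 ≠ z.2}) := by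
      refine ENNReal.continuous_ofReal.comp_continuousOn (ContinuousOn.div ?_ ?_ ?_)
      · exact ((hg.comp continuousOn_fst fun z hz => hz.1.1).sub
          (hg.comp continuousOn_snd fun z hz => hz.1.2)).norm
      · refine ContinuousOn.rpow_const (by fun_prop) fun z hz => Or.inl ?_
        exact norm_ne_zero_iff.2 (sub_ne_zero.2 hz.2)
      · intro z hz
        exact (Real.rpow_pos_of_pos (norm_pos_iff.2 (sub_ne_zero.2 hz.2)) _).ne'
    refine h1.congr fun z hz => ?_
    have hp : 0 < ‖z.1 - z.2‖ := norm_pos_iff.2 (sub_ne_zero.2 hz.2)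
    simp only
    rw [ENNReal.ofReal_div_of_pos (Real.rpow_pos_of_pos hp _), ofReal_norm,
      ← ENNReal.ofReal_rpow_of_pos hp, ofReal_norm]
  refine ⟨hc, ?_⟩
  unfold holderSeminorm
  rw [Measure.prod_restrict]
  refine essSup_restrict_eq_iSup
    ((hB.prod hB).inter (isOpen_ne_fun continuous_fst continuous_snd))
    (hB.prod hB).measurableSet Set.inter_subset_left hc fun z hz hz' => ?_
  have : z.1 = z.2 := by
    by_contra h; exact hz' ⟨hz, h⟩
  simp [this]

theorem CkHolder.continuousOn (hθ : 0 < θ) {k : ℕ} {M : ℝ} {f : Space d → ℝ}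
    (h : CkHolder B θ k M f) : ContinuousOn f B := h.holderBdd.continuousOn hθ

theorem HolderBdd.supNorm_le {M : ℝ} {f : Space d → ℝ} (hB : IsOpen B)
    (h : HolderBdd B θ M f) : supNorm B f ≤ ENNReal.ofReal M := by
  unfold supNorm
  rw [eLpNorm_exponent_top]
  refine essSup_le_of_ae_le _ ?_
  filter_upwards [ae_restrict_mem hB.measurableSet] with x hx
  rw [← ofReal_norm]
  exact ENNReal.ofReal_le_ofReal (h x hx).1

theorem HolderBdd.holderSeminorm_le {M : ℝ} {f : Space d → ℝ} (hB : IsOpen B) (hθ : 0 ≤ θ)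
    (h : HolderBdd B θ M f) : holderSeminorm B θ f ≤ ENNReal.ofReal M := by
  unfold holderSeminorm
  rw [Measure.prod_restrict]
  refine essSup_le_of_ae_le _ ?_
  filter_upwards [ae_restrict_mem (hB.prod hB).measurableSet] with z hz
  refine ENNReal.div_le_of_le_mul ?_
  rw [← ofReal_norm, ← ofReal_norm, ENNReal.ofReal_rpow_of_nonneg (norm_nonneg _) hθ,
    ← ENNReal.ofReal_mul ((abs_nonneg _).trans (h z.1 hz.1).1)]
  exact ENNReal.ofReal_le_ofReal ((h z.1 hz.1).2 z.2 hz.2)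

theorem abs_le_of_supNorm_le (hB : IsOpen B) {f : Space d → ℝ} (hf : ContinuousOn f B) {b : ℝ}
    (hb : 0 ≤ b) (h : supNorm B f ≤ ENNReal.ofReal b) {x : Space d} (hx : x ∈ B) : |f x| ≤ b := by
  rw [supNorm_eq_iSup hB hf] at h
  have h1 : ‖f x‖ₑ ≤ ENNReal.ofReal b :=
    le_trans (le_iSup₂ (f := fun x (_ : x ∈ B) => ‖f x‖ₑ) x hx) h
  rw [← ofReal_norm, ENNReal.ofReal_le_ofReal_iff hb] at h1
  exact h1

/-! ### Weak derivatives -/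

/-- The iterated partial derivative `∂_{w (m-1)} ⋯ ∂_{w 0} f`. -/
def iterD : (m : ℕ) → (Fin m → Fin d) → (Space d → ℝ) → Space d → ℝ
  | 0, _, f => f
  | m + 1, w, f => iterD m (Fin.tail w) (partialD (w 0) f)

theorem CkHolder.iterD {k m : ℕ} (hm : m ≤ k) {M : ℝ} {f : Space d → ℝ}
    (h : CkHolder B θ k M f) (w : Fin m → Fin d) :
    CkHolder B θ (k - m) M (iterD m w f) := by
  induction m generalizing k f with
  | zero => exact h
  | succ m ih =>
    obtain ⟨k, rfl⟩ : ∃ k', k = k' + 1 := ⟨k - 1, by omega⟩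
    rw [Nat.add_sub_add_right]
    exact ih (by omega) (h.2.2 _) _

theorem integrable_mul_of_locallyIntegrableOn {f χ : Space d → ℝ}
    (hf : LocallyIntegrableOn f B) (hχ : Continuous χ) (hc : HasCompactSupport χ)
    (hs : tsupport χ ⊆ B) : Integrable (fun x => f x * χ x) := by
  have h1 : IntegrableOn (fun x => f x * χ x) (tsupport χ) :=
    (hf.integrableOn_compact_subset hs hc).mul_continuousOn hχ.continuousOn hc
  refine (integrableOn_iff_integrable_of_support_subset fun x hx => ?_).1 h1
  exact subset_tsupport _ (right_ne_zero_of_mul hx)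

theorem setIntegral_mul_eq {f χ : Space d → ℝ} (hs : tsupport χ ⊆ B) :
    ∫ x in B, f x * χ x = ∫ x, f x * χ x :=
  setIntegral_eq_integral_of_forall_compl_eq_zero fun x hx => by
    rw [image_eq_zero_of_notMem_tsupport fun h => hx (hs h), mul_zero]

theorem pderiv_succ {m : ℕ} (w : Fin (m + 1) → Fin d) {φ : Space d → ℝ} (hφ : ContDiff ℝ ∞ φ) :
    pderiv w φ = partialD (w 0) (pderiv (Fin.tail w) φ) := by
  ext x
  unfold pderiv partialD
  rw [iteratedFDeriv_succ_apply_left]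
  have h : DifferentiableAt ℝ (iteratedFDeriv ℝ m φ) x :=
    (hφ.differentiable_iteratedFDeriv (m := m) (by exact_mod_cast WithTop.coe_lt_top _)) x
  rw [fderiv_continuousMultilinear_apply_const_apply h]
  rfl

theorem IsTestFun.pderiv {φ : Space d → ℝ} (hφ : IsTestFun B φ) {m : ℕ} (w : Fin m → Fin d) :
    IsTestFun B (pderiv w φ) := by
  have hsub : tsupport (RandomDiffusion.pderiv w φ) ⊆ tsupport φ := by
    refine closure_minimal (fun x hx => ?_) (isClosed_tsupport _)
    by_contra h
    refine hx ?_
    have h2 : x ∉ tsupport (iteratedFDeriv ℝ m φ) := fun h' =>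
      h (tsupport_iteratedFDeriv_subset m h')
    simp only [RandomDiffusion.pderiv]
    rw [image_eq_zero_of_notMem_tsupport h2]
    rfl
  refine ⟨?_, hφ.2.1.mono' ((subset_tsupport _).trans hsub), hsub.trans hφ.2.2⟩
  have h1 : ContDiff ℝ ∞ (iteratedFDeriv ℝ m φ) :=
    hφ.1.iteratedFDeriv_right (by exact_mod_cast le_top)
  exact (ContinuousMultilinearMap.apply ℝ (fun _ : Fin m => Space d) ℝ
    (fun l => EuclideanSpace.single (w l) (1 : ℝ))).contDiff.comp h1

theorem integral_mul_partialD (hB : IsOpen B) {f χ : Space d → ℝ}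
    (hf : ∀ x ∈ B, DifferentiableAt ℝ f x) (l : Fin d) (hf' : ContinuousOn (partialD l f) B)
    (hχ : IsTestFun B χ) :
    ∫ x in B, f x * partialD l χ x = -∫ x in B, partialD l f x * χ x := by
  have hfc : ContinuousOn f B := fun x hx => (hf x hx).continuousAt.continuousWithinAt
  have hsub : tsupport (partialD l χ) ⊆ tsupport χ := by
    refine closure_minimal (fun x hx => ?_) (isClosed_tsupport _)
    by_contra h
    refine hx ?_
    have h2 : x ∉ tsupport (fderiv ℝ χ) := fun h' => h (tsupport_fderiv_subset ℝ h')
    simp [partialD, image_eq_zero_of_notMem_tsupport h2]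
  have hd : Differentiable ℝ χ := hχ.1.differentiable (by simp)
  have hcont : Continuous (partialD l χ) :=
    (hχ.1.continuous_fderiv (by simp)).clm_apply continuous_const
  rw [setIntegral_mul_eq (hsub.trans hχ.2.2), setIntegral_mul_eq hχ.2.2]
  refine integral_mul_fderiv_eq_neg_fderiv_mul_of_integrable ?_ ?_ ?_
    (fun x hx => hf x (hχ.2.2 hx)) fun x _ => hd x
  · exact integrable_mul_of_locallyIntegrableOn (hf'.locallyIntegrableOn hB.measurableSet)
      hd.continuous hχ.2.1 hχ.2.2
  · exact integrable_mul_of_locallyIntegrableOn (hfc.locallyIntegrableOn hB.measurableSet)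
      hcont (hχ.2.1.mono' ((subset_tsupport _).trans hsub)) (hsub.trans hχ.2.2)
  · exact integrable_mul_of_locallyIntegrableOn (hfc.locallyIntegrableOn hB.measurableSet)
      hd.continuous hχ.2.1 hχ.2.2

theorem isWeakDeriv_iterD (hB : IsOpen B) (hθ : 0 < θ) {k m : ℕ} (hm : m ≤ k) {M : ℝ}
    {f : Space d → ℝ} (h : CkHolder B θ k M f) (w : Fin m → Fin d) :
    IsWeakDeriv B w f (iterD m w f) := by
  refine ⟨(h.continuousOn hθ).locallyIntegrableOn hB.measurableSet,
    ((h.iterD hm w).continuousOn hθ).locallyIntegrableOn hB.measurableSet, fun φ hφ => ?_⟩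
  induction m generalizing k f with
  | zero => simp [pderiv, iterD]
  | succ m ih =>
    obtain ⟨k, rfl⟩ : ∃ k', k = k' + 1 := ⟨k - 1, by omega⟩
    -- The outermost derivative `w 0` of the test function is the first to move onto `f`, which is
    -- why `iterD` applies `w 0` first. Each move costs a sign.
    rw [pderiv_succ w hφ.1, integral_mul_partialD hB h.2.1 _ ((h.2.2 _).continuousOn hθ)
      (hφ.pderiv _), ih (by omega) (h.2.2 (w 0)) (Fin.tail w), pow_succ]
    simp [iterD]

/-- The fundamental lemma of the calculus of variations, applied to the difference of the two weak
derivatives. -/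
theorem IsWeakDeriv.ae_eq (hB : IsOpen B) {m : ℕ} {w : Fin m → Fin d} {f g g' : Space d → ℝ}
    (h : IsWeakDeriv B w f g) (h' : IsWeakDeriv B w f g') : g =ᵐ[volume.restrict B] g' := by
  rw [EventuallyEq, ae_restrict_iff' hB.measurableSet]
  have := hB.ae_eq_zero_of_integral_contDiff_smul_eq_zero (μ := volume) (f := fun x => g x - g' x)
    (h.2.1.sub h'.2.1) fun φ h1 h2 h3 => by
      have hφ : IsTestFun B φ := ⟨h1, h2, h3⟩
      have e := (h.2.2 φ hφ).symm.trans (h'.2.2 φ hφ)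
      rw [setIntegral_mul_eq h3, setIntegral_mul_eq h3] at e
      have e2 := mul_left_cancel₀ (pow_ne_zero m (by norm_num)) e
      have i1 := integrable_mul_of_locallyIntegrableOn h.2.1 h1.continuous h2 h3
      have i2 := integrable_mul_of_locallyIntegrableOn h'.2.1 h1.continuous h2 h3
      rw [← sub_eq_zero, ← integral_sub i1 i2] at e2
      rw [← e2]
      congr 1 with x
      rw [smul_eq_mul]
      ring
  filter_upwards [this] with x hx hxB
  exact sub_eq_zero.1 (hx hxB)

theorem supNorm_congr {f g : Space d → ℝ} (h : f =ᵐ[volume.restrict B] g) :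
    supNorm B f = supNorm B g := eLpNorm_congr_ae h

theorem holderSeminorm_congr {f g : Space d → ℝ} (h : f =ᵐ[volume.restrict B] g) :
    holderSeminorm B θ f = holderSeminorm B θ g := by
  refine essSup_congr_ae ?_
  have h1 := Measure.quasiMeasurePreserving_fst (μ := volume.restrict B)
    (ν := volume.restrict B) |>.ae_eq_comp h
  have h2 := Measure.quasiMeasurePreserving_snd (μ := volume.restrict B)
    (ν := volume.restrict B) |>.ae_eq_comp h
  filter_upwards [h1, h2] with z e1 e2
  simp only [Function.comp_apply] at e1 e2
  rw [e1, e2]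

-- The classical derivatives are an admissible family, and by uniqueness of weak derivatives every
-- other admissible family gives the same value.
open Classical in
theorem sobolevInftyNorm_eq (hB : IsOpen B) (hθ : 0 < θ) {υ M : ℝ} {f : Space d → ℝ}
    (h : CkHolder B θ ⌊υ⌋₊ M f) :
    sobolevInftyNorm B υ f =
      max (⨆ (m : ℕ) (_ : m ≤ ⌊υ⌋₊) (w : Fin m → Fin d), supNorm B (iterD m w f))
      (if υ = ⌊υ⌋₊ then 0
        else ⨆ w : Fin ⌊υ⌋₊ → Fin d, holderSeminorm B (υ - ⌊υ⌋₊) (iterD ⌊υ⌋₊ w f)) := by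
  refine le_antisymm (iInf₂_le _ fun m hm w => isWeakDeriv_iterD hB hθ hm h w)
    (le_iInf₂ fun g hg => le_of_eq ?_)
  have e : ∀ m ≤ ⌊υ⌋₊, ∀ w : Fin m → Fin d, iterD m w f =ᵐ[volume.restrict B] g m w :=
    fun m hm w => (isWeakDeriv_iterD hB hθ hm h w).ae_eq hB (hg m hm w)
  congr 1
  · exact iSup_congr fun m => iSup_congr fun hm => iSup_congr fun w => supNorm_congr (e m hm w)
  · split_ifs
    · rfl
    · exact iSup_congr fun w => holderSeminorm_congr (e _ le_rfl w)

theorem sobolevInftyNorm_le (hB : IsOpen B) (hθ : 0 < θ) {υ M : ℝ}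
    (hυ : υ ≠ ⌊υ⌋₊ → θ = υ - ⌊υ⌋₊) {f : Space d → ℝ} (h : CkHolder B θ ⌊υ⌋₊ M f) :
    sobolevInftyNorm B υ f ≤ ENNReal.ofReal M := by
  rw [sobolevInftyNorm_eq hB hθ h]
  refine max_le (iSup_le fun m => iSup_le fun hm => iSup_le fun w =>
    (h.iterD hm w).holderBdd.supNorm_le hB) ?_
  split_ifs with hif
  · exact zero_le
  · rw [← hυ hif]
    exact iSup_le fun w => (h.iterD le_rfl w).holderBdd.holderSeminorm_le hB hθ.le

/-! ### Measurability -/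

section Measurability

variable {Ω : Type*} [MeasurableSpace Ω] {μ : Measure Ω}

/-- A limit of difference quotients with steps `1 / (n + 1)`; the index shift `n₀` keeps the
evaluation points in `B`, where `F` is known to be measurable. -/
theorem aemeasurable_partialD (hB : IsOpen B) {F : Ω → Space d → ℝ}
    (hF : ∀ x ∈ B, AEMeasurable (fun y => F y x) μ)
    (hd : ∀ᵐ y ∂μ, ∀ x ∈ B, DifferentiableAt ℝ (F y) x) (l : Fin d) :
    ∀ x ∈ B, AEMeasurable (fun y => partialD l (F y) x) μ := by
  intro x hx
  set e : Space d := EuclideanSpace.single l 1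
  have hlim : Tendsto (fun n : ℕ => x + ((n : ℝ) + 1)⁻¹ • e) atTop (𝓝 x) := by
    have h1 : Tendsto (fun n : ℕ => ((n : ℝ) + 1)⁻¹) atTop (𝓝 0) := by
      simpa using tendsto_one_div_add_atTop_nhds_zero_nat (𝕜 := ℝ)
    simpa using (h1.smul_const e).const_add x
  obtain ⟨n₀, hn₀⟩ := eventually_atTop.1 (hlim.eventually (hB.mem_nhds hx))
  refine aemeasurable_of_tendsto_metrizable_ae atTop
    (f := fun n y => (((n + n₀ : ℕ) : ℝ) + 1) • (F y (x + (((n + n₀ : ℕ) : ℝ) + 1)⁻¹ • e) - F y x))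
    (fun n => ((hF _ (hn₀ (n + n₀) (by omega))).sub (hF x hx)).const_smul
      (((n + n₀ : ℕ) : ℝ) + 1)) ?_
  filter_upwards [hd] with y hy
  have h2 : Tendsto (fun n : ℕ => ((n + n₀ : ℕ) : ℝ) + 1) atTop atTop :=
    tendsto_atTop_add_const_right _ _ (tendsto_natCast_atTop_atTop.comp (tendsto_add_atTop_nat n₀))
  exact ((hy x hx).hasFDerivAt.lim_real e).comp h2

theorem aemeasurable_iterD (hB : IsOpen B) {k m : ℕ} (hm : m ≤ k) {F : Ω → Space d → ℝ}
    (hF : ∀ x ∈ B, AEMeasurable (fun y => F y x) μ)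
    (hd : ∀ᵐ y ∂μ, ∃ M, CkHolder B θ k M (F y)) (w : Fin m → Fin d) :
    ∀ x ∈ B, AEMeasurable (fun y => iterD m w (F y) x) μ := by
  induction m generalizing k F with
  | zero => exact hF
  | succ m ih =>
    obtain ⟨k, rfl⟩ : ∃ k', k = k' + 1 := ⟨k - 1, by omega⟩
    refine ih (k := k) (F := fun y => partialD (w 0) (F y)) (by omega)
      (aemeasurable_partialD hB hF ?_ _) ?_ (Fin.tail w)
    · filter_upwards [hd] with y ⟨M, hM⟩
      exact hM.2.1
    · filter_upwards [hd] with y ⟨M, hM⟩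
      exact ⟨M, hM.2.2 _⟩

theorem aemeasurable_supNorm (hB : IsOpen B) {F : Ω → Space d → ℝ}
    (hF : ∀ x ∈ B, AEMeasurable (fun y => F y x) μ) (hc : ∀ᵐ y ∂μ, ContinuousOn (F y) B) :
    AEMeasurable (fun y => supNorm B (F y)) μ := by
  obtain ⟨S, hS, hSB, hsup⟩ := exists_countable_iSup_eq B
  have : Countable S := hS.to_subtype
  have h1 : AEMeasurable (fun y => ⨆ x : S, ‖F y x‖ₑ) μ :=
    AEMeasurable.iSup fun x => (hF x (hSB x.2)).enorm
  refine h1.congr ?_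
  filter_upwards [hc] with y hy
  rw [supNorm_eq_iSup hB hy, hsup _ hy.enorm, iSup_subtype']

theorem aemeasurable_holderSeminorm (hB : IsOpen B) {F : Ω → Space d → ℝ}
    (hF : ∀ x ∈ B, AEMeasurable (fun y => F y x) μ) (hc : ∀ᵐ y ∂μ, ContinuousOn (F y) B) :
    AEMeasurable (fun y => holderSeminorm B θ (F y)) μ := by
  obtain ⟨S, hS, hSB, hsup⟩ :=
    exists_countable_iSup_eq ((B ×ˢ B) ∩ {z : Space d × Space d | z.1 ≠ z.2})
  have : Countable S := hS.to_subtype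
  have h1 : AEMeasurable (fun y => ⨆ z : S, ‖F y z.1.1 - F y z.1.2‖ₑ /
      ‖z.1.1 - z.1.2‖ₑ ^ θ) μ :=
    AEMeasurable.iSup fun z =>
      ((hF _ (hSB z.2).1.1).sub (hF _ (hSB z.2).1.2)).enorm.div_const _
  refine h1.congr ?_
  filter_upwards [hc] with y hy
  obtain ⟨h2, h3⟩ := holderSeminorm_eq_iSup (θ := θ) hB hy
  rw [h3, hsup _ h2, iSup_subtype']

theorem aemeasurable_sobolevInftyNorm (hB : IsOpen B) (hθ : 0 < θ) {υ : ℝ}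
    {F : Ω → Space d → ℝ} (hF : ∀ x ∈ B, AEMeasurable (fun y => F y x) μ)
    (hd : ∀ᵐ y ∂μ, ∃ M, CkHolder B θ ⌊υ⌋₊ M (F y)) :
    AEMeasurable (fun y => sobolevInftyNorm B υ (F y)) μ := by
  classical
  have hc : ∀ m ≤ ⌊υ⌋₊, ∀ w : Fin m → Fin d, ∀ᵐ y ∂μ, ContinuousOn (iterD m w (F y)) B := by
    intro m hm w
    filter_upwards [hd] with y ⟨M, hM⟩
    exact (hM.iterD hm w).continuousOn hθ
  have h1 : AEMeasurable (fun y =>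
      max (⨆ (m : ℕ) (_ : m ≤ ⌊υ⌋₊) (w : Fin m → Fin d), supNorm B (iterD m w (F y)))
      (if υ = ⌊υ⌋₊ then 0
        else ⨆ w : Fin ⌊υ⌋₊ → Fin d, holderSeminorm B (υ - ⌊υ⌋₊) (iterD ⌊υ⌋₊ w (F y)))) μ := by
    refine AEMeasurable.max (AEMeasurable.iSup fun m => AEMeasurable.iSup fun hm =>
      AEMeasurable.iSup fun w =>
        aemeasurable_supNorm hB (aemeasurable_iterD hB hm hF hd w) (hc m hm w)) ?_
    split_ifs
    · exact aemeasurable_const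
    · exact AEMeasurable.iSup fun w =>
        aemeasurable_holderSeminorm hB (aemeasurable_iterD hB le_rfl hF hd w) (hc _ le_rfl w)
  refine h1.congr ?_
  filter_upwards [hd] with y ⟨M, hM⟩
  rw [sobolevInftyNorm_eq hB hθ hM]

end Measurability

end WeakDerivatives

section CoefficientMoments

variable {d : ℕ} {B : Set (Space d)} {θ : ℝ}

/-! ### Moments of the random coefficient -/

theorem hasFiniteMoment_of_le {X : (ℕ → ℝ) → ℝ≥0∞} {K : (ℕ → ℝ) → ℝ}
    (hK : HasExpMoments K paramLaw) (hX : AEMeasurable X paramLaw) {c : ℝ}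
    (h : ∀ᵐ y ∂paramLaw, X y ≤ ENNReal.ofReal (Real.exp (c * K y))) {p : ℝ} (hp : 1 ≤ p) :
    HasFiniteMoment X p := by
  refine ⟨hX, lt_of_le_of_lt (lintegral_mono_ae ?_) (hK.lintegral_lt (c * p))⟩
  filter_upwards [h] with y hy
  refine (ENNReal.rpow_le_rpow hy (by linarith)).trans (le_of_eq ?_)
  rw [ENNReal.ofReal_rpow_of_pos (Real.exp_pos _), ← Real.exp_mul]
  ring_nf

theorem aemeasurable_kappa {ψ : ℕ → Space d → ℝ} (h : SeriesConverges B ψ) :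
    ∀ x ∈ B, AEMeasurable (fun y => kappa ψ x y) paramLaw := fun x hx =>
  aemeasurable_of_tendsto_metrizable_ae atTop (f := fun N y => kappaPartial ψ N x y)
    (fun N => Measurable.aemeasurable (by unfold kappaPartial; fun_prop))
    (h.mono fun y hy => hy x hx)

theorem aemeasurable_coeff {ψ : ℕ → Space d → ℝ} (h : SeriesConverges B ψ) :
    ∀ x ∈ B, AEMeasurable (fun y => coeff ψ y x) paramLaw := fun x hx =>
  Real.measurable_exp.comp_aemeasurable (aemeasurable_kappa h x hx)

theorem HolderBdd.neg {M : ℝ} {f : Space d → ℝ} (h : HolderBdd B θ M f) :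
    HolderBdd B θ M (fun x => -f x) := fun x hx => by
  refine ⟨by rw [abs_neg]; exact (h x hx).1, fun x' hx' => ?_⟩
  rw [neg_sub_neg, abs_sub_comm]
  exact (h x hx).2 x' hx'

theorem inv_coeff (ψ : ℕ → Space d → ℝ) (y : ℕ → ℝ) (x : Space d) :
    (coeff ψ y x)⁻¹ = Real.exp (-kappa ψ x y) := (Real.exp_neg _).symm

/-- The inequalities hold at every point and not only almost everywhere because, for continuous
functions, essential suprema are suprema. The lower bound for `a` is the upper bound for `exp (-κ)`.
-/
theorem elliptic_of_holderBdd (hB : IsOpen B) (hθ : 0 < θ) {ψ : ℕ → Space d → ℝ} {y : ℕ → ℝ}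
    {M : ℝ} (h : HolderBdd B θ M (fun x => kappa ψ x y)) :
    aMax B ψ y ≤ ENNReal.ofReal (Real.exp (2 * M)) ∧
    (aMin B ψ y)⁻¹ ≤ ENNReal.ofReal (Real.exp (2 * M)) ∧
    ∀ x ∈ B, aMin B ψ y ≤ ENNReal.ofReal (coeff ψ y x) ∧
      ENNReal.ofReal (coeff ψ y x) ≤ aMax B ψ y := by
  have h1 : HolderBdd B θ (Real.exp (2 * M)) (coeff ψ y) := h.exp
  have h2 : HolderBdd B θ (Real.exp (2 * M)) (fun x => (coeff ψ y x)⁻¹) :=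
    h.neg.exp.congr fun x _ => (inv_coeff ψ y x).symm
  refine ⟨h1.supNorm_le hB, ?_, fun x hx => ⟨?_, ?_⟩⟩
  · rw [aMin, inv_inv]
    exact h2.supNorm_le hB
  · rw [aMin, ENNReal.inv_le_iff_inv_le, supNorm_eq_iSup hB (h2.continuousOn hθ),
      ← ENNReal.ofReal_inv_of_pos (show 0 < coeff ψ y x from Real.exp_pos _)]
    refine le_trans (le_of_eq ?_) (le_iSup₂ (f := fun x (_ : x ∈ B) => ‖(coeff ψ y x)⁻¹‖ₑ) x hx)
    exact (Real.enorm_of_nonneg (inv_nonneg.2 (Real.exp_pos _).le)).symm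
  · rw [aMax, supNorm_eq_iSup hB (h1.continuousOn hθ)]
    refine le_trans (le_of_eq ?_) (le_iSup₂ (f := fun x (_ : x ∈ B) => ‖coeff ψ y x‖ₑ) x hx)
    exact (Real.enorm_of_nonneg (Real.exp_pos _).le).symm

theorem elliptic_and_moments (hB : IsOpen B) (hθ : 0 < θ) {ψ : ℕ → Space d → ℝ}
    {K : (ℕ → ℝ) → ℝ} (hK : HasExpMoments K paramLaw)
    (h : ∀ᵐ y ∂paramLaw,
      TendstoUniformlyOn (fun N x => kappaPartial ψ N x y) (fun x => kappa ψ x y) atTop B ∧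
      HolderBdd B θ (K y) (fun x => kappa ψ x y)) :
    SeriesConverges B ψ ∧ IsUniformlyElliptic B ψ ∧
    ∀ p : ℝ, 1 ≤ p → HasFiniteMoment (aMax B ψ) p ∧
      HasFiniteMoment (fun y => (aMin B ψ y)⁻¹) p := by
  have hser : SeriesConverges B ψ := h.mono fun y hy x hx => hy.1.tendsto_at hx
  refine ⟨hser, ?_, fun p hp => ⟨?_, ?_⟩⟩
  · filter_upwards [h] with y hy
    obtain ⟨h1, h2, h3⟩ := elliptic_of_holderBdd hB hθ hy.2
    exact ⟨ENNReal.inv_lt_top.1 (h2.trans_lt ENNReal.ofReal_lt_top),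
      h1.trans_lt ENNReal.ofReal_lt_top, h3⟩
  · refine hasFiniteMoment_of_le hK (aemeasurable_supNorm hB (aemeasurable_coeff hser) ?_)
      (h.mono fun y hy => (elliptic_of_holderBdd hB hθ hy.2).1) hp
    filter_upwards [h] with y hy
    exact (HolderBdd.exp hy.2).continuousOn hθ
  · refine hasFiniteMoment_of_le hK ?_
      (h.mono fun y hy => (elliptic_of_holderBdd hB hθ hy.2).2.1) hp
    simp only [aMin, inv_inv]
    refine aemeasurable_supNorm hB (fun x hx => (aemeasurable_coeff hser x hx).inv) ?_
    filter_upwards [h] with y hy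
    exact (HolderBdd.exp hy.2).continuousOn hθ |>.inv₀ fun x _ => (Real.exp_pos _).ne'

theorem ckHolder_of_derivBound (hB : IsOpen B) (hbd : Bornology.IsBounded B)
    (hL : HasLipschitzBoundary B) (k : ℕ) : ∃ C : ℝ, 1 ≤ C ∧ ∀ f : Space d → ℝ,
      ContDiffOn ℝ (k + 1 : ℕ) f B → derivBound B (k + 1) f ≠ ⊤ →
      CkHolder B 1 k (C * (derivBound B (k + 1) f).toReal) f := by
  obtain ⟨C, hC, hLip⟩ := exists_lipschitz_const hB hbd hL
  refine ⟨C, hC, fun f hf hfb =>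
    ckHolder_of_pderiv_le hB hC hLip ENNReal.toReal_nonneg k f hf fun m hm w x hx => ?_⟩
  refine abs_le_of_supNorm_le hB (pderiv_continuousOn hB (hf.of_le (by exact_mod_cast hm)) w)
    ENNReal.toReal_nonneg ?_ hx
  rw [ENNReal.ofReal_toReal hfb]
  exact le_trans (le_iSup (fun w : Fin m → Fin d => supNorm B (pderiv w f)) w)
    (le_iSup₂ (f := fun (m : ℕ) (_ : m ≤ k + 1) => ⨆ w : Fin m → Fin d, supNorm B (pderiv w f))
      m hm)

/-- Moments of the Sobolev norms of the random coefficient on a bounded Lipschitz domain. -/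
theorem coeff_moments (hB : IsOpen B) (hne : B.Nonempty) (hbd : Bornology.IsBounded B)
    (hL : HasLipschitzBoundary B) (s : ℕ) (hs : 1 ≤ s) (ψ : ℕ → Space d → ℝ)
    (hψ : ∀ j, IsCsOnClosure B s (ψ j)) (hsum : ∑' j, derivBound B s (ψ j) ^ 2 < ⊤) :
    SeriesConverges B ψ ∧ IsUniformlyElliptic B ψ ∧
    (∀ p υ : ℝ, 1 ≤ p → 0 ≤ υ → υ < s →
      HasFiniteMoment (fun y => sobolevInftyNorm B υ (coeff ψ y)) p) ∧
    (∀ p : ℝ, 1 ≤ p → HasFiniteMoment (aMax B ψ) p ∧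
      HasFiniteMoment (fun y => (aMin B ψ y)⁻¹) p) := by
  obtain ⟨k, rfl⟩ : ∃ k, s = k + 1 := ⟨s - 1, by omega⟩
  obtain ⟨C, hC, hCk⟩ := ckHolder_of_derivBound hB hbd hL k
  have hfin : ∀ j, derivBound B (k + 1) (ψ j) ≠ ⊤ := fun j h => by
    refine ENNReal.ne_top_of_tsum_ne_top hsum.ne j ?_
    rw [h]; rfl
  set β : ℕ → ℝ := fun j => C * (derivBound B (k + 1) (ψ j)).toReal with hβ
  have hβs : Summable fun j => β j ^ 2 := by
    have := (ENNReal.summable_toReal hsum.ne).mul_left (C ^ 2)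
    refine this.congr fun j => ?_
    rw [ENNReal.toReal_pow, hβ]; ring
  have hck : ∀ j, CkHolder B 1 k (β j) (ψ j) := fun j => hCk _ (hψ j).1 (hfin j)
  have hbase : ∀ θ : ℝ, 0 < θ → θ < 1 → ∀ m ≤ k, ∃ K : (ℕ → ℝ) → ℝ, HasExpMoments K paramLaw ∧
      ∀ᵐ y ∂paramLaw,
        TendstoUniformlyOn (fun N x => kappaPartial ψ N x y) (fun x => kappa ψ x y) atTop B ∧
        CkHolder B θ m (K y) (fun x => kappa ψ x y) := fun θ h0 h1 m hm =>
    exists_kappa_ckHolder hB hne hbd h0 h1 m ψ β hβs fun j => (hck j).of_le hm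
  obtain ⟨K₀, hK₀, h₀⟩ := hbase (1 / 2) (by norm_num) (by norm_num) 0 (by omega)
  obtain ⟨h1, h2, h3⟩ := elliptic_and_moments hB (by norm_num) hK₀ h₀
  refine ⟨h1, h2, fun p υ hp hυ hυs => ?_, h3⟩
  have hm : ⌊υ⌋₊ ≤ k := by
    have := (Nat.floor_lt hυ).2 hυs
    omega
  -- For integer `υ` no Hölder seminorm enters and any exponent in `(0, 1)` serves; otherwise the
  -- fractional part is needed, and it is below the Lipschitz exponent `1` as chaining requires.
  obtain ⟨θ, hθ0, hθ1, hθυ⟩ : ∃ θ : ℝ, 0 < θ ∧ θ < 1 ∧ (υ ≠ ⌊υ⌋₊ → θ = υ - ⌊υ⌋₊) := by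
    by_cases h : υ = ⌊υ⌋₊
    · exact ⟨1 / 2, by norm_num, by norm_num, fun h' => absurd h h'⟩
    · refine ⟨υ - ⌊υ⌋₊, ?_, ?_, fun _ => rfl⟩
      · exact sub_pos.2 (lt_of_le_of_ne (Nat.floor_le hυ) (Ne.symm h))
      · linarith [Nat.lt_floor_add_one υ]
  obtain ⟨K, hK, hy⟩ := hbase θ hθ0 hθ1 _ hm
  obtain ⟨c, hc, hexp⟩ := CkHolder.exp (θ := θ) hB ⌊υ⌋₊
  have hcoeff : ∀ᵐ y ∂paramLaw,
      CkHolder B θ ⌊υ⌋₊ (Real.exp (c * (K y + 1))) (coeff ψ y) := by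
    filter_upwards [hy] with y hy
    have := hK.nonneg y
    -- The summand `1` meets the requirement `1 ≤ M` of `CkHolder.exp`.
    exact hexp (K y + 1) (by linarith) _ (hy.2.mono (by linarith))
  refine hasFiniteMoment_of_le (hK.add (HasExpMoments.const zero_le_one))
    (aemeasurable_sobolevInftyNorm hB hθ0 (aemeasurable_coeff h1)
      (hcoeff.mono fun y hy => ⟨_, hy⟩)) (c := c) ?_ hp
  filter_upwards [hcoeff] with y hy
  exact sobolevInftyNorm_le hB hθ0 hθυ hy

end CoefficientMoments

section TrigonometricProducts

variable {d : ℕ}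

/-! ### The log-uniform example: decay of the expansion -/

theorem abs_prod_sub_prod_le {ι : Type*} (s : Finset ι) (a b : ι → ℝ) (ha : ∀ i ∈ s, |a i| ≤ 1)
    (hb : ∀ i ∈ s, |b i| ≤ 1) : |∏ i ∈ s, a i - ∏ i ∈ s, b i| ≤ ∑ i ∈ s, |a i - b i| := by
  classical
  induction s using Finset.induction_on with
  | empty => simp
  | insert i s hi ih =>
    rw [Finset.prod_insert hi, Finset.prod_insert hi, Finset.sum_insert hi]
    have h1 := ih (fun j hj => ha j (by simp [hj])) fun j hj => hb j (by simp [hj])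
    have h2 : |∏ j ∈ s, b j| ≤ 1 := by
      rw [Finset.abs_prod]
      exact Finset.prod_le_one (fun _ _ => abs_nonneg _) fun j hj => hb j (by simp [hj])
    have h3 := ha i (by simp)
    have e : a i * ∏ j ∈ s, a j - b i * ∏ j ∈ s, b j =
        (a i - b i) * ∏ j ∈ s, b j + a i * (∏ j ∈ s, a j - ∏ j ∈ s, b j) := by ring
    rw [e]
    refine (abs_add_le _ _).trans ?_
    rw [abs_mul, abs_mul]
    exact add_le_add (mul_le_of_le_one_right (abs_nonneg _) h2)
      ((mul_le_of_le_one_left (abs_nonneg _) h3).trans h1)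

theorem abs_trigFactor_le (l : Fin 2) (u : ℝ) :
    |Real.cos u ^ (l : ℕ) * Real.sin u ^ (1 - (l : ℕ))| ≤ 1 := by
  fin_cases l
  · simpa using Real.abs_sin_le_one u
  · simpa using Real.abs_cos_le_one u

theorem abs_trigFactor_sub_le (l : Fin 2) (u v : ℝ) :
    |Real.cos u ^ (l : ℕ) * Real.sin u ^ (1 - (l : ℕ)) -
      Real.cos v ^ (l : ℕ) * Real.sin v ^ (1 - (l : ℕ))| ≤ |u - v| := by
  fin_cases l
  · simpa using Real.abs_sin_sub_sin_le u v
  · simpa using Real.abs_cos_sub_cos_le u v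

theorem abs_trigProd_le (k : Fin d → ℕ) (l : Fin d → Fin 2) (x : Space d) :
    |trigProd k l x| ≤ 1 := by
  unfold trigProd
  rw [Finset.abs_prod]
  exact Finset.prod_le_one (fun _ _ => abs_nonneg _) fun i _ => abs_trigFactor_le _ _

theorem abs_trigProd_sub_le (k : Fin d → ℕ) (l : Fin d → Fin 2) (x x' : Space d) :
    |trigProd k l x - trigProd k l x'| ≤ Real.pi * ((∑ i, k i : ℕ) : ℝ) * ‖x - x'‖ := by
  unfold trigProd
  refine (abs_prod_sub_prod_le _ _ _ (fun i _ => abs_trigFactor_le _ _)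
    fun i _ => abs_trigFactor_le _ _).trans ?_
  push_cast
  rw [Finset.mul_sum, Finset.sum_mul]
  refine Finset.sum_le_sum fun i _ => (abs_trigFactor_sub_le _ _ _).trans ?_
  rw [← mul_sub, abs_mul, abs_of_nonneg (by have := Real.pi_pos; positivity)]
  have := Real.pi_pos
  gcongr
  exact PiLp.norm_apply_le (x - x') i

/-- Interpolation, according to whether `S * ‖x - x'‖` is at most one, between the Lipschitz bound
and the trivial bound `2`. -/
theorem abs_trigProd_sub_le_rpow (k : Fin d → ℕ) (l : Fin d → Fin 2) (x x' : Space d) {η : ℝ}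
    (h0 : 0 < η) (h1 : η ≤ 1) : |trigProd k l x - trigProd k l x'| ≤
      2 * Real.pi * (1 + ((∑ i, k i : ℕ) : ℝ) ^ 2) ^ (η / 2) * ‖x - x'‖ ^ η := by
  set S : ℝ := ((∑ i, k i : ℕ) : ℝ) with hS
  have hS0 : 0 ≤ S := Nat.cast_nonneg _
  have hn := norm_nonneg (x - x')
  have hpi := Real.pi_gt_three
  have hSη : S ^ η ≤ (1 + S ^ 2) ^ (η / 2) := by
    calc S ^ η = (S ^ 2) ^ (η / 2) := by
          rw [← Real.rpow_natCast, ← Real.rpow_mul hS0]; congr 1; push_cast; ring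
      _ ≤ _ := Real.rpow_le_rpow (by positivity) (by linarith) (by linarith)
  have key : |trigProd k l x - trigProd k l x'| ≤ 2 * Real.pi * (S * ‖x - x'‖) ^ η := by
    rcases le_or_gt (S * ‖x - x'‖) 1 with h | h
    · have h2 : S * ‖x - x'‖ ≤ (S * ‖x - x'‖) ^ η := by
        conv_lhs => rw [← Real.rpow_one (S * ‖x - x'‖)]
        exact Real.rpow_le_rpow_of_exponent_ge_of_imp (by positivity) h h1
          (fun _ h => absurd h one_ne_zero)
      have h3 := abs_trigProd_sub_le k l x x'
      have h4 : 0 ≤ (S * ‖x - x'‖) ^ η := by positivity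
      rw [← hS] at h3
      nlinarith
    · have h2 : 1 ≤ (S * ‖x - x'‖) ^ η := Real.one_le_rpow h.le h0.le
      have h3 := abs_sub (trigProd k l x) (trigProd k l x')
      have h4 := abs_trigProd_le k l x
      have h5 := abs_trigProd_le k l x'
      nlinarith
  rw [Real.mul_rpow hS0 hn] at key
  refine key.trans ?_
  rw [← mul_assoc]
  gcongr

/-- A finite set of indices lies in the product of its coordinate projections, over which the sum
factorises. -/
theorem summable_prod_fin {f : ℕ → ℝ} (hf0 : ∀ n, 0 ≤ f n) (hf : Summable f) :
    Summable fun k : Fin d → ℕ => ∏ i, f (k i) := by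
  classical
  refine summable_of_sum_le (c := (∑' n, f n) ^ d)
    (fun k => Finset.prod_nonneg fun i _ => hf0 _) fun u => ?_
  have hsub : u ⊆ Fintype.piFinset fun i => u.image fun k => k i := fun k hk =>
    Fintype.mem_piFinset.2 fun i => Finset.mem_image_of_mem _ hk
  refine (Finset.sum_le_sum_of_subset_of_nonneg hsub fun k _ _ =>
    Finset.prod_nonneg fun i _ => hf0 _).trans ?_
  rw [← Finset.prod_univ_sum (fun i => u.image fun k => k i) fun _ n => f n]
  refine (Finset.prod_le_prod (fun i _ => Finset.sum_nonneg fun _ _ => hf0 _)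
    fun i _ => hf.sum_le_tsum _ fun n _ => hf0 n).trans (le_of_eq ?_)
  simp

/-- Comparison with a product of one-dimensional series: `1 + k i ≤ 1 + S` gives `∏ (1 + k i)^(2/d)
≤ (1 + S)² ≤ 2 (1 + S²)`, and the resulting exponent `1 + 2 ε / d` of each factor exceeds one. -/
theorem summable_one_add_sq_rpow (hd : 0 < d) {ε : ℝ} (hε : 0 < ε) :
    Summable fun k : Fin d → ℕ => (1 + ((∑ i, k i : ℕ) : ℝ) ^ 2) ^ (-((d : ℝ) / 2 + ε)) := by
  set q : ℝ := (d : ℝ) / 2 + ε with hq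
  have hd' : (0:ℝ) < d := by exact_mod_cast hd
  have hq0 : 0 < q := by positivity
  have hr : 1 < 2 / d * q := by
    rw [hq, mul_add, div_mul_div_cancel₀ (by positivity)]
    have : 0 < 2 / d * ε := by positivity
    rw [div_self (by norm_num)]
    linarith
  have hsum : Summable fun n : ℕ => (1 + (n : ℝ)) ^ (-(2 / d * q)) := by
    have := (Real.summable_one_div_nat_add_rpow 1 (2 / d * q)).2 hr
    refine this.congr fun n => ?_
    rw [abs_of_nonneg (by positivity), Real.rpow_neg (by positivity), one_div, add_comm]
  refine Summable.of_nonneg_of_le (fun k => by positivity) (fun k => ?_)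
    ((summable_prod_fin (d := d) (fun n => by positivity) hsum).mul_left (2 ^ q))
  set S : ℝ := ((∑ i, k i : ℕ) : ℝ) with hS
  have hS0 : 0 ≤ S := Nat.cast_nonneg _
  set P : ℝ := ∏ i, (1 + (k i : ℝ)) with hP
  have hP0 : 0 < P := Finset.prod_pos fun i _ => by positivity
  have hPS : P ≤ (1 + S) ^ d := by
    have : P ≤ ∏ _i : Fin d, (1 + S) := Finset.prod_le_prod (fun i _ => by positivity) fun i _ => by
      have : k i ≤ ∑ i, k i := Finset.single_le_sum (fun _ _ => Nat.zero_le _) (Finset.mem_univ i)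
      have : (k i : ℝ) ≤ S := Nat.cast_le.2 this
      linarith
    simpa using this
  have hPd : P ^ ((2:ℝ) / d) ≤ 2 * (1 + S ^ 2) := by
    have h1 : P ^ ((2:ℝ) / d) ≤ ((1 + S) ^ d) ^ ((2:ℝ) / d) :=
      Real.rpow_le_rpow hP0.le hPS (by positivity)
    rw [← Real.rpow_natCast, ← Real.rpow_mul (by positivity), mul_div_cancel₀ _ hd'.ne',
      Real.rpow_two] at h1
    nlinarith [sq_nonneg (1 - S)]
  have h2 : (1 + S ^ 2) ^ (-q) ≤ (2⁻¹ * P ^ ((2:ℝ) / d)) ^ (-q) :=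
    Real.rpow_le_rpow_of_nonpos (by positivity) (by linarith) (by linarith)
  refine h2.trans (le_of_eq ?_)
  rw [Real.mul_rpow (by norm_num) (by positivity), ← Real.rpow_mul hP0.le,
    Real.inv_rpow (by norm_num), Real.rpow_neg (by norm_num), inv_inv, mul_neg,
    Real.finsetProd_rpow _ _ fun i _ => by positivity]

theorem amplitude_nonneg (ν : ℝ) (k : Fin d → ℕ) : 0 ≤ amplitude ν k := by
  unfold amplitude; positivity

theorem amplitude_sq_le (ν : ℝ) (k : Fin d → ℕ) : amplitude ν k ^ 2 ≤
    3 * 2 ^ d * (1 + ((∑ i, k i : ℕ) : ℝ) ^ 2) ^ (-(ν + (d : ℝ) / 2)) := by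
  unfold amplitude
  rw [mul_pow, mul_pow, Real.sq_sqrt (by norm_num), ← Real.rpow_natCast, ← Real.rpow_natCast,
    ← Real.rpow_mul (by norm_num), ← Real.rpow_mul (by positivity), Nat.cast_ofNat,
    div_mul_cancel₀ _ (by norm_num), neg_mul, div_mul_cancel₀ _ (by norm_num), Real.rpow_natCast]
  gcongr
  · norm_num
  · exact (Finset.card_le_univ _).trans (by simp)

theorem isOpen_unitCube : IsOpen (unitCube d) := by
  have : unitCube d = ⋂ i, {x : Space d | x i ∈ Set.Ioo (0 : ℝ) 1} := by
    ext; simp [unitCube]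
  rw [this]
  exact isOpen_iInter_of_finite fun i => isOpen_Ioo.preimage (by fun_prop)

theorem unitCube_nonempty : (unitCube d).Nonempty :=
  ⟨WithLp.toLp 2 fun _ => 1 / 2, fun i => by constructor <;> norm_num⟩

theorem isBounded_unitCube : Bornology.IsBounded (unitCube d) := by
  refine isBounded_iff_forall_norm_le.2 ⟨√d, fun x hx => ?_⟩
  rw [EuclideanSpace.norm_eq]
  refine Real.sqrt_le_sqrt ?_
  refine (Finset.sum_le_sum fun i _ => (?_ : ‖x i‖ ^ 2 ≤ 1)).trans (by simp)
  rw [Real.norm_eq_abs, sq_abs]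
  nlinarith [(hx i).1, (hx i).2]

/-- Square summable uniform and Hölder bounds of the log-uniform expansion. -/
theorem exists_logUniform_bounds (hd : 0 < d) {ν : ℝ} (hν : 0 < ν)
    (e : ℕ ≃ (Fin d → ℕ) × (Fin d → Fin 2)) : ∃ (η : ℝ) (β : ℕ → ℝ), 0 < η ∧ η ≤ 1 ∧
      (Summable fun j => β j ^ 2) ∧ (∀ j x, |logUniform ν e j x| ≤ β j) ∧
      ∀ j x x', |logUniform ν e j x - logUniform ν e j x'| ≤ β j * ‖x - x'‖ ^ η := by
  -- The Hölder bound costs a factor `(1 + |k|²)^η` in the squares, leaving the exponent `-(d/2 + ν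
  -- - η)` with `ν - η > 0`.
  set η : ℝ := min (ν / 2) 1 with hη
  have hη0 : 0 < η := lt_min (by positivity) one_pos
  have hη1 : η ≤ 1 := min_le_right _ _
  have hην : η ≤ ν / 2 := min_le_left _ _
  let S : (Fin d → ℕ) → ℝ := fun k => ((∑ i, k i : ℕ) : ℝ)
  let b : (Fin d → ℕ) → ℝ := fun k =>
    amplitude ν k * (2 * Real.pi * (1 + S k ^ 2) ^ (η / 2))
  have hpi := Real.pi_gt_three
  have hb : Summable fun k => b k ^ 2 := by
    have hε : 0 < ν - η := by linarith
    refine Summable.of_nonneg_of_le (fun k => sq_nonneg _) (fun k => ?_)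
      ((summable_one_add_sq_rpow hd hε).mul_left (3 * 2 ^ d * (2 * Real.pi) ^ 2))
    have h1 := amplitude_sq_le ν k
    calc b k ^ 2 = amplitude ν k ^ 2 * (2 * Real.pi) ^ 2 * (1 + S k ^ 2) ^ η := by
          simp only [b]
          rw [mul_pow, mul_pow, ← Real.rpow_natCast ((1 + S k ^ 2) ^ (η / 2)),
            ← Real.rpow_mul (by positivity), Nat.cast_ofNat, div_mul_cancel₀ _ (by norm_num)]
          ring
      _ ≤ (3 * 2 ^ d * (1 + S k ^ 2) ^ (-(ν + (d : ℝ) / 2))) * (2 * Real.pi) ^ 2 *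
          (1 + S k ^ 2) ^ η := by gcongr
      _ = 3 * 2 ^ d * (2 * Real.pi) ^ 2 *
          ((1 + S k ^ 2) ^ (-(ν + (d : ℝ) / 2)) * (1 + S k ^ 2) ^ η) := by ring
      _ = _ := by
          rw [← Real.rpow_add (by positivity)]
          congr 2
          ring
  refine ⟨η, fun j => b (e j).1, hη0, hη1, ?_, fun j x => ?_, fun j x x' => ?_⟩
  · have h2 : Summable fun p : (Fin d → ℕ) × (Fin d → Fin 2) => b p.1 ^ 2 := by
      rw [summable_prod_of_nonneg fun p => sq_nonneg _]
      refine ⟨fun k => Summable.of_finite, ?_⟩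
      simp only [tsum_fintype, Finset.sum_const]
      exact hb.const_smul _
    exact e.summable_iff.2 h2
  · unfold logUniform
    rw [abs_mul, abs_of_nonneg (amplitude_nonneg _ _)]
    refine mul_le_mul_of_nonneg_left ((abs_trigProd_le _ _ _).trans ?_) (amplitude_nonneg _ _)
    have : 1 ≤ (1 + S (e j).1 ^ 2) ^ (η / 2) :=
      Real.one_le_rpow (by nlinarith [sq_nonneg (S (e j).1)]) (by linarith)
    nlinarith
  · unfold logUniform
    rw [← mul_sub, abs_mul, abs_of_nonneg (amplitude_nonneg _ _)]
    simp only [b]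
    rw [mul_assoc (amplitude ν (e j).1)]
    exact mul_le_mul_of_nonneg_left (abs_trigProd_sub_le_rpow _ _ _ _ hη0 hη1)
      (amplitude_nonneg _ _)

end TrigonometricProducts

section LaxMilgram

variable {d : ℕ} {B : Set (Space d)}

/-! ### The energy form -/

instance : CompleteSpace (H10 B) :=
  (Submodule.isClosed_topologicalClosure _).completeSpace_coe

/-- The weak gradient as a continuous linear map. -/
def gradL (B : Set (Space d)) : H10 B →L[ℝ] Lp (Space d) 2 (volume.restrict B) :=
  (WithLp.sndL 2 ℝ (Lp ℝ 2 (volume.restrict B)) (Lp (Space d) 2 (volume.restrict B))).comp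
    (H10 B).subtypeL

theorem norm_gradL_le (u : H10 B) : ‖gradL B u‖ ≤ ‖u‖ := by
  have h := WithLp.prod_norm_sq_eq_of_L2 (u : L2Pair B)
  have h2 : ‖gradL B u‖ = ‖(u : L2Pair B).snd‖ := rfl
  have h3 : ‖u‖ = ‖(u : L2Pair B)‖ := rfl
  rw [h2, h3]
  refine (sq_le_sq₀ (norm_nonneg _) (norm_nonneg _)).1 ?_
  nlinarith [sq_nonneg ‖(u : L2Pair B).fst‖]

/-- `a` is measurable on `B`, and bounded by `M`. -/
structure BddCoeff (B : Set (Space d)) (a : Space d → ℝ) (M : ℝ) : Prop where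
  meas : AEStronglyMeasurable a (volume.restrict B)
  bound : ∀ᵐ x ∂volume.restrict B, |a x| ≤ M

theorem BddCoeff.memLp {a : Space d → ℝ} {M : ℝ} (h : BddCoeff B a M)
    (f : Lp (Space d) 2 (volume.restrict B)) :
    MemLp (fun x => a x • f x) 2 (volume.restrict B) := by
  refine (Lp.memLp f).of_le_mul (c := M) (h.meas.smul (Lp.aestronglyMeasurable f)) ?_
  filter_upwards [h.bound] with x hx
  rw [norm_smul]
  exact mul_le_mul_of_nonneg_right hx (norm_nonneg _)

/-- The function `a • f`, as an element of `L²`. -/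
def BddCoeff.smulLp {a : Space d → ℝ} {M : ℝ} (h : BddCoeff B a M)
    (f : Lp (Space d) 2 (volume.restrict B)) : Lp (Space d) 2 (volume.restrict B) :=
  (h.memLp f).toLp _

theorem BddCoeff.coeFn_smulLp {a : Space d → ℝ} {M : ℝ} (h : BddCoeff B a M)
    (f : Lp (Space d) 2 (volume.restrict B)) :
    h.smulLp f =ᵐ[volume.restrict B] fun x => a x • f x := (h.memLp f).coeFn_toLp

theorem BddCoeff.smulLp_add {a : Space d → ℝ} {M : ℝ} (h : BddCoeff B a M)
    (f g : Lp (Space d) 2 (volume.restrict B)) :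
    h.smulLp (f + g) = h.smulLp f + h.smulLp g := by
  apply Lp.ext
  filter_upwards [h.coeFn_smulLp (f + g), h.coeFn_smulLp f, h.coeFn_smulLp g, Lp.coeFn_add f g,
    Lp.coeFn_add (h.smulLp f) (h.smulLp g)] with x e1 e2 e3 e4 e5
  rw [e1, e5, Pi.add_apply, e2, e3, e4, Pi.add_apply, smul_add]

theorem BddCoeff.smulLp_smul {a : Space d → ℝ} {M : ℝ} (h : BddCoeff B a M) (c : ℝ)
    (f : Lp (Space d) 2 (volume.restrict B)) :
    h.smulLp (c • f) = c • h.smulLp f := by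
  apply Lp.ext
  filter_upwards [h.coeFn_smulLp (c • f), h.coeFn_smulLp f, Lp.coeFn_smul c f,
    Lp.coeFn_smul c (h.smulLp f)] with x e1 e2 e3 e4
  rw [e1, e4, Pi.smul_apply, e2, e3, Pi.smul_apply, smul_comm]

theorem BddCoeff.norm_smulLp_le {a : Space d → ℝ} {M : ℝ} (h : BddCoeff B a M)
    (f : Lp (Space d) 2 (volume.restrict B)) : ‖h.smulLp f‖ ≤ M * ‖f‖ := by
  refine Lp.norm_le_mul_norm_of_ae_le_mul ?_
  filter_upwards [h.coeFn_smulLp f, h.bound] with x e hx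
  rw [e, norm_smul]
  exact mul_le_mul_of_nonneg_right hx (norm_nonneg _)

theorem BddCoeff.smulLp_sub {a a' : Space d → ℝ} {M M' N : ℝ} (h : BddCoeff B a M)
    (h' : BddCoeff B a' M') (hd : BddCoeff B (fun x => a x - a' x) N)
    (f : Lp (Space d) 2 (volume.restrict B)) :
    h.smulLp f - h'.smulLp f = hd.smulLp f := by
  apply Lp.ext
  filter_upwards [hd.coeFn_smulLp f, h.coeFn_smulLp f, h'.coeFn_smulLp f,
    Lp.coeFn_sub (h.smulLp f) (h'.smulLp f)] with x e1 e2 e3 e4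
  rw [e4, Pi.sub_apply, e1, e2, e3, sub_smul]

theorem BddCoeff.inner_eq {a : Space d → ℝ} {M : ℝ} (h : BddCoeff B a M)
    (f g : Lp (Space d) 2 (volume.restrict B)) :
    IntegrableOn (fun x => a x * inner ℝ (f x) (g x)) B ∧
    inner ℝ (h.smulLp f) g = ∫ x in B, a x * inner ℝ (f x) (g x) := by
  have e : (fun x => inner ℝ (h.smulLp f x) (g x)) =ᵐ[volume.restrict B]
      fun x => a x * inner ℝ (f x) (g x) := by
    filter_upwards [h.coeFn_smulLp f] with x hx
    rw [hx, real_inner_smul_left]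
  refine ⟨(L2.integrable_inner (𝕜 := ℝ) (h.smulLp f) g).congr e, ?_⟩
  rw [L2.inner_def]
  exact integral_congr_ae e

theorem BddCoeff.isWeakSolution_iff {a : Space d → ℝ} {M : ℝ} (h : BddCoeff B a M)
    (ς : Hneg1 B) (u : H10 B) :
    IsWeakSolution a ς u ↔ ∀ v : H10 B, inner ℝ (h.smulLp (gradL B u)) (gradL B v) = ς v := by
  refine forall_congr' fun v => ?_
  obtain ⟨h1, h2⟩ := h.inner_eq (gradL B u) (gradL B v)
  rw [h2]
  exact ⟨fun h => h.2, fun h => ⟨h1, h⟩⟩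

theorem BddCoeff.le_inner {a : Space d → ℝ} {M m : ℝ} (h : BddCoeff B a M)
    (hm : ∀ᵐ x ∂volume.restrict B, m ≤ a x) (f : Lp (Space d) 2 (volume.restrict B)) :
    m * ‖f‖ ^ 2 ≤ inner ℝ (h.smulLp f) f := by
  obtain ⟨h1, h2⟩ := h.inner_eq f f
  rw [h2, ← real_inner_self_eq_norm_sq, L2.inner_def, ← integral_const_mul]
  refine integral_mono_ae ((L2.integrable_inner (𝕜 := ℝ) f f).const_mul m) h1 ?_
  filter_upwards [hm] with x hx
  exact mul_le_mul_of_nonneg_right hx real_inner_self_nonneg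

/-- The Poincaré inequality on `H¹₀(B)`, with the full norm of `H¹` on the left. -/
def HasPoincare (B : Set (Space d)) (P : ℝ) : Prop := ∀ u : H10 B, ‖u‖ ^ 2 ≤ P * ‖gradL B u‖ ^ 2

/-- The Lax-Milgram theorem for the bilinear form `⟪T (D u), D v⟫`. -/
theorem exists_inner_comp_eq {H L : Type*} [NormedAddCommGroup H] [InnerProductSpace ℝ H]
    [CompleteSpace H] [NormedAddCommGroup L] [InnerProductSpace ℝ L] (D : H →L[ℝ] L)
    (T : L →L[ℝ] L) {c : ℝ} (hc0 : 0 < c) (hc : ∀ u, c * ‖u‖ ^ 2 ≤ inner ℝ (T (D u)) (D u))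
    (f : StrongDual ℝ H) : ∃ u : H, ∀ v, inner ℝ (T (D u)) (D v) = f v := by
  let b : H →ₗ[ℝ] H →ₗ[ℝ] ℝ := LinearMap.mk₂ ℝ (fun u v => inner ℝ (T (D u)) (D v))
    (fun u u' v => by rw [map_add, map_add, inner_add_left])
    (fun c u v => by rw [map_smul, map_smul, real_inner_smul_left, smul_eq_mul])
    (fun u v v' => by rw [map_add, inner_add_right])
    (fun c u v => by rw [map_smul, real_inner_smul_right, smul_eq_mul])
  let bc : H →L[ℝ] H →L[ℝ] ℝ := b.mkContinuous₂ (‖T‖ * ‖D‖ * ‖D‖) fun u v => by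
    have h1 := (norm_inner_le_norm (𝕜 := ℝ) (T (D u)) (D v)).trans
      (mul_le_mul ((T.le_opNorm _).trans (mul_le_mul_of_nonneg_left (D.le_opNorm u)
        (norm_nonneg T))) (D.le_opNorm v) (norm_nonneg _) (by positivity))
    refine h1.trans (le_of_eq ?_)
    ring
  have hbc : ∀ u v, bc u v = inner ℝ (T (D u)) (D v) := fun u v => rfl
  have hco : IsCoercive bc :=
    ⟨c, hc0, fun u => by rw [hbc, mul_assoc, ← pow_two]; exact hc u⟩
  refine ⟨hco.continuousLinearEquivOfBilin.symm ((InnerProductSpace.toDual ℝ H).symm f),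
    fun v => ?_⟩
  rw [← hbc, ← hco.continuousLinearEquivOfBilin_apply, ContinuousLinearEquiv.apply_symm_apply,
    InnerProductSpace.toDual_symm_apply]

theorem exists_isWeakSolution {P : ℝ} (hP0 : 0 < P) (hP : HasPoincare B P) {a : Space d → ℝ}
    {M m : ℝ} (h : BddCoeff B a M) (hm0 : 0 < m) (hm : ∀ᵐ x ∂volume.restrict B, m ≤ a x)
    (ς : Hneg1 B) : ∃ u : H10 B, IsWeakSolution a ς u := by
  let T₀ : Lp (Space d) 2 (volume.restrict B) →ₗ[ℝ] Lp (Space d) 2 (volume.restrict B) :=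
    { toFun := h.smulLp, map_add' := h.smulLp_add, map_smul' := h.smulLp_smul }
  obtain ⟨u, hu⟩ := exists_inner_comp_eq (gradL B) (T₀.mkContinuous M h.norm_smulLp_le)
    (c := m / P) (by positivity) (fun u => by
      refine le_trans ?_ (h.le_inner hm (gradL B u))
      rw [div_mul_eq_mul_div, div_le_iff₀ hP0, mul_assoc, mul_comm _ P]
      exact mul_le_mul_of_nonneg_left (hP u) hm0.le) ς
  exact ⟨u, (h.isWeakSolution_iff ς u).2 hu⟩

/-- Multiplying by `P` and applying Poincaré leaves one factor `‖u‖` to cancel. -/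
theorem norm_le_of_energy_le {P m c : ℝ} (hP : HasPoincare B P) (hP0 : 0 < P) (hm0 : 0 < m)
    (hc : 0 ≤ c) {u : H10 B} (h : m * ‖gradL B u‖ ^ 2 ≤ c * ‖u‖) : ‖u‖ ≤ P / m * c := by
  have h1 := hP u
  rcases (norm_nonneg u).eq_or_lt with h0 | h0
  · rw [← h0]; positivity
  · rw [div_mul_eq_mul_div, le_div_iff₀ hm0]
    have h2 : m * ‖u‖ ^ 2 ≤ P * (c * ‖u‖) := by nlinarith
    nlinarith

theorem IsWeakSolution.norm_le {P : ℝ} (hP0 : 0 < P) (hP : HasPoincare B P) {a : Space d → ℝ}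
    {M m : ℝ} (h : BddCoeff B a M) (hm0 : 0 < m) (hm : ∀ᵐ x ∂volume.restrict B, m ≤ a x)
    {ς : Hneg1 B} {u : H10 B} (hu : IsWeakSolution a ς u) : ‖u‖ ≤ P / m * ‖ς‖ := by
  refine norm_le_of_energy_le hP hP0 hm0 (c := ‖ς‖) (norm_nonneg ς) ((h.le_inner hm _).trans ?_)
  rw [(h.isWeakSolution_iff ς u).1 hu u]
  exact (le_abs_self _).trans (ς.le_opNorm u)

/-- Subtracting the two equations, `a ∇(u - u')` and `(a' - a) ∇u'` have the same pairing with
gradients; the test function is `u - u'`. Equal coefficients with `ε = 0` give uniqueness. -/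
theorem IsWeakSolution.norm_sub_le {P : ℝ} (hP0 : 0 < P) (hP : HasPoincare B P)
    {a a' : Space d → ℝ} {M M' m ε : ℝ} (h : BddCoeff B a M) (h' : BddCoeff B a' M')
    (hm0 : 0 < m) (hm : ∀ᵐ x ∂volume.restrict B, m ≤ a x) (hε : 0 ≤ ε)
    (haa : ∀ᵐ x ∂volume.restrict B, |a' x - a x| ≤ ε)
    {ς : Hneg1 B} {u u' : H10 B} (hu : IsWeakSolution a ς u) (hu' : IsWeakSolution a' ς u') :
    ‖u - u'‖ ≤ P / m * (ε * ‖u'‖) := by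
  refine norm_le_of_energy_le hP hP0 hm0 (by positivity) ((h.le_inner hm _).trans ?_)
  set w := gradL B (u - u') with hw
  have hd : BddCoeff B (fun x => a' x - a x) ε := ⟨h'.meas.sub h.meas, haa⟩
  have e : h.smulLp (gradL B u) = h.smulLp w + h.smulLp (gradL B u') := by
    rw [← h.smulLp_add, hw, ← map_add, sub_add_cancel]
  have h1 := (h.isWeakSolution_iff ς u).1 hu (u - u')
  have h2 := (h'.isWeakSolution_iff ς u').1 hu' (u - u')
  rw [← hw] at h1 h2
  rw [e, inner_add_left] at h1
  have h3 : inner ℝ (h.smulLp w) w = inner ℝ (hd.smulLp (gradL B u')) w := by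
    rw [← h'.smulLp_sub h hd, inner_sub_left]
    linarith
  rw [h3]
  refine (le_abs_self _).trans ((abs_real_inner_le_norm _ _).trans ?_)
  refine mul_le_mul ((hd.norm_smulLp_le _).trans ?_) (norm_gradL_le _) (norm_nonneg _)
    (by positivity)
  exact mul_le_mul_of_nonneg_left (norm_gradL_le _) hε

/-! ### Exponential coefficients -/

/-- `κ` is continuous on `B`, and bounded by `R`. -/
structure BddCont (B : Set (Space d)) (κ : Space d → ℝ) (R : ℝ) : Prop where
  cont : ContinuousOn κ B
  bound : ∀ x ∈ B, |κ x| ≤ R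

theorem BddCont.bddCoeff_exp (hB : IsOpen B) {κ : Space d → ℝ} {R : ℝ} (h : BddCont B κ R) :
    BddCoeff B (fun x => Real.exp (κ x)) (Real.exp R) := by
  refine ⟨(Real.continuous_exp.comp_continuousOn h.cont).aestronglyMeasurable hB.measurableSet, ?_⟩
  filter_upwards [ae_restrict_mem hB.measurableSet] with x hx
  rw [abs_of_pos (Real.exp_pos _)]
  exact Real.exp_le_exp.2 (abs_le.1 (h.bound x hx)).2

theorem BddCont.le_exp (hB : IsOpen B) {κ : Space d → ℝ} {R : ℝ} (h : BddCont B κ R) :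
    ∀ᵐ x ∂volume.restrict B, Real.exp (-R) ≤ Real.exp (κ x) := by
  filter_upwards [ae_restrict_mem hB.measurableSet] with x hx
  exact Real.exp_le_exp.2 (abs_le.1 (h.bound x hx)).1

theorem BddCont.exists_isWeakSolution (hB : IsOpen B) {P : ℝ} (hP0 : 0 < P)
    (hP : HasPoincare B P) {κ : Space d → ℝ} {R : ℝ} (h : BddCont B κ R) (ς : Hneg1 B) :
    ∃ u : H10 B, IsWeakSolution (fun x => Real.exp (κ x)) ς u :=
  RandomDiffusion.exists_isWeakSolution hP0 hP (h.bddCoeff_exp hB) (Real.exp_pos _) (h.le_exp hB) ς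

theorem BddCont.isWeakSolution_unique (hB : IsOpen B) {P : ℝ} (hP0 : 0 < P)
    (hP : HasPoincare B P) {κ : Space d → ℝ} {R : ℝ} (h : BddCont B κ R) {ς : Hneg1 B}
    {u u' : H10 B} (hu : IsWeakSolution (fun x => Real.exp (κ x)) ς u)
    (hu' : IsWeakSolution (fun x => Real.exp (κ x)) ς u') : u = u' := by
  have := hu.norm_sub_le hP0 hP (h.bddCoeff_exp hB) (h.bddCoeff_exp hB) (Real.exp_pos _)
    (h.le_exp hB) le_rfl (ae_of_all _ fun x => by simp) hu'
  rw [zero_mul, mul_zero] at this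
  exact sub_eq_zero.1 (norm_le_zero_iff.1 this)

/-- The weak solution depends continuously on the logarithm of the coefficient. -/
theorem BddCont.tendsto_solution (hB : IsOpen B) {P : ℝ} (hP0 : 0 < P) (hP : HasPoincare B P)
    {ι : Type*} {l : Filter ι} {κ : ι → Space d → ℝ} {κ' : Space d → ℝ} {R : ι → ℝ} {R' : ℝ}
    (h : ∀ i, BddCont B (κ i) (R i)) (h' : BddCont B κ' R') (hl : TendstoUniformlyOn κ κ' l B)
    {ς : Hneg1 B} {u : ι → H10 B} {u' : H10 B}
    (hu : ∀ i, IsWeakSolution (fun x => Real.exp (κ i x)) ς (u i))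
    (hu' : IsWeakSolution (fun x => Real.exp (κ' x)) ς u') : Tendsto u l (𝓝 u') := by
  rw [Metric.tendstoUniformlyOn_iff] at hl
  rw [Metric.tendsto_nhds]
  intro ε hε
  set c : ℝ := P / Real.exp (-(R' + 1)) * (Real.exp (R' + 1) * ‖u'‖) with hc
  have hc0 : 0 ≤ c := by positivity
  have hδ : 0 < min 1 (ε / (c + 1)) := lt_min one_pos (by positivity)
  filter_upwards [hl _ hδ] with i hi
  set δ := min 1 (ε / (c + 1)) with hδd
  have hclose : ∀ x ∈ B, |κ' x - κ i x| ≤ δ := fun x hx => (hi x hx).le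
  have hbd : ∀ x ∈ B, |κ i x| ≤ R' + 1 := fun x hx => by
    have h1 := abs_le.1 ((hclose x hx).trans (min_le_left _ _))
    have h2 := abs_le.1 (h'.bound x hx)
    rw [abs_le]
    constructor <;> linarith [h1.1, h1.2, h2.1, h2.2]
  -- The given bounds `R i` need not be uniform in `i`; closeness to `κ'` supplies a common bound,
  -- hence a common ellipticity constant.
  have hi2 : BddCont B (κ i) (R' + 1) := ⟨(h i).cont, hbd⟩
  have h1 := (hu i).norm_sub_le hP0 hP (hi2.bddCoeff_exp hB) (h'.bddCoeff_exp hB)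
    (Real.exp_pos _) (hi2.le_exp hB) (ε := Real.exp (R' + 1) * δ) (by positivity) (by
      filter_upwards [ae_restrict_mem hB.measurableSet] with x hx
      refine (abs_exp_sub_exp_le (M := R' + 1) ?_ (abs_le.1 (hbd x hx)).2).trans
        (mul_le_mul_of_nonneg_left (hclose x hx) (Real.exp_pos _).le)
      linarith [(abs_le.1 (h'.bound x hx)).2]) hu'
  rw [dist_eq_norm]
  calc ‖u i - u'‖ ≤ c * δ := h1.trans (le_of_eq (by rw [hc]; ring))
    _ ≤ c * (ε / (c + 1)) := mul_le_mul_of_nonneg_left (min_le_right _ _) hc0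
    _ < ε := by
      rw [← mul_div_assoc, div_lt_iff₀ (by positivity)]
      nlinarith

/-! ### The Poincaré inequality on the unit cube -/

theorem lp_norm_sq_eq {E : Type*} [NormedAddCommGroup E] [InnerProductSpace ℝ E]
    {μ : Measure (Space d)} (f : Lp E 2 μ) : ‖f‖ ^ 2 = ∫ x, ‖f x‖ ^ 2 ∂μ := by
  rw [← real_inner_self_eq_norm_sq, L2.inner_def]
  simp only [real_inner_self_eq_norm_sq]

theorem abs_partialD_le_norm_gradient (l : Fin d) (φ : Space d → ℝ) (x : Space d) :
    |partialD l φ x| ≤ ‖gradient φ x‖ := by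
  have h1 : ‖gradient φ x‖ = ‖fderiv ℝ φ x‖ := by
    unfold gradient; exact LinearIsometryEquiv.norm_map _ _
  rw [h1]
  refine ((fderiv ℝ φ x).le_opNorm _).trans (le_of_eq ?_)
  simp

/-- Integration by parts against the coordinate `x i`, as `∂_i x_i = 1`: `∫ φ² = -2 ∫ x_i φ ∂_i φ ≤
½ ∫ φ² + 2 ∫ |∇φ|²`, by Young's inequality and `|x_i| ≤ 1`. -/
theorem IsTestFun.poincare_unitCube (hd : 0 < d) {φ : Space d → ℝ}
    (hφ : IsTestFun (unitCube d) φ) :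
    ∫ x in unitCube d, φ x ^ 2 ≤ 4 * ∫ x in unitCube d, ‖gradient φ x‖ ^ 2 := by
  set i : Fin d := ⟨0, hd⟩
  have hdφ : Differentiable ℝ φ := hφ.1.differentiable (by simp)
  have hcont : Continuous (partialD i φ) :=
    (hφ.1.continuous_fderiv (by simp)).clm_apply continuous_const
  have hxd : ∀ x, HasFDerivAt (fun x : Space d => x i * φ x)
      (x i • fderiv ℝ φ x + φ x • (EuclideanSpace.proj (𝕜 := ℝ) i : Space d →L[ℝ] ℝ)) x :=
    fun x => (EuclideanSpace.proj (𝕜 := ℝ) i).hasFDerivAt.mul (hdφ x).hasFDerivAt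
  have hpd : ∀ x, partialD i (fun x : Space d => x i * φ x) x = x i * partialD i φ x + φ x := by
    intro x
    simp only [partialD]
    rw [(hxd x).fderiv]
    simp
  have hibp := integral_mul_partialD isOpen_unitCube (f := fun x : Space d => x i * φ x)
    (fun x _ => (hxd x).differentiableAt) i
    (by simp only [funext hpd]
        exact (((EuclideanSpace.proj (𝕜 := ℝ) i).continuous.mul hcont).add
          hdφ.continuous).continuousOn) hφ
  simp only [hpd] at hibp
  have hcs : HasCompactSupport φ := hφ.2.1
  have hxc : Continuous fun x : Space d => x i := by fun_prop
  have hφc := hdφ.continuous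
  have I1 : Integrable (fun x => φ x ^ 2) := by
    simp only [pow_two]
    exact (hφc.mul hφc).integrable_of_hasCompactSupport hcs.mul_right
  have I2 : Integrable (fun x => x i * φ x * partialD i φ x) :=
    ((hxc.mul hφc).mul hcont).integrable_of_hasCompactSupport (hcs.mul_left.mul_right)
  have hgc : Continuous fun x => ‖gradient φ x‖ := by
    have : (fun x => ‖gradient φ x‖) = fun x => ‖fderiv ℝ φ x‖ := by
      ext x; unfold gradient; exact LinearIsometryEquiv.norm_map _ _
    rw [this]
    exact (hφ.1.continuous_fderiv (by simp)).norm
  have hgs : HasCompactSupport fun x => ‖gradient φ x‖ := by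
    have : (fun x => ‖gradient φ x‖) = fun x => ‖fderiv ℝ φ x‖ := by
      ext x; unfold gradient; exact LinearIsometryEquiv.norm_map _ _
    rw [this]
    exact (hcs.fderiv ℝ).norm
  have I3 : Integrable (fun x => ‖gradient φ x‖ ^ 2) := by
    simp only [pow_two]
    exact (hgc.mul hgc).integrable_of_hasCompactSupport hgs.mul_right
  have e : ∫ x in unitCube d, φ x ^ 2 =
      ∫ x in unitCube d, -2 * (x i * φ x * partialD i φ x) := by
    have e1 : ∫ x in unitCube d, (x i * partialD i φ x + φ x) * φ x =
        (∫ x in unitCube d, x i * φ x * partialD i φ x) + ∫ x in unitCube d, φ x ^ 2 := by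
      rw [← integral_add I2.integrableOn I1.integrableOn]
      congr 1 with x
      ring
    rw [e1] at hibp
    rw [integral_const_mul]
    linarith
  have hle : ∫ x in unitCube d, -2 * (x i * φ x * partialD i φ x) ≤
      ∫ x in unitCube d, (1 / 2 * φ x ^ 2 + 2 * ‖gradient φ x‖ ^ 2) := by
    refine setIntegral_mono_on (I2.const_mul _).integrableOn
      ((I1.const_mul _).add (I3.const_mul _)).integrableOn isOpen_unitCube.measurableSet
      fun x hx => ?_
    have h1 := abs_partialD_le_norm_gradient i φ x
    have h2 : partialD i φ x ^ 2 ≤ ‖gradient φ x‖ ^ 2 := by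
      rw [← sq_abs]; exact pow_le_pow_left₀ (abs_nonneg _) h1 2
    have h3 := hx i
    have h4 : (x i * partialD i φ x) ^ 2 ≤ partialD i φ x ^ 2 := by
      rw [mul_pow]
      exact mul_le_of_le_one_left (sq_nonneg _) (by nlinarith [h3.1, h3.2])
    nlinarith [sq_nonneg (φ x + 2 * (x i * partialD i φ x))]
  rw [← e, integral_add (I1.const_mul _).integrableOn (I3.const_mul _).integrableOn,
    integral_const_mul, integral_const_mul] at hle
  linarith

theorem IsTestFun.zero : IsTestFun B (0 : Space d → ℝ) :=
  ⟨contDiff_const, HasCompactSupport.zero, by simp [tsupport]⟩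

theorem IsTestFun.add {φ χ : Space d → ℝ} (hφ : IsTestFun B φ) (hχ : IsTestFun B χ) :
    IsTestFun B (φ + χ) :=
  ⟨hφ.1.add hχ.1, hφ.2.1.add hχ.2.1,
    (tsupport_add φ χ).trans (Set.union_subset hφ.2.2 hχ.2.2)⟩

theorem IsTestFun.smul {φ : Space d → ℝ} (hφ : IsTestFun B φ) (c : ℝ) :
    IsTestFun B (c • φ) := by
  have h : tsupport (c • φ) ⊆ tsupport φ :=
    closure_mono fun x hx => right_ne_zero_of_mul (a := c) hx
  exact ⟨contDiff_const.smul hφ.1, hφ.2.1.mono' ((subset_tsupport _).trans h), h.trans hφ.2.2⟩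

theorem exists_testFun_of_mem_span {z : L2Pair B} (hz : z ∈ Submodule.span ℝ {z : L2Pair B |
    ∃ φ : Space d → ℝ, IsTestFun B φ ∧ z.fst =ᵐ[volume.restrict B] φ ∧
      z.snd =ᵐ[volume.restrict B] fun x => gradient φ x}) :
    ∃ φ : Space d → ℝ, IsTestFun B φ ∧ z.fst =ᵐ[volume.restrict B] φ ∧
      z.snd =ᵐ[volume.restrict B] fun x => gradient φ x := by
  induction hz using Submodule.span_induction with
  | mem z h => exact h
  | zero =>
    refine ⟨0, IsTestFun.zero, Lp.coeFn_zero _ _ _, ?_⟩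
    refine (Lp.coeFn_zero _ _ _).trans (ae_of_all _ fun x => ?_)
    simp [gradient, show (0 : Space d → ℝ) = fun _ => 0 from rfl]
  | add z w _ _ hz hw =>
    obtain ⟨φ, h1, h2, h3⟩ := hz
    obtain ⟨χ, k1, k2, k3⟩ := hw
    refine ⟨φ + χ, h1.add k1, (Lp.coeFn_add z.fst w.fst).trans (h2.add k2), ?_⟩
    refine (Lp.coeFn_add z.snd w.snd).trans ((h3.add k3).trans (ae_of_all _ fun x => ?_))
    simp only [gradient, Pi.add_apply]
    rw [fderiv_add (h1.1.differentiable (by simp) x) (k1.1.differentiable (by simp) x), map_add]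
  | smul c z _ hz =>
    obtain ⟨φ, h1, h2, h3⟩ := hz
    refine ⟨c • φ, h1.smul c, (Lp.coeFn_smul c z.fst).trans (h2.const_smul c), ?_⟩
    refine (Lp.coeFn_smul c z.snd).trans ((h3.const_smul c).trans (ae_of_all _ fun x => ?_))
    simp only [gradient, Pi.smul_apply]
    rw [fderiv_const_smul (h1.1.differentiable (by simp) x)]
    simp

/-- The inequality between the components is a closed condition, and elements of the span come from
single test functions. The constant is `5 = 4 + 1`, the `1` for the gradient part of the full norm.
-/
theorem hasPoincare_unitCube (hd : 0 < d) : HasPoincare (unitCube d) 5 := by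
  intro u
  have hcl : IsClosed {z : L2Pair (unitCube d) | ‖z.fst‖ ^ 2 ≤ 4 * ‖z.snd‖ ^ 2} := by
    have h1 : Continuous fun z : L2Pair (unitCube d) => z.fst :=
      (WithLp.fstL 2 ℝ (Lp ℝ 2 (volume.restrict (unitCube d)))
        (Lp (Space d) 2 (volume.restrict (unitCube d)))).continuous
    have h2 : Continuous fun z : L2Pair (unitCube d) => z.snd :=
      (WithLp.sndL 2 ℝ (Lp ℝ 2 (volume.restrict (unitCube d)))
        (Lp (Space d) 2 (volume.restrict (unitCube d)))).continuous
    exact isClosed_le (h1.norm.pow 2) ((h2.norm.pow 2).const_mul 4)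
  have hu : (u : L2Pair (unitCube d)) ∈
      {z : L2Pair (unitCube d) | ‖z.fst‖ ^ 2 ≤ 4 * ‖z.snd‖ ^ 2} := by
    refine closure_minimal (fun z hz => ?_) hcl u.2
    obtain ⟨φ, h1, h2, h3⟩ := exists_testFun_of_mem_span hz
    have h4 := h1.poincare_unitCube hd
    rw [Set.mem_ofPred_eq, lp_norm_sq_eq, lp_norm_sq_eq]
    have e1 : ∫ x in unitCube d, ‖z.fst x‖ ^ 2 = ∫ x in unitCube d, φ x ^ 2 :=
      integral_congr_ae (h2.mono fun x hx => by simp only [hx, Real.norm_eq_abs, sq_abs])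
    have e2 : ∫ x in unitCube d, ‖z.snd x‖ ^ 2 = ∫ x in unitCube d, ‖gradient φ x‖ ^ 2 :=
      integral_congr_ae (h3.mono fun x hx => by simp only [hx])
    rw [e1, e2]
    exact h4
  have h5 := WithLp.prod_norm_sq_eq_of_L2 (u : L2Pair (unitCube d))
  have h6 : ‖gradL (unitCube d) u‖ = ‖(u : L2Pair (unitCube d)).snd‖ := rfl
  have h7 : ‖u‖ = ‖(u : L2Pair (unitCube d))‖ := rfl
  rw [h6, h7, h5]
  rw [Set.mem_ofPred_eq] at hu
  linarith

end LaxMilgram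

section RandomProblem

variable {d : ℕ} {B : Set (Space d)}

/-! ### The random boundary value problem -/

theorem bddCont_kappaPartial {ψ : ℕ → Space d → ℝ} {β : ℕ → ℝ}
    (hc : ∀ j, ContinuousOn (ψ j) B) (hb : ∀ j, ∀ x ∈ B, |ψ j x| ≤ β j) (N : ℕ) (y : ℕ → ℝ) :
    BddCont B (fun x => kappaPartial ψ N x y) (∑ j ∈ Finset.range N, β j * |y j|) := by
  refine ⟨?_, fun x hx => ?_⟩
  · unfold kappaPartial
    exact continuousOn_finsetSum _ fun j _ => (hc j).mul continuousOn_const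
  · refine (Finset.abs_sum_le_sum_abs _ _).trans (Finset.sum_le_sum fun j _ => ?_)
    rw [abs_mul]
    exact mul_le_mul_of_nonneg_right (hb j x hx) (abs_nonneg _)

theorem tendstoUniformlyOn_kappaPartial {ψ : ℕ → Space d → ℝ} {β : ℕ → ℝ}
    (hb : ∀ j, ∀ x ∈ B, |ψ j x| ≤ β j) (N : ℕ) (y : ℕ → ℝ) :
    TendstoUniformlyOn (fun y' x => kappaPartial ψ N x y') (fun x => kappaPartial ψ N x y)
      (𝓝 y) B := by
  rw [Metric.tendstoUniformlyOn_iff]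
  intro ε hε
  have h : Tendsto (fun y' : ℕ → ℝ => ∑ j ∈ Finset.range N, β j * |y j - y' j|) (𝓝 y) (𝓝 0) := by
    have : Continuous fun y' : ℕ → ℝ => ∑ j ∈ Finset.range N, β j * |y j - y' j| := by fun_prop
    simpa using this.tendsto y
  filter_upwards [h.eventually (gt_mem_nhds hε)] with y' hy' x hx
  refine lt_of_le_of_lt ?_ hy'
  rw [Real.dist_eq]
  unfold kappaPartial
  rw [← Finset.sum_sub_distrib]
  refine (Finset.abs_sum_le_sum_abs _ _).trans (Finset.sum_le_sum fun j _ => ?_)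
  rw [← mul_sub, abs_mul]
  exact mul_le_mul_of_nonneg_right (hb j x hx) (abs_nonneg _)

/-- Any choice of weak solutions for almost every parameter is strongly measurable. -/
theorem aestronglyMeasurable_solution (hB : IsOpen B) {P : ℝ} (hP0 : 0 < P)
    (hP : HasPoincare B P) {ψ : ℕ → Space d → ℝ} {β : ℕ → ℝ} (hc : ∀ j, ContinuousOn (ψ j) B)
    (hb : ∀ j, ∀ x ∈ B, |ψ j x| ≤ β j)
    (h : ∀ᵐ y ∂paramLaw,
      TendstoUniformlyOn (fun N x => kappaPartial ψ N x y) (fun x => kappa ψ x y) atTop B ∧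
      ∃ R, BddCont B (fun x => kappa ψ x y) R) {ς : Hneg1 B} {u : (ℕ → ℝ) → H10 B}
    (hu : ∀ᵐ y ∂paramLaw, IsWeakSolution (coeff ψ y) ς (u y)) :
    AEStronglyMeasurable u paramLaw := by
  -- Solutions for the truncated coefficients: these exist for every `y` and, being unique, depend
  -- continuously on `y`. They converge to `u` where the series converges uniformly.
  choose v hv using fun (N : ℕ) (y : ℕ → ℝ) =>
    (bddCont_kappaPartial hc hb N y).exists_isWeakSolution hB hP0 hP ς
  refine aestronglyMeasurable_of_tendsto_ae atTop (f := v) (fun N => ?_) ?_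
  · have hcont : Continuous (v N) := continuous_iff_continuousAt.2 fun y =>
      BddCont.tendsto_solution hB hP0 hP (fun y' => bddCont_kappaPartial hc hb N y')
        (bddCont_kappaPartial hc hb N y) (tendstoUniformlyOn_kappaPartial hb N y)
        (fun y' => hv N y') (hv N y)
    -- Second countability of the parameter space is enough, so separability of `H10 B` is not
    -- needed.
    have := secondCountableTopologyEither_of_left (ℕ → ℝ) (H10 B)
    exact hcont.aestronglyMeasurable
  · filter_upwards [h, hu] with y hy huy
    obtain ⟨R, hR⟩ := hy.2
    exact BddCont.tendsto_solution hB hP0 hP (fun N => bddCont_kappaPartial hc hb N y) hR hy.1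
      (fun N => hv N y) huy

/-- Nonemptiness of `B` makes `aMin` finite, so that it can serve as a real ellipticity constant. -/
theorem enorm_solution_le (hB : IsOpen B) (hne : B.Nonempty) {P : ℝ} (hP0 : 0 < P)
    (hP : HasPoincare B P) {ψ : ℕ → Space d → ℝ} {y : ℕ → ℝ} {R : ℝ}
    (hR : BddCont B (fun x => kappa ψ x y) R) (h0 : 0 < aMin B ψ y)
    (hle : ∀ x ∈ B, aMin B ψ y ≤ ENNReal.ofReal (coeff ψ y x)) {ς : Hneg1 B} {u : H10 B}
    (hu : IsWeakSolution (coeff ψ y) ς u) :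
    ‖u‖ₑ ≤ ENNReal.ofReal P * (aMin B ψ y)⁻¹ * ‖ς‖ₑ := by
  obtain ⟨x₀, hx₀⟩ := hne
  have htop : aMin B ψ y ≠ ⊤ := ((hle x₀ hx₀).trans_lt ENNReal.ofReal_lt_top).ne
  have hm0 : 0 < (aMin B ψ y).toReal := ENNReal.toReal_pos h0.ne' htop
  have h1 : ‖u‖ ≤ P / (aMin B ψ y).toReal * ‖ς‖ := by
    refine IsWeakSolution.norm_le hP0 hP (hR.bddCoeff_exp hB) hm0 ?_ hu
    filter_upwards [ae_restrict_mem hB.measurableSet] with x hx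
    exact ENNReal.toReal_le_of_le_ofReal (Real.exp_pos _).le (hle x hx)
  rw [← ofReal_norm, ← ofReal_norm, ← ENNReal.ofReal_toReal htop,
    ← ENNReal.ofReal_inv_of_pos hm0, ← ENNReal.ofReal_mul hP0.le,
    ← ENNReal.ofReal_mul (by positivity), ← div_eq_mul_inv]
  exact ENNReal.ofReal_le_ofReal h1

/-- Well-posedness of the boundary value problem with random coefficient `exp κ`, on a domain with
a Poincaré inequality. -/
theorem exists_random_solution (hB : IsOpen B) (hne : B.Nonempty) {P : ℝ} (hP0 : 0 < P)
    (hP : HasPoincare B P) {ψ : ℕ → Space d → ℝ} {β : ℕ → ℝ} (hc : ∀ j, ContinuousOn (ψ j) B)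
    (hb : ∀ j, ∀ x ∈ B, |ψ j x| ≤ β j)
    (h : ∀ᵐ y ∂paramLaw,
      TendstoUniformlyOn (fun N x => kappaPartial ψ N x y) (fun x => kappa ψ x y) atTop B ∧
      ∃ R, BddCont B (fun x => kappa ψ x y) R) (hell : IsUniformlyElliptic B ψ)
    (hmom : ∀ p : ℝ, 1 ≤ p → HasFiniteMoment (fun y => (aMin B ψ y)⁻¹) p) (ς : Hneg1 B) :
    ∃ u : (ℕ → ℝ) → H10 B,
      (∀ᵐ y ∂paramLaw, IsWeakSolution (coeff ψ y) ς (u y)) ∧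
      (∀ w : (ℕ → ℝ) → H10 B,
        (∀ᵐ y ∂paramLaw, IsWeakSolution (coeff ψ y) ς (w y)) → w =ᵐ[paramLaw] u) ∧
      ∀ p : ℝ, 1 ≤ p → MemLp u (ENNReal.ofReal p) paramLaw ∧
        eLpNorm u (ENNReal.ofReal p) paramLaw ≤
          ENNReal.ofReal P * (∫⁻ y, (aMin B ψ y)⁻¹ ^ p ∂paramLaw) ^ (1 / p) * ‖ς‖ₑ := by
  classical
  -- A choice without any measurability, with value `0` where there is no solution; measurability
  -- comes afterwards from the approximation by truncation.
  let u : (ℕ → ℝ) → H10 B := fun y =>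
    if hy : ∃ v, IsWeakSolution (coeff ψ y) ς v then hy.choose else 0
  have hu : ∀ᵐ y ∂paramLaw, IsWeakSolution (coeff ψ y) ς (u y) := by
    filter_upwards [h] with y hy
    obtain ⟨R, hR⟩ := hy.2
    have hex : ∃ v, IsWeakSolution (coeff ψ y) ς v := hR.exists_isWeakSolution hB hP0 hP ς
    simp only [u, hex, dif_pos]
    exact hex.choose_spec
  refine ⟨u, hu, fun w hw => ?_, fun p hp => ?_⟩
  · filter_upwards [h, hu, hw] with y hy huy hwy
    obtain ⟨R, hR⟩ := hy.2
    exact hR.isWeakSolution_unique hB hP0 hP hwy huy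
  have hp0 : 0 < p := by linarith
  have hle : eLpNorm u (ENNReal.ofReal p) paramLaw ≤
      ENNReal.ofReal P * (∫⁻ y, (aMin B ψ y)⁻¹ ^ p ∂paramLaw) ^ (1 / p) * ‖ς‖ₑ := by
    rw [eLpNorm_eq_lintegral_rpow_enorm_toReal (by simpa using hp0) ENNReal.ofReal_ne_top,
      ENNReal.toReal_ofReal hp0.le]
    have h1 : ∫⁻ y, ‖u y‖ₑ ^ p ∂paramLaw ≤
        (ENNReal.ofReal P * ‖ς‖ₑ) ^ p * ∫⁻ y, (aMin B ψ y)⁻¹ ^ p ∂paramLaw := by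
      rw [← lintegral_const_mul' _ _ (ENNReal.rpow_ne_top_of_nonneg hp0.le
        (ENNReal.mul_ne_top ENNReal.ofReal_ne_top enorm_ne_top))]
      refine lintegral_mono_ae ?_
      filter_upwards [h, hu, hell] with y hy huy hey
      obtain ⟨R, hR⟩ := hy.2
      rw [← ENNReal.mul_rpow_of_nonneg _ _ hp0.le]
      refine ENNReal.rpow_le_rpow ?_ hp0.le
      refine (enorm_solution_le hB hne hP0 hP hR hey.1 (fun x hx => (hey.2.2 x hx).1)
        huy).trans (le_of_eq ?_)
      ring
    refine (ENNReal.rpow_le_rpow h1 (by positivity)).trans (le_of_eq ?_)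
    rw [ENNReal.mul_rpow_of_nonneg _ _ (by positivity), ← ENNReal.rpow_mul,
      mul_one_div_cancel hp0.ne', ENNReal.rpow_one]
    ring
  refine ⟨⟨aestronglyMeasurable_solution hB hP0 hP hc hb h hu, hle.trans_lt ?_⟩, hle⟩
  refine ENNReal.mul_lt_top (ENNReal.mul_lt_top ENNReal.ofReal_lt_top ?_) enorm_lt_top
  exact ENNReal.rpow_lt_top_of_nonneg (by positivity) (hmom p hp).2.ne

end RandomProblem

end RandomDiffusion

end

/-! ### Assembly of the two assertions -/

open RandomDiffusion in
theorem lemmaA4 (d : ℕ) (hd : 0 < d) :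
    -- moments of the coefficient
    (∀ (B : Set (Space d)), IsOpen B → B.Nonempty → Bornology.IsBounded B →
      HasLipschitzBoundary B →
      ∀ (s : ℕ), 1 ≤ s → ∀ ψ : ℕ → Space d → ℝ, (∀ j, IsCsOnClosure B s (ψ j)) →
      ∑' j, derivBound B s (ψ j) ^ 2 < ⊤ →
        SeriesConverges B ψ ∧ IsUniformlyElliptic B ψ ∧
        (∀ p υ : ℝ, 1 ≤ p → 0 ≤ υ → υ < s →
          HasFiniteMoment (fun y => sobolevInftyNorm B υ (coeff ψ y)) p) ∧
        (∀ p : ℝ, 1 ≤ p → HasFiniteMoment (aMax B ψ) p ∧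
          HasFiniteMoment (fun y => (aMin B ψ y)⁻¹) p)) ∧
    -- well-posedness of the log-uniform example
    (∃ C : ℝ, 0 < C ∧ ∀ ν : ℝ, 0 < ν → ∀ e : ℕ ≃ (Fin d → ℕ) × (Fin d → Fin 2),
      SeriesConverges (unitCube d) (logUniform ν e) ∧
      IsUniformlyElliptic (unitCube d) (logUniform ν e) ∧
      (∀ p : ℝ, 1 ≤ p → HasFiniteMoment (aMax (unitCube d) (logUniform ν e)) p ∧
        HasFiniteMoment (fun y => (aMin (unitCube d) (logUniform ν e) y)⁻¹) p) ∧
      ∀ ς : Hneg1 (unitCube d), ∃ u : (ℕ → ℝ) → H10 (unitCube d),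
        (∀ᵐ y ∂paramLaw, IsWeakSolution (coeff (logUniform ν e) y) ς (u y)) ∧
        (∀ w : (ℕ → ℝ) → H10 (unitCube d),
          (∀ᵐ y ∂paramLaw, IsWeakSolution (coeff (logUniform ν e) y) ς (w y)) →
            w =ᵐ[paramLaw] u) ∧
        ∀ p : ℝ, 1 ≤ p → MemLp u (ENNReal.ofReal p) paramLaw ∧
          eLpNorm u (ENNReal.ofReal p) paramLaw ≤
            ENNReal.ofReal C *
              (∫⁻ y, (aMin (unitCube d) (logUniform ν e) y)⁻¹ ^ p ∂paramLaw) ^ (1 / p) *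
              ‖ς‖ₑ) := by
  refine ⟨fun B hB hne hbd hL s hs ψ hψ hsum => coeff_moments hB hne hbd hL s hs ψ hψ hsum,
    5, by norm_num, fun ν hν e => ?_⟩
  obtain ⟨η, β, hη0, hη1, hβ, hb, hh⟩ := exists_logUniform_bounds hd hν e
  -- Any exponent below `η` would serve in place of `η / 2`. It depends on `ν`, but the final
  -- constant `5` is the Poincaré constant of the cube and does not.
  obtain ⟨K, hK, hy⟩ := exists_kappa_bound unitCube_nonempty isBounded_unitCube
    (logUniform ν e) β hβ hη1 (half_pos hη0) (half_lt_self hη0) (fun j x _ => hb j x)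
    fun j x _ x' _ => hh j x x'
  obtain ⟨h1, h2, h3⟩ := elliptic_and_moments isOpen_unitCube (half_pos hη0) hK hy
  refine ⟨h1, h2, h3, fun ς => exists_random_solution isOpen_unitCube unitCube_nonempty
    (by norm_num) (hasPoincare_unitCube hd) (β := β) (fun j => ?_) (fun j x _ => hb j x) ?_ h2
    (fun p hp => (h3 p hp).2) ς⟩
  · exact HolderBdd.continuousOn hη0 (M := β j) fun x _ => ⟨hb j x, fun x' _ => hh j x x'⟩
  · filter_upwards [hy] with y hy
    exact ⟨hy.1, K y, HolderBdd.continuousOn (half_pos hη0) hy.2, fun x hx => (hy.2 x hx).1⟩
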